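/- \textbf{Proposition} (the space of Heine--Borel boundedly finite metric measure spaces with the Gromov-Hausdorff-vague topology is Polish). \emph{Spaces.} A metric measure space $\mathcal X=(X,r,\rho,\mu)$ consists of a complete separable metric space $(X,r)$, a root $\rho\in X$ and a Borel measure $\mu$ on $X$; it is boundedly finite if $\mu$ is finite on bounded sets. Two such spaces are equivalent if there is an isometry $\phi$ from $\operatorname{supp}(\mu)\cup\{\rho\}$ onto $\operatorname{supp}(\mu')\cup\{\rho'\}$ with $\phi(\rho)=\rho'$ and $\phi_*\mu=\mu'$. Let $\mathbb X_{\mathrm{HB}}$ be the set of equivalence classes of boundedly finite metric measure spaces that contain a representative in which all closed bounded sets are compact. For $R\ge 0$ let $\mathcal X|_R=(X,r,\rho,\mu|_{\overline B(\rho,R)})$. \emph{Topology.} Metric finite measure spaces $\mathcal X_n=(X_n,r_n,\rho_n,\mu_n)$ converge to $\mathcal X_\infty$ Gromov-Hausdorff-weakly if there are a pointed metric space $(E,d_E,\rho_E)$ and isometric embeddings $\varphi_n\colon\operatorname{supp}(\mu_n)\cup\{\rho_n\}\to E$, $n\in\mathbb N\cup\{\infty\}$, with $\varphi_n(\rho_n)=\rho_E$,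 such that $(\varphi_n)_*\mu_n\to(\varphi_\infty)_*\mu_\infty$ weakly and $\varphi_n(\operatorname{supp}\mu_n)\to\varphi_\infty(\operatorname{supp}\mu_\infty)$ in Hausdorff distance (where $\emptyset$ has distance $\infty$ from every nonempty set). Boundedly finite spaces $\mathcal X_n$ converge to $\mathcal X$ Gromov-Hausdorff-vaguely if $\mathcal X_n|_R\to\mathcal X|_R$ Gromov-Hausdorff-weakly for all but countably many $R>0$. The Gromov-Hausdorff-vague topology on $\mathbb X_{\mathrm{HB}}$ is the one in which a set $U$ is open if and only if every sequence in $\mathbb X_{\mathrm{HB}}$ that converges Gromov-Hausdorff-vaguely to a point of $U$ is eventually in $U$. \emph{Metric.} For metric finite measure spaces $\mathcal X,\mathcal X'$ let $$d_{\mathrm{sGHP}}(\mathcal X,\mathcal X')=\inf_d\Big(d_{\mathrm{Pr}}^{d}(\mu,\mu')+d_{\mathrm H}^{d}(\operatorname{supp}\mu,\operatorname{supp}\mu')+d(\rho,\rho')\Big)+\int_0^1 1\wedge\Big|\frac1{m_\delta(\mathcal X)}-\frac1{m_\delta(\mathcal X')}\Big|\,d\delta ,$$ where the infimum is over all metrics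 $d$ on the disjoint union of $\operatorname{supp}(\mu)\cup\{\rho\}$ and $\operatorname{supp}(\mu')\cup\{\rho'\}$ that extend $r$ and $r'$, $d_{\mathrm{Pr}}^d$ and $d_{\mathrm H}^d$ are the Prohorov and Hausdorff distances for $d$, and $m_\delta(\mathcal X)=\inf\{\mu(\overline B(x,\delta)):x\in\operatorname{supp}\mu\}$ with $\inf\emptyset=\infty$, $1/\infty=0$. For $\mathcal X,\mathcal Y\in\mathbb X_{\mathrm{HB}}$ let $$d^*_{\mathrm{sGHP}}(\mathcal X,\mathcal Y)=\int_0^\infty e^{-R}\big(1\wedge d_{\mathrm{sGHP}}(\mathcal X|_R,\mathcal Y|_R)\big)\,dR .$$ \emph{Claim.} $\mathbb X_{\mathrm{HB}}$ with the Gromov-Hausdorff-vague topology is a Polish space, and a sequence in $\mathbb X_{\mathrm{HB}}$ converges in this topology if and only if it converges Gromov-Hausdorff-vaguely to the same limit. Moreover, for all $\mathcal X,\mathcal Y\in\mathbb X_{\mathrm{HB}}$ the function $R\mapsto d_{\mathrm{sGHP}}(\mathcal X|_R,\mathcal Y|_R)$ is Lebesgue measurable on $[0,\infty)$, and $d^*_{\mathrm{sGHP}}$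 is well defined on equivalence classes and is a complete metric on $\mathbb X_{\mathrm{HB}}$ that induces the Gromov-Hausdorff-vague topology. -/

import Mathlib

open MeasureTheory Filter Topology Set
open scoped ENNReal BoundedContinuousFunction

/-- A pointed, complete, separable metric measure space `(X, r, ρ, μ)` whose Borel measure `μ` is
finite on bounded sets. -/
structure MMSpace : Type 1 where
  carrier : Type
  [metric : MetricSpace carrier]
  [complete : CompleteSpace carrier]
  [separable : TopologicalSpace.SeparableSpace carrier]
  [measurable : MeasurableSpace carrier]
  [borel : BorelSpace carrier]
  root : carrier
  μ : Measure carrier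
  boundedlyFinite : ∀ s : Set carrier, Bornology.IsBounded s → μ s < ∞

namespace MMSpace

attribute [instance] metric complete separable measurable borel

/-- The set `supp μ ∪ {ρ}`, on which the equivalence class of a space depends. -/
def core (X : MMSpace) : Set X.carrier := X.μ.support ∪ {X.root}

/-- The root as a point of `supp μ ∪ {ρ}`. -/
def coreRoot (X : MMSpace) : X.core := ⟨X.root, Or.inr rfl⟩

/-- The support of `μ` as a subset of `supp μ ∪ {ρ}`; it does not contain the root if
`ρ ∉ supp μ`, and it is empty if `μ = 0`. -/
def coreSupport (X : MMSpace) : Set X.core := {x | (x : X.carrier) ∈ X.μ.support}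

/-- The measure `μ` on the closed set `supp μ ∪ {ρ}`, which carries all of its mass. -/
noncomputable def coreMeasure (X : MMSpace) : Measure X.core :=
  X.μ.comap (fun x : X.core => (x : X.carrier))

/-- Equivalence of metric measure spaces: a root preserving and measure preserving isometry of
`supp μ ∪ {ρ}` onto `supp μ' ∪ {ρ'}`. -/
def Equivalent (X Y : MMSpace) : Prop :=
  ∃ φ : X.core ≃ᵢ Y.core, φ X.coreRoot = Y.coreRoot ∧ X.coreMeasure.map φ = Y.coreMeasure

theorem equivalent_equivalence : Equivalence Equivalent where
  refl X := ⟨IsometryEquiv.refl _, rfl, Measure.map_id⟩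
  symm := by
    rintro X Y ⟨φ, hroot, hμ⟩
    refine ⟨φ.symm, by rw [← hroot, φ.symm_apply_apply], ?_⟩
    rw [← hμ, Measure.map_map φ.symm.continuous.measurable φ.continuous.measurable]
    have h : (φ.symm ∘ φ : X.core → X.core) = id := funext φ.symm_apply_apply
    rw [h, Measure.map_id]
  trans := by
    rintro X Y Z ⟨φ, hφ, hμ⟩ ⟨ψ, hψ, hν⟩
    refine ⟨φ.trans ψ, by rw [IsometryEquiv.trans_apply, hφ, hψ], ?_⟩
    rw [← hν, ← hμ, Measure.map_map ψ.continuous.measurable φ.continuous.measurable]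
    rfl

instance equivalenceSetoid : Setoid MMSpace := ⟨Equivalent, equivalent_equivalence⟩

/-- The restriction `X|_R = (X, r, ρ, μ|_{B̄(ρ, R)})` to the closed ball around the root. -/
noncomputable def restrict (X : MMSpace) (R : ℝ) : MMSpace where
  carrier := X.carrier
  root := X.root
  μ := X.μ.restrict (Metric.closedBall X.root R)
  boundedlyFinite s hs := (Measure.restrict_apply_le _ s).trans_lt (X.boundedlyFinite s hs)

/-! ### Gromov-Hausdorff-weak and Gromov-Hausdorff-vague convergence -/

/-- Gromov-Hausdorff-weak convergence of a sequence of metric finite measure spaces: there are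
root preserving isometric embeddings of all `supp μ ∪ {ρ}` into one pointed metric space, such
that the image measures converge weakly and the images of the supports converge in Hausdorff
distance. (The Hausdorff distance of the empty set to a nonempty set is `∞`.) -/
def GHWeakTendsto (X : ℕ → MMSpace) (Y : MMSpace) : Prop :=
  ∃ (E : Type) (_ : MetricSpace E) (_ : MeasurableSpace E) (_ : BorelSpace E) (o : E)
    (φ : ∀ n, (X n).core → E) (ψ : Y.core → E),
    (∀ n, Isometry (φ n)) ∧ Isometry ψ ∧
    (∀ n, φ n (X n).coreRoot = o) ∧ ψ Y.coreRoot = o ∧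
    (∀ f : E →ᵇ ℝ, Tendsto (fun n => ∫ e, f e ∂((X n).coreMeasure.map (φ n))) atTop
      (𝓝 (∫ e, f e ∂(Y.coreMeasure.map ψ)))) ∧
    Tendsto (fun n => Metric.hausdorffEDist (φ n '' (X n).coreSupport) (ψ '' Y.coreSupport))
      atTop (𝓝 0)

/-- Gromov-Hausdorff-vague convergence: Gromov-Hausdorff-weak convergence of the restrictions for
all but countably many `R > 0`. -/
def GHVagueTendsto (X : ℕ → MMSpace) (Y : MMSpace) : Prop :=
  {R : ℝ | 0 < R ∧ ¬ GHWeakTendsto (fun n => (X n).restrict R) (Y.restrict R)}.Countable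

/-! ### The localized support Gromov-Hausdorff-Prohorov metric -/

/-- The lower mass function
`m_δ^R = inf {μ(B̄(x, δ)) | x ∈ B(ρ, R) ∩ supp μ}`, with `inf ∅ = ∞`. -/
noncomputable def lowerMass (X : MMSpace) (R δ : ℝ) : ℝ≥0∞ :=
  ⨅ x ∈ Metric.ball X.root R ∩ X.μ.support, X.μ (Metric.closedBall x δ)

/-- The global lower mass function `m_δ = inf_{R > 0} m_δ^R`. -/
noncomputable def globalLowerMass (X : MMSpace) (δ : ℝ) : ℝ≥0∞ :=
  ⨅ (R : ℝ) (_ : 0 < R), X.lowerMass R δ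

/-- For maps `i`, `j` of `supp μ ∪ {ρ}` and `supp μ' ∪ {ρ'}` into a metric space: the sum of the
Prohorov distance of the image measures, the Hausdorff distance of the images of the supports,
and the distance of the images of the roots. -/
noncomputable def embeddedGHP {E : Type} [MetricSpace E] (X Y : MMSpace)
    (i : X.core → E) (j : Y.core → E) : ℝ≥0∞ :=
  letI : MeasurableSpace E := _root_.borel E
  levyProkhorovEDist (X.coreMeasure.map i) (Y.coreMeasure.map j)
    + Metric.hausdorffEDist (i '' X.coreSupport) (j '' Y.coreSupport)
    + edist (i X.coreRoot) (j Y.coreRoot)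

/-- The Gromov-Hausdorff-Prohorov distance of `(supp μ, r, ρ, μ)` and `(supp μ', r', ρ', μ')`: the
infimum over all metrics on the disjoint union of `supp μ ∪ {ρ}` and `supp μ' ∪ {ρ'}` that extend
both `r` and `r'`. -/
noncomputable def supportGHP (X Y : MMSpace) : ℝ≥0∞ :=
  ⨅ (d : MetricSpace (X.core ⊕ Y.core))
    (_ : ∀ a b : X.core, d.dist (Sum.inl a) (Sum.inl b) = dist a b)
    (_ : ∀ a b : Y.core, d.dist (Sum.inr a) (Sum.inr b) = dist a b),
    @embeddedGHP (X.core ⊕ Y.core) d X Y Sum.inl Sum.inr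

/-- The support Gromov-Hausdorff-Prohorov metric
`d_sGHP(X, Y) = d_GHP(supp X, supp Y) + ∫_0^1 1 ∧ |1 / m_δ(X) - 1 / m_δ(Y)| dδ` for metric finite
measure spaces with compact supports, where `0 < m_δ ≤ ∞`. It is `∞` if exactly one of the two
measures is zero. -/
noncomputable def dsGHP (X Y : MMSpace) : ℝ≥0∞ :=
  X.supportGHP Y
    + ∫⁻ δ in Ioc (0 : ℝ) 1, min 1 (ENNReal.ofReal
        |((X.globalLowerMass δ)⁻¹).toReal - ((Y.globalLowerMass δ)⁻¹).toReal|)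

/-- The localized metric `∫_0^∞ e^{-R} (1 ∧ d_sGHP(X|_R, Y|_R)) dR`. -/
noncomputable def localizedSGHP (X Y : MMSpace) : ℝ :=
  (∫⁻ R in Ici (0 : ℝ), ENNReal.ofReal (Real.exp (-R))
    * min 1 (dsGHP (X.restrict R) (Y.restrict R))).toReal

end MMSpace

/-- The set of equivalence classes of metric boundedly finite measure spaces. -/
def MMClass : Type 1 := Quotient MMSpace.equivalenceSetoid

/-- The set of Heine-Borel boundedly finite measure spaces: equivalence classes that contain a
representative in which every closed bounded set is compact. -/
def HBClass : Type 1 :=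
  {x : MMClass // ∃ X : MMSpace, ProperSpace X.carrier ∧
    (Quotient.mk MMSpace.equivalenceSetoid X : MMClass) = x}

/-- `X` is a representative of the equivalence class `x`. -/
def MMSpace.Represents (X : MMSpace) (x : HBClass) : Prop :=
  (Quotient.mk MMSpace.equivalenceSetoid X : MMClass) = x.1

/-- The Gromov-Hausdorff-vague topology on the space of Heine-Borel boundedly finite measure
spaces: a set is open if every sequence that converges Gromov-Hausdorff-vaguely to a point of the
set is eventually in the set. -/
instance HBClass.ghVagueTopology : TopologicalSpace HBClass where
  IsOpen U := ∀ (X : ℕ → MMSpace) (Y : MMSpace) (x : ℕ → HBClass) (y : HBClass),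
    (∀ n, (X n).Represents (x n)) → Y.Represents y → MMSpace.GHVagueTendsto X Y →
    y ∈ U → ∀ᶠ n in atTop, x n ∈ U
  isOpen_univ := fun _ _ _ _ _ _ _ _ => Eventually.of_forall fun _ => mem_univ _
  isOpen_inter := fun _ _ hU hV X Y x y hX hY h hy =>
    (hU X Y x y hX hY h hy.1).and (hV X Y x y hX hY h hy.2)
  isOpen_sUnion := by
    rintro S hS X Y x y hX hY h ⟨U, hU, hyU⟩
    exact (hS U hU X Y x y hX hY h hyU).mono fun n hn => ⟨U, hU, hn⟩

/-! Everything passes through one relation, `Close X Y S ε`: the cores embed into a common metric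
space so that the roots are within `ε` and, on balls of radius `S`, the measure and the support of
each space are dominated by those of the other up to `ε`. For spaces with proper cores, being
eventually `Close` for all `S` and `ε` describes both convergence in the localized metric and
Gromov-Hausdorff-vague convergence.

From `Close` to the metric: cutting at radius `R` is continuous for all but countably many `R`
(`countable_not_goodRadius`), because ball masses and distances to the truncated support are
monotone in `R`. At such radii closeness passes to the restrictions (`supportGHP_restrict_le`), the
lower mass integral follows for free when the limit has compact support (`tendsto_dsGHP`), and
dominated convergence handles the integral over `R`. Conversely, a small localized distance forces
restrictions beyond radius `S` to be close (`close_of_localizedEDist_lt`). Since bounded parts of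
the supports are compact, weak convergence together with Hausdorff convergence of the supports
amounts to convergence in `supportGHP`; hence `ghVagueTendsto_iff`.

Separation of points: if `X` and `Y` are `Close` at every scale, an ultrafilter limit of almost
isometries is an equivalence (`equivalent_of_close`).

Completeness: a rapidly Cauchy sequence is glued into one proper space (`exists_proper_of_close`),
where the measures have a vague limit by the Riesz theorem. Vague convergence alone could lose
support points whose surrounding mass tends to zero. This is what the lower mass term in the metric
prevents: summable distances give lower mass bounds uniform along the sequence
(`exists_le_globalLowerMass`), so the supports converge as well (`exists_limit_of_close`).

Separability: atomic measures with rational weights at rational points of `ℝᵏ` are dense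
(`exists_close_atomic`). Finally, both topologies are determined by convergent sequences, and these
agree (`ghVagueTopology_eq`). -/

set_option linter.unusedSectionVars false

/-! ### Lévy-Prokhorov distance and weak convergence of finite measures -/

section LevyProkhorov

variable {E F A : Type*} [MetricSpace E] [MeasurableSpace E] [BorelSpace E]
  [MetricSpace F] [MeasurableSpace F] [BorelSpace F] [MeasurableSpace A]

theorem levyProkhorovEDist_le_ofReal {μ ν : Measure E} {ε : ℝ} (hε : 0 ≤ ε)
    (h₁ : ∀ B, MeasurableSet B → μ B ≤ ν (Metric.thickening ε B) + ENNReal.ofReal ε)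
    (h₂ : ∀ B, MeasurableSet B → ν B ≤ μ (Metric.thickening ε B) + ENNReal.ofReal ε) :
    levyProkhorovEDist μ ν ≤ ENNReal.ofReal ε :=
  sInf_le fun B hB => by
    rw [ENNReal.toReal_ofReal hε]
    exact ⟨h₁ B hB, h₂ B hB⟩

theorem measure_le_of_levyProkhorovEDist_lt {μ ν : Measure E} {ε : ℝ} (hε : 0 ≤ ε)
    (h : levyProkhorovEDist μ ν < ENNReal.ofReal ε) {B : Set E} (hB : MeasurableSet B) :
    μ B ≤ ν (Metric.thickening ε B) + ENNReal.ofReal ε := by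
  simpa [ENNReal.toReal_ofReal hε] using left_measure_le_of_levyProkhorovEDist_lt h hB

theorem levyProkhorovEDist_map_le {μ : Measure A} {f g : A → E} (hf : Measurable f)
    (hg : Measurable g) {c : ℝ≥0∞} (h : ∀ x, edist (f x) (g x) ≤ c) :
    levyProkhorovEDist (μ.map f) (μ.map g) ≤ c := by
  refine levyProkhorovEDist_le_of_forall _ _ _ fun ε B hε hε' hB => ?_
  have key : ∀ u v : A → E, Measurable u → Measurable v → (∀ x, edist (u x) (v x) ≤ c) →
      μ.map u B ≤ μ.map v (Metric.thickening ε.toReal B) + ε := by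
    intro u v hu hv huv
    rw [Measure.map_apply hu hB, Measure.map_apply hv Metric.isOpen_thickening.measurableSet]
    refine le_add_right (measure_mono fun x hx => ?_)
    refine (Metric.mem_thickening_iff_exists_edist_lt _ _).2 ⟨u x, hx, ?_⟩
    rw [edist_comm, ENNReal.ofReal_toReal hε'.ne]
    exact (huv x).trans_lt hε
  exact ⟨key f g hf hg h, key g f hg hf fun x => by rw [edist_comm]; exact h x⟩

theorem Isometry.preimage_thickening_image {e : F → E} (he : Isometry e) (ε : ℝ) (B : Set F) :
    e ⁻¹' Metric.thickening ε (e '' B) = Metric.thickening ε B := by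
  ext x
  simp [Metric.mem_thickening_iff, he.dist_eq]

theorem thickening_closure_eq (ε : ℝ) (B : Set E) :
    Metric.thickening ε (closure B) = Metric.thickening ε B := by
  ext x
  simp [Metric.thickening, Metric.infEDist_closure]

/-- The image of a Borel set under `e` need not be Borel, so a set `B` in `F` is tested through
`closure (e '' B)`, which has the same thickenings as `e '' B`. -/
theorem Isometry.levyProkhorovEDist_map {e : F → E} (he : Isometry e) (μ ν : Measure F) :
    levyProkhorovEDist (μ.map e) (ν.map e) = levyProkhorovEDist μ ν := by
  have hm := he.continuous.measurable
  unfold levyProkhorovEDist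
  congr 1
  ext ε
  refine ⟨fun h B hB => ?_, fun h B hB => ?_⟩
  · have key : ∀ μ ν : Measure F, μ.map e (closure (e '' B)) ≤
        ν.map e (Metric.thickening ε.toReal (closure (e '' B))) + ε →
        μ B ≤ ν (Metric.thickening ε.toReal B) + ε := by
      intro μ ν h
      rw [thickening_closure_eq, Measure.map_apply hm isClosed_closure.measurableSet,
        Measure.map_apply hm Metric.isOpen_thickening.measurableSet,
        he.preimage_thickening_image] at h
      refine (measure_mono ?_).trans h
      exact fun x hx => subset_closure (mem_image_of_mem e hx)
    have := h (closure (e '' B)) isClosed_closure.measurableSet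
    exact ⟨key μ ν this.1, key ν μ this.2⟩
  · have key : ∀ μ ν : Measure F, μ (e ⁻¹' B) ≤ ν (Metric.thickening ε.toReal (e ⁻¹' B)) + ε →
        μ.map e B ≤ ν.map e (Metric.thickening ε.toReal B) + ε := by
      intro μ ν h
      rw [Measure.map_apply hm hB, Measure.map_apply hm Metric.isOpen_thickening.measurableSet]
      refine h.trans (add_le_add (measure_mono ?_) le_rfl)
      rw [← he.preimage_thickening_image]
      exact preimage_mono (Metric.thickening_subset_of_subset _ (image_preimage_subset _ _))
    have := h (e ⁻¹' B) (hm hB)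
    exact ⟨key μ ν this.1, key ν μ this.2⟩

/-- By the layer cake formula the integral is controlled by the `ν`-mass of thickened superlevel
sets. These sets are closed, so the bound tends to the integral against `ν` as the thickening
shrinks. -/
theorem eventually_integral_le_of_levyProkhorovEDist {μ : ℕ → Measure E} {ν : Measure E}
    [∀ n, IsFiniteMeasure (μ n)] [IsFiniteMeasure ν]
    (h : Tendsto (fun n => levyProkhorovEDist (μ n) ν) atTop (𝓝 0)) (f : E →ᵇ ℝ)
    (hf : ∀ x, 0 ≤ f x) {δ : ℝ} (hδ : 0 < δ) :
    ∀ᶠ n in atTop, ∫ x, f x ∂μ n ≤ ∫ x, f x ∂ν + δ := by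
  have key : Tendsto (fun ε : ℝ => ∫ t in Ioc 0 ‖f‖, ν.real (Metric.thickening ε {a | t ≤ f a}))
      (𝓝[>] 0) (𝓝 (∫ t in Ioc 0 ‖f‖, ν.real {a | t ≤ f a})) := by
    apply tendsto_integral_filter_of_dominated_convergence (fun _ => ν.real univ)
    · refine Eventually.of_forall fun ε => (Measurable.ennreal_toReal
        (Antitone.measurable fun s t hst => ?_)).aestronglyMeasurable
      exact measure_mono (Metric.thickening_subset_of_subset _ fun ω h => hst.trans h)
    · refine Eventually.of_forall fun ε => Eventually.of_forall fun t => ?_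
      rw [Real.norm_eq_abs, abs_of_nonneg measureReal_nonneg]
      exact measureReal_mono (subset_univ _)
    · exact integrable_const _
    · refine Eventually.of_forall fun t => (ENNReal.tendsto_toReal (measure_ne_top _ _)).comp ?_
      exact tendsto_measure_thickening_of_isClosed ⟨1, one_pos, measure_ne_top _ _⟩
        (isClosed_le continuous_const f.continuous)
  rw [← BoundedContinuousFunction.integral_eq_integral_meas_le f ν (Eventually.of_forall hf)] at key
  have key2 : Tendsto (fun ε : ℝ => (∫ t in Ioc 0 ‖f‖,
      ν.real (Metric.thickening ε {a | t ≤ f a})) + ε * ‖f‖) (𝓝[>] 0) (𝓝 (∫ x, f x ∂ν)) := by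
    have : Tendsto (fun ε : ℝ => ε * ‖f‖) (𝓝[>] 0) (𝓝 0) := by
      have : Tendsto (fun ε : ℝ => ε * ‖f‖) (𝓝 0) (𝓝 (0 * ‖f‖)) := tendsto_id.mul_const _
      rw [zero_mul] at this
      exact this.mono_left nhdsWithin_le_nhds
    simpa using key.add this
  obtain ⟨ε, hε, hε0⟩ := ((key2.eventually (gt_mem_nhds (lt_add_of_pos_right _ hδ))).and
    self_mem_nhdsWithin).exists
  filter_upwards [h.eventually (gt_mem_nhds (ENNReal.ofReal_pos.2 hε0))] with n hn
  exact (BoundedContinuousFunction.integral_le_of_levyProkhorovEDist_lt _ _ hε0 hn f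
    (Eventually.of_forall hf)).trans hε.le

/-- The one-sided estimate for nonnegative functions is applied to `‖f‖ + f` and `‖f‖ - f`. The
masses are not normalized, so their convergence is obtained separately from the test set `univ`. -/
theorem tendsto_integral_of_levyProkhorovEDist {μ : ℕ → Measure E} {ν : Measure E}
    [∀ n, IsFiniteMeasure (μ n)] [IsFiniteMeasure ν]
    (h : Tendsto (fun n => levyProkhorovEDist (μ n) ν) atTop (𝓝 0)) (f : E →ᵇ ℝ) :
    Tendsto (fun n => ∫ x, f x ∂μ n) atTop (𝓝 (∫ x, f x ∂ν)) := by
  have mass : Tendsto (fun n => (μ n).real univ) atTop (𝓝 (ν.real univ)) := by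
    rw [Metric.tendsto_nhds]
    intro ε hε
    filter_upwards [h.eventually (gt_mem_nhds (ENNReal.ofReal_pos.2 (half_pos hε)))] with n hn
    have a := measure_le_of_levyProkhorovEDist_lt (half_pos hε).le hn MeasurableSet.univ
    rw [levyProkhorovEDist_comm] at hn
    have b := measure_le_of_levyProkhorovEDist_lt (half_pos hε).le hn MeasurableSet.univ
    have key : ∀ μ ν : Measure E, [IsFiniteMeasure μ] → [IsFiniteMeasure ν] →
        μ univ ≤ ν (Metric.thickening (ε / 2) univ) + ENNReal.ofReal (ε / 2) →
        μ.real univ ≤ ν.real univ + ε / 2 := by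
      intro μ ν _ _ h
      have := ENNReal.toReal_mono (by finiteness)
        (h.trans (add_le_add (measure_mono (subset_univ _)) le_rfl))
      rwa [ENNReal.toReal_add (by finiteness) (by finiteness),
        ENNReal.toReal_ofReal (half_pos hε).le] at this
    have a := key _ _ a
    have b := key _ _ b
    rw [Real.dist_eq, abs_lt]
    constructor <;> linarith
  have up := fun δ (hδ : (0:ℝ) < δ) => eventually_integral_le_of_levyProkhorovEDist h
    (f + BoundedContinuousFunction.const E ‖f‖)
    (fun x => by have := (abs_le.1 (f.norm_coe_le_norm x)).1; simp; linarith) hδ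
  have dn := fun δ (hδ : (0:ℝ) < δ) => eventually_integral_le_of_levyProkhorovEDist h
    (BoundedContinuousFunction.const E ‖f‖ - f)
    (fun x => by have := (abs_le.1 (f.norm_coe_le_norm x)).2; simp; linarith) hδ
  rw [Metric.tendsto_nhds]
  intro ε hε
  have hm := mass.mul_const ‖f‖
  rw [Metric.tendsto_nhds] at hm
  filter_upwards [up (ε / 2) (half_pos hε), dn (ε / 2) (half_pos hε), hm (ε / 2) (half_pos hε)]
    with n h1 h2 h3
  have i1 : ∀ μ : Measure E, [IsFiniteMeasure μ] →
      ∫ x, (f + BoundedContinuousFunction.const E ‖f‖) x ∂μ = ∫ x, f x ∂μ + μ.real univ * ‖f‖ := by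
    intro μ _
    simp only [BoundedContinuousFunction.coe_add, Pi.add_apply,
      BoundedContinuousFunction.const_apply]
    rw [integral_add (f.integrable μ) (integrable_const _)]
    simp
  have i2 : ∀ μ : Measure E, [IsFiniteMeasure μ] →
      ∫ x, (BoundedContinuousFunction.const E ‖f‖ - f) x ∂μ = μ.real univ * ‖f‖ - ∫ x, f x ∂μ := by
    intro μ _
    simp only [BoundedContinuousFunction.coe_sub, Pi.sub_apply,
      BoundedContinuousFunction.const_apply]
    rw [integral_sub (integrable_const _) (f.integrable μ)]
    simp
  rw [i1, i1] at h1
  rw [i2, i2] at h2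
  rw [Real.dist_eq, abs_lt] at h3 ⊢
  constructor <;> linarith [h3.1, h3.2]

/-- On a compact set, weak convergence implies convergence in the Lévy-Prokhorov distance. -/
theorem tendsto_levyProkhorovEDist_of_integral {μ : ℕ → Measure E} {ν : Measure E}
    [∀ n, IsFiniteMeasure (μ n)] [IsFiniteMeasure ν] {K : Set E} (hK : IsCompact K)
    (hν : ν Kᶜ = 0)
    (h : ∀ f : E →ᵇ ℝ, Tendsto (fun n => ∫ x, f x ∂μ n) atTop (𝓝 (∫ x, f x ∂ν))) :
    Tendsto (fun n => levyProkhorovEDist (μ n) ν) atTop (𝓝 0) := by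
  suffices H : ∀ ε : ℝ, 0 < ε → ∀ᶠ n in atTop,
      levyProkhorovEDist (μ n) ν ≤ ENNReal.ofReal (5 * ε) by
    rw [ENNReal.tendsto_nhds_zero]
    intro c hc
    obtain ⟨r, hr, hr0⟩ := ENNReal.lt_iff_exists_nnreal_btwn.1 hc
    have hr' : (0:ℝ) < r := by exact_mod_cast hr
    filter_upwards [H (r / 5) (by positivity)] with n hn
    refine hn.trans ?_
    rw [mul_div_cancel₀ _ (by norm_num), ENNReal.ofReal_coe_nnreal]
    exact hr0.le
  intro ε hε
  obtain ⟨t, htf, ht⟩ := Metric.totallyBounded_iff.1 hK.totallyBounded ε hε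
  have hfin : (𝒫 t).Finite := htf.finite_subsets
  -- A Borel set is replaced by the set `J ⊆ t` of centres whose `2ε`-ball meets it. Only finitely
  -- many `J` occur, so convergence of the corresponding integrals is uniform over all Borel sets.
  let g : ℝ → Set E → (E →ᵇ ℝ) := fun r J =>
    BoundedContinuousFunction.comp _ (LipschitzWith.of_dist_le_mul (K := 1)
      (fun a b => by simp [NNReal.dist_eq, Real.dist_eq]) : LipschitzWith 1 ((↑) : NNReal → ℝ))
      (thickenedIndicator hε (Metric.thickening r J))
  have g_def : ∀ r J x, g r J x = (thickenedIndicator hε (Metric.thickening r J) x : ℝ) :=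
    fun _ _ _ => rfl
  have g_nonneg : ∀ r J x, 0 ≤ g r J x := fun r J x => NNReal.coe_nonneg _
  have g_one : ∀ r J x, x ∈ Metric.thickening r J → g r J x = 1 := fun r J x hx => by
    rw [g_def, thickenedIndicator_one hε _ hx]; rfl
  have g_zero : ∀ r J x, x ∉ Metric.thickening (r + ε) J → g r J x = 0 := fun r J x hx => by
    rw [g_def, thickenedIndicator_zero hε _ fun h' => hx ?_]; · rfl
    have := Metric.thickening_thickening_subset ε r J h'
    rwa [add_comm] at this
  have g_le : ∀ r J x, g r J x ≤ 1 := fun r J x => by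
    exact_mod_cast thickenedIndicator_le_one hε (Metric.thickening r J) x
  have lower : ∀ (μ : Measure E) [IsFiniteMeasure μ] (r : ℝ) J,
      μ.real (Metric.thickening r J) ≤ ∫ x, g r J x ∂μ := by
    intro μ _ r J
    rw [← integral_indicator_one Metric.isOpen_thickening.measurableSet]
    refine integral_mono ((integrable_const 1).indicator
      Metric.isOpen_thickening.measurableSet) ((g r J).integrable μ) fun x => ?_
    by_cases hx : x ∈ Metric.thickening r J
    · simp [hx, g_one r J x hx]
    · simp [hx, g_nonneg r J x]
  have upper : ∀ (μ : Measure E) [IsFiniteMeasure μ] (r : ℝ) J,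
      ∫ x, g r J x ∂μ ≤ μ.real (Metric.thickening (r + ε) J) := by
    intro μ _ r J
    rw [← integral_indicator_one Metric.isOpen_thickening.measurableSet]
    refine integral_mono ((g r J).integrable μ) ((integrable_const 1).indicator
      Metric.isOpen_thickening.measurableSet) fun x => ?_
    by_cases hx : x ∈ Metric.thickening (r + ε) J
    · simpa [hx] using g_le r J x
    · simp [hx, g_zero r J x hx]
  have ev : ∀ r, ∀ᶠ n in atTop, ∀ J ∈ 𝒫 t, |∫ x, g r J x ∂μ n - ∫ x, g r J x ∂ν| < ε := by
    intro r
    rw [eventually_all_finite hfin]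
    exact fun J _ => Metric.tendsto_nhds.1 (h (g r J)) ε hε
  have ev1 : ∀ᶠ n in atTop, |(μ n).real univ - ν.real univ| < ε := by
    have := Metric.tendsto_nhds.1 (h (BoundedContinuousFunction.const E 1)) ε hε
    simpa [Real.dist_eq] using this
  have hae : Metric.thickening ε t ∈ ae ν := by
    refine mem_of_superset (mem_ae_iff.2 hν) ?_
    rw [Metric.thickening_eq_biUnion_ball]; exact ht
  have hνt : ν.real (Metric.thickening ε t) = ν.real univ :=
    measureReal_congr (eventuallyEq_univ.2 hae)
  have hνK : ∀ B, ν.real B ≤ ν.real (B ∩ Metric.thickening (2 * ε) t) := by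
    intro B
    refine (measureReal_congr ?_).le
    have : Metric.thickening (2 * ε) t ∈ ae ν :=
      mem_of_superset hae (Metric.thickening_mono (by linarith) _)
    exact (inter_ae_eq_left_of_ae_eq_univ (eventuallyEq_univ.2 this)).symm
  have cover : ∀ B : Set E, B ∩ Metric.thickening (2 * ε) t ⊆ Metric.thickening (2 * ε)
      {z ∈ t | (B ∩ Metric.ball z (2 * ε)).Nonempty} := by
    rintro B x ⟨hxB, hxt⟩
    obtain ⟨z, hz, hxz⟩ := Metric.mem_thickening_iff.1 hxt
    exact Metric.mem_thickening_iff.2 ⟨z, ⟨hz, x, hxB, hxz⟩, hxz⟩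
  have back : ∀ B : Set E, Metric.thickening (2 * ε + ε)
      {z ∈ t | (B ∩ Metric.ball z (2 * ε)).Nonempty} ⊆ Metric.thickening (5 * ε) B := by
    intro B x hx
    obtain ⟨z, ⟨hz, y, hy, hyz⟩, hxz⟩ := Metric.mem_thickening_iff.1 hx
    refine Metric.mem_thickening_iff.2 ⟨y, hy, ?_⟩
    have := dist_triangle_right x y z
    rw [Metric.mem_ball] at hyz
    linarith
  filter_upwards [ev ε, ev (2 * ε), ev1] with n hn0 hn hn1
  have conv : ∀ (μ ν : Measure E) [IsFiniteMeasure μ] [IsFiniteMeasure ν] (B : Set E),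
      μ.real B ≤ ν.real (Metric.thickening (5 * ε) B) + 5 * ε →
      μ B ≤ ν (Metric.thickening (5 * ε) B) + ENNReal.ofReal (5 * ε) := by
    intro μ ν _ _ B h
    rw [← ofReal_measureReal (measure_ne_top μ B), ← ofReal_measureReal (measure_ne_top ν _),
      ← ENNReal.ofReal_add measureReal_nonneg (by positivity)]
    exact ENNReal.ofReal_le_ofReal h
  have chain : ∀ (μ ν : Measure E) [IsFiniteMeasure μ] [IsFiniteMeasure ν] (B : Set E),
      (∀ J ∈ 𝒫 t, ∫ x, g (2 * ε) J x ∂μ ≤ ∫ x, g (2 * ε) J x ∂ν + ε) →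
      μ.real (B ∩ Metric.thickening (2 * ε) t) ≤ ν.real (Metric.thickening (5 * ε) B) + ε := by
    intro μ ν _ _ B h
    have h1 := measureReal_mono (cover B) (μ := μ)
    have h2 := lower μ (2 * ε) {z ∈ t | (B ∩ Metric.ball z (2 * ε)).Nonempty}
    have h3 := upper ν (2 * ε) {z ∈ t | (B ∩ Metric.ball z (2 * ε)).Nonempty}
    have h4 := measureReal_mono (back B) (μ := ν)
    have h5 := h {z ∈ t | (B ∩ Metric.ball z (2 * ε)).Nonempty} fun z hz => hz.1
    linarith
  refine levyProkhorovEDist_le_ofReal (by positivity) (fun B hB => conv _ _ _ ?_)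
    fun B hB => conv _ _ _ ?_
  -- Only `ν` is known to live on `K`. The mass of `μ n` outside the `2ε`-thickening of `t` is at
  -- most `2ε`, since the total masses are close and `ν` is carried by the `ε`-thickening.
  · have h1 := chain (μ n) ν B fun J hJ => by have := (abs_lt.1 (hn J hJ)); linarith [this.2]
    have h2 := measureReal_inter_add_sdiff (μ := μ n) (s := B)
      (Metric.isOpen_thickening (δ := 2 * ε) (E := t)).measurableSet
    have h3 := measureReal_mono (sdiff_subset_compl B (Metric.thickening (2 * ε) t)) (μ := μ n)
    have h4 := measureReal_add_measureReal_compl (μ := μ n)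
      (Metric.isOpen_thickening (δ := 2 * ε) (E := t)).measurableSet
    have h5 := upper (μ n) ε t
    have h6 := (abs_lt.1 (hn0 t (Subset.refl t))).1
    have h7 := lower ν ε t
    have h8 := (abs_lt.1 hn1).2
    rw [← two_mul] at h5
    linarith
  · have h1 := chain ν (μ n) B fun J hJ => by have := (abs_lt.1 (hn J hJ)); linarith [this.1]
    linarith [hνK B]

end LevyProkhorov

/-! ### Gluing metric spaces and embedding them into a normed space -/

section Gluing

/-- Amalgamation of two metric spaces along a common nonempty subspace. -/
theorem exists_amalgam {A P Q : Type} [MetricSpace A] [MetricSpace P] [MetricSpace Q] [Nonempty A]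
    {l : A → P} {r : A → Q} (hl : Isometry l) (hr : Isometry r) :
    ∃ (E : Type) (_ : MetricSpace E) (i : P → E) (j : Q → E), Isometry i ∧ Isometry j ∧
      ∀ a, i (l a) = j (r a) :=
  ⟨Metric.GlueSpace hl hr, inferInstance, Metric.toGlueL hl hr, Metric.toGlueR hl hr,
    Metric.toGlueL_isometry hl hr, Metric.toGlueR_isometry hl hr,
    fun a => congrFun (Metric.toGlue_commute hl hr) a⟩

/-- A metric space together with an isometric embedding of `P`. -/
structure MetricExtension (P : Type) [MetricSpace P] where
  space : Type
  [metric : MetricSpace space]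
  map : P → space
  isometry : Isometry map

attribute [instance] MetricExtension.metric

/-- Infinitely many metric spaces `P n` can be glued successively along common subspaces. -/
theorem exists_chain_amalgam {A P : ℕ → Type} [∀ n, MetricSpace (A n)] [∀ n, MetricSpace (P n)]
    [∀ n, Nonempty (A n)] {l : ∀ n, A n → P n} {r : ∀ n, A (n + 1) → P n}
    (hl : ∀ n, Isometry (l n)) (hr : ∀ n, Isometry (r n)) :
    ∃ (E : Type) (_ : MetricSpace E) (e : ∀ n, P n → E), (∀ n, Isometry (e n)) ∧
      ∀ n a, e n (r n a) = e (n + 1) (l (n + 1) a) := by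
  have step : ∀ (n : ℕ) (W : MetricExtension (P n)), ∃ (V : MetricExtension (P (n + 1)))
      (f : W.space → V.space), Isometry f ∧ ∀ a, f (W.map (r n a)) = V.map (l (n + 1) a) := by
    intro n W
    obtain ⟨E, _, i, j, hi, hj, hij⟩ := exists_amalgam (W.isometry.comp (hr n)) (hl (n + 1))
    exact ⟨⟨E, j, hj⟩, i, hi, hij⟩
  choose V f hf hV using step
  let W : ∀ n, MetricExtension (P n) := fun n =>
    Nat.rec (motive := fun n => MetricExtension (P n)) ⟨P 0, id, isometry_id⟩ (fun n W => V n W) n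
  have I : ∀ n, Isometry (f n (W n)) := fun n => hf n (W n)
  refine ⟨Metric.InductiveLimit (X := fun n => (W n).space) (f := fun n => f n (W n)) I,
    inferInstance, fun n p => Metric.toInductiveLimit I n ((W n).map p),
    fun n => (Metric.toInductiveLimit_isometry I n).comp (W n).isometry, fun n a => ?_⟩
  have h1 := congrFun (Metric.toInductiveLimit_commute I n) ((W n).map (r n a))
  have h2 : f n (W n) ((W n).map (r n a)) = (W (n + 1)).map (l (n + 1) a) := hV n (W n) a
  exact h1.symm.trans (congrArg (Metric.toInductiveLimit I (n + 1)) h2)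

/-- The Kuratowski embedding into the space of bounded continuous functions. -/
theorem exists_isometry_boundedContinuousFunction (E : Type) [MetricSpace E] :
    ∃ κ : E → (E →ᵇ ℝ), Isometry κ := by
  rcases isEmpty_or_nonempty E with h | ⟨⟨o⟩⟩
  · exact ⟨fun x => (h.false x).elim, fun x => (h.false x).elim⟩
  let κ : E → (E →ᵇ ℝ) := fun x => BoundedContinuousFunction.ofNormedAddCommGroup
    (fun z => dist x z - dist o z) (by fun_prop) (dist x o) fun z => by
      rw [Real.norm_eq_abs]; exact abs_dist_sub_le x o z
  refine ⟨κ, Isometry.of_dist_eq fun x y => le_antisymm ?_ ?_⟩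
  · refine (BoundedContinuousFunction.dist_le dist_nonneg).2 fun z => ?_
    change |dist x z - dist o z - (dist y z - dist o z)| ≤ _
    rw [sub_sub_sub_cancel_right]
    exact abs_dist_sub_le x y z
  · have := BoundedContinuousFunction.dist_coe_le_dist (f := κ x) (g := κ y) y
    refine le_trans ?_ this
    change _ ≤ |dist x y - dist o y - (dist y y - dist o y)|
    rw [sub_sub_sub_cancel_right, dist_self, sub_zero]
    exact le_abs_self _

end Gluing

/-! ### The core, its measure, and restriction to balls -/

namespace MMSpace

section Core

theorem isClosed_core (X : MMSpace) : IsClosed X.core :=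
  X.μ.isClosed_support.union isClosed_singleton

instance (X : MMSpace) : CompleteSpace X.core := X.isClosed_core.completeSpace_coe

instance (X : MMSpace) : Nonempty X.core := ⟨X.coreRoot⟩

instance (X : MMSpace) : SecondCountableTopology X.carrier :=
  UniformSpace.secondCountable_of_separable X.carrier

theorem measure_compl_core (X : MMSpace) : X.μ X.coreᶜ = 0 :=
  measure_mono_null (compl_subset_compl.2 subset_union_left) Measure.measure_compl_support

theorem measurableEmbedding_core (X : MMSpace) :
    MeasurableEmbedding (Subtype.val : X.core → X.carrier) :=
  MeasurableEmbedding.subtype_coe X.isClosed_core.measurableSet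

theorem coreMeasure_map_val (X : MMSpace) : X.coreMeasure.map Subtype.val = X.μ := by
  have := X.measurableEmbedding_core.map_comap X.μ
  rw [coreMeasure, this, Subtype.range_coe]
  exact Measure.restrict_eq_self_of_ae_mem X.measure_compl_core

theorem coreMeasure_preimage (X : MMSpace) (s : Set X.carrier) :
    X.coreMeasure (Subtype.val ⁻¹' s) = X.μ s := by
  conv_rhs => rw [← X.coreMeasure_map_val]
  exact (X.measurableEmbedding_core.map_apply _ _).symm

theorem coreMeasure_lt_top (X : MMSpace) {s : Set X.core} (hs : Bornology.IsBounded s) :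
    X.coreMeasure s < ∞ := by
  have h : s = Subtype.val ⁻¹' (Subtype.val '' s) := (preimage_image_eq _ Subtype.val_injective).symm
  rw [h, coreMeasure_preimage]
  exact X.boundedlyFinite _ (isometry_subtype_coe.lipschitz.isBounded_image hs)

theorem isClosed_coreSupport (X : MMSpace) : IsClosed X.coreSupport :=
  X.μ.isClosed_support.preimage continuous_subtype_val

theorem coreSupport_eq (X : MMSpace) : X.coreMeasure.support = X.coreSupport := by
  ext x
  rw [Measure.mem_support_iff_forall]
  change _ ↔ (x : X.carrier) ∈ X.μ.support
  rw [Measure.mem_support_iff_forall]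
  refine ⟨fun h U hU => ?_, fun h U hU => ?_⟩
  · rw [← coreMeasure_preimage]
    exact h _ (continuous_subtype_val.continuousAt.preimage_mem_nhds hU)
  · obtain ⟨V, hV, hVU⟩ := mem_nhds_subtype _ _ _ |>.1 hU
    have := h V hV
    rw [← coreMeasure_preimage] at this
    exact this.trans_le (measure_mono hVU)

theorem core_eq (X : MMSpace) (x : X.core) : x ∈ X.coreSupport ∨ x = X.coreRoot := by
  rcases x.2 with h | h
  · exact Or.inl h
  · exact Or.inr (Subtype.ext h)

variable {E : Type} [MetricSpace E] [MeasurableSpace E] [BorelSpace E]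

/-- Completeness of `F` makes the image of the support closed, so no closure appears on the
right-hand side. -/
theorem _root_.Isometry.support_map {F : Type} [MetricSpace F] [CompleteSpace F]
    [MeasurableSpace F] [BorelSpace F] [SecondCountableTopology F] {e : F → E} (he : Isometry e)
    (μ : Measure F) : (μ.map e).support = e '' μ.support := by
  have hm := he.continuous.measurable
  apply Subset.antisymm
  · refine Measure.support_subset_of_isClosed ?_ ?_
    · exact he.isClosedEmbedding.isClosedMap _ μ.isClosed_support
    · rw [mem_ae_iff, Measure.map_apply hm (he.isClosedEmbedding.isClosedMap _
        μ.isClosed_support).isOpen_compl.measurableSet]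
      refine measure_mono_null (fun x hx hx' => hx (mem_image_of_mem e hx'))
        Measure.measure_compl_support
  · rintro _ ⟨x, hx, rfl⟩
    rw [Measure.mem_support_iff_forall] at hx ⊢
    intro U hU
    exact (hx _ (he.continuous.continuousAt.preimage_mem_nhds hU)).trans_le
      (Measure.le_map_apply hm.aemeasurable U)

theorem support_map (X : MMSpace) {i : X.core → E} (hi : Isometry i) :
    (X.coreMeasure.map i).support = i '' X.coreSupport := by
  rw [hi.support_map, coreSupport_eq]

theorem map_coreMeasure_lt_top (X : MMSpace) {i : X.core → E} (hi : Isometry i) {s : Set E}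
    (hs : Bornology.IsBounded s) : X.coreMeasure.map i s < ∞ := by
  have hc : Bornology.IsBounded (closure s) := hs.closure
  refine (measure_mono subset_closure).trans_lt ?_
  rw [Measure.map_apply hi.continuous.measurable isClosed_closure.measurableSet]
  exact X.coreMeasure_lt_top (hi.antilipschitz.isBounded_preimage hc)

theorem embeddedGHP_eq (X Y : MMSpace) (i : X.core → E) (j : Y.core → E) :
    embeddedGHP X Y i j = levyProkhorovEDist (X.coreMeasure.map i) (Y.coreMeasure.map j)
      + Metric.hausdorffEDist (i '' X.coreSupport) (j '' Y.coreSupport)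
      + edist (i X.coreRoot) (j Y.coreRoot) := by
  obtain rfl : ‹MeasurableSpace E› = _root_.borel E := BorelSpace.measurable_eq
  rfl

theorem core_restrict_subset (X : MMSpace) (R : ℝ) :
    (X.restrict R).core ⊆ X.core :=
  union_subset_union_left _ (Measure.support_mono Measure.restrict_le_self)

/-- The inclusion of the core of a restriction. -/
def coreInclusion (X : MMSpace) (R : ℝ) : (X.restrict R).core → X.core :=
  Set.inclusion (X.core_restrict_subset R)

theorem isometry_coreInclusion (X : MMSpace) (R : ℝ) : Isometry (X.coreInclusion R) :=
  Isometry.of_dist_eq fun _ _ => rfl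

theorem coreInclusion_coreRoot (X : MMSpace) (R : ℝ) :
    X.coreInclusion R (X.restrict R).coreRoot = X.coreRoot := rfl

theorem coreMeasure_map_coreInclusion (X : MMSpace) (R : ℝ) :
    (X.restrict R).coreMeasure.map (X.coreInclusion R) =
      X.coreMeasure.restrict (Metric.closedBall X.coreRoot R) := by
  have h1 : ((X.restrict R).coreMeasure.map (X.coreInclusion R)).map Subtype.val =
      (X.coreMeasure.restrict (Metric.closedBall X.coreRoot R)).map Subtype.val := by
    rw [Measure.map_map measurable_subtype_coe
      (X.isometry_coreInclusion R).continuous.measurable]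
    have h2 : (Subtype.val ∘ X.coreInclusion R) = Subtype.val := rfl
    rw [h2]
    refine ((X.restrict R).coreMeasure_map_val).trans ?_
    change X.μ.restrict (Metric.closedBall X.root R) = _
    conv_lhs => rw [← X.coreMeasure_map_val]
    rw [Measure.restrict_map measurable_subtype_coe Metric.isClosed_closedBall.measurableSet]
    rfl
  ext s hs
  obtain ⟨t, ht, rfl⟩ := hs
  rw [← Measure.map_apply measurable_subtype_coe ht, h1, Measure.map_apply measurable_subtype_coe ht]

theorem map_restrict_coreMeasure (X : MMSpace) (R : ℝ) {i : X.core → E} (hi : Isometry i) :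
    (X.restrict R).coreMeasure.map (i ∘ X.coreInclusion R) =
      (X.coreMeasure.map i).restrict (Metric.closedBall (i X.coreRoot) R) := by
  rw [← Measure.map_map hi.continuous.measurable (X.isometry_coreInclusion R).continuous.measurable,
    coreMeasure_map_coreInclusion, Measure.restrict_map hi.continuous.measurable
      Metric.isClosed_closedBall.measurableSet, hi.preimage_closedBall]

instance (X : MMSpace) (R : ℝ) : IsFiniteMeasure (X.restrict R).μ :=
  ⟨by
    change X.μ.restrict (Metric.closedBall X.root R) univ < ∞
    rw [Measure.restrict_apply_univ]
    exact X.boundedlyFinite _ Metric.isBounded_closedBall⟩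

instance isFiniteMeasure_coreMeasure (X : MMSpace) [IsFiniteMeasure X.μ] :
    IsFiniteMeasure X.coreMeasure :=
  ⟨by rw [← preimage_univ (f := Subtype.val), coreMeasure_preimage]; exact measure_lt_top _ _⟩

end Core
end MMSpace

/-! ### The support Gromov-Hausdorff-Prohorov distance as a pseudometric -/

namespace MMSpace

section SupportGHP

variable {E F : Type} [MetricSpace E] [MetricSpace F]

theorem embeddedGHP_comp (X Y : MMSpace) {i : X.core → E} {j : Y.core → E} (hi : Isometry i)
    (hj : Isometry j) {e : E → F} (he : Isometry e) :
    embeddedGHP X Y (e ∘ i) (e ∘ j) = embeddedGHP X Y i j := by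
  borelize E
  borelize F
  rw [embeddedGHP_eq, embeddedGHP_eq, image_comp, image_comp, Metric.hausdorffEDist_image he,
    ← Measure.map_map he.continuous.measurable hi.continuous.measurable,
    ← Measure.map_map he.continuous.measurable hj.continuous.measurable,
    he.levyProkhorovEDist_map, Function.comp_apply, Function.comp_apply, he.edist_eq]

theorem embeddedGHP_comm (X Y : MMSpace) (i : X.core → E) (j : Y.core → E) :
    embeddedGHP X Y i j = embeddedGHP Y X j i := by
  borelize E
  rw [embeddedGHP_eq, embeddedGHP_eq, levyProkhorovEDist_comm, Metric.hausdorffEDist_comm,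
    edist_comm]

theorem embeddedGHP_triangle (X Y Z : MMSpace) (i : X.core → E) (j : Y.core → E)
    (k : Z.core → E) :
    embeddedGHP X Z i k ≤ embeddedGHP X Y i j + embeddedGHP Y Z j k := by
  borelize E
  rw [embeddedGHP_eq, embeddedGHP_eq, embeddedGHP_eq, add_add_add_comm,
    add_add_add_comm (levyProkhorovEDist _ _)]
  gcongr
  · exact levyProkhorovEDist_triangle _ _ _
  · exact Metric.hausdorffEDist_triangle
  · exact edist_triangle _ _ _

theorem embeddedGHP_self_le (X : MMSpace) {i j : X.core → E} (hi : Isometry i) (hj : Isometry j)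
    {c : ℝ≥0∞} (h : ∀ x, edist (i x) (j x) ≤ c) : embeddedGHP X X i j ≤ c + c + c := by
  borelize E
  rw [embeddedGHP_eq]
  gcongr
  · exact levyProkhorovEDist_map_le hi.continuous.measurable hj.continuous.measurable h
  · refine Metric.hausdorffEDist_le_of_mem_edist ?_ ?_
    · rintro _ ⟨x, hx, rfl⟩
      exact ⟨_, mem_image_of_mem _ hx, h x⟩
    · rintro _ ⟨x, hx, rfl⟩
      exact ⟨_, mem_image_of_mem _ hx, by rw [edist_comm]; exact h x⟩
  · exact h _

/-- The images of `i` and `j` may overlap, in which case `E` induces only a pseudometric on the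
disjoint union. Placing the two copies at heights `0` and `ε / 3` in `E × ℝ` separates them, and
each of the three summands grows by at most `ε / 3`. -/
theorem supportGHP_le (X Y : MMSpace) {i : X.core → E} {j : Y.core → E} (hi : Isometry i)
    (hj : Isometry j) : X.supportGHP Y ≤ embeddedGHP X Y i j := by
  refine ENNReal.le_of_forall_pos_le_add fun ε hε _ => ?_
  have hε3 : (0:ℝ) < ε / 3 := by positivity
  let e : X.core ⊕ Y.core → E × ℝ := Sum.elim (fun a => (i a, 0)) (fun b => (j b, (ε / 3 : ℝ)))
  have he : Function.Injective e := by
    rintro (a | a) (b | b) h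
    · exact congrArg _ (hi.injective (Prod.ext_iff.1 h).1)
    · exact absurd (Prod.ext_iff.1 h).2 hε3.ne
    · exact absurd (Prod.ext_iff.1 h).2 hε3.ne'
    · exact congrArg _ (hj.injective (Prod.ext_iff.1 h).1)
  let d : MetricSpace (X.core ⊕ Y.core) := MetricSpace.induced e he inferInstance
  have hei : Isometry e := Isometry.of_dist_eq fun _ _ => rfl
  have hl : ∀ a b : X.core, d.dist (Sum.inl a) (Sum.inl b) = dist a b := fun a b => by
    change dist (i a, (0:ℝ)) (i b, (0:ℝ)) = _
    simp [Prod.dist_eq, hi.dist_eq]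
  have hr : ∀ a b : Y.core, d.dist (Sum.inr a) (Sum.inr b) = dist a b := fun a b => by
    change dist (j a, (ε / 3 : ℝ)) (j b, (ε / 3 : ℝ)) = _
    simp [Prod.dist_eq, hj.dist_eq]
  refine (iInf_le_of_le d (iInf_le_of_le hl (iInf_le _ hr))).trans ?_
  have h0 : ∀ t : ℝ, Isometry fun x : E => (x, t) := fun t =>
    Isometry.of_dist_eq fun x y => by simp [Prod.dist_eq]
  rw [← embeddedGHP_comp X Y (Isometry.of_dist_eq hl) (Isometry.of_dist_eq hr) hei]
  have e1 : e ∘ Sum.inl = (fun x : E => (x, (0:ℝ))) ∘ i := rfl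
  have e2 : e ∘ Sum.inr = (fun x : E => (x, (ε / 3 : ℝ))) ∘ j := rfl
  rw [e1, e2]
  refine (embeddedGHP_triangle X Y Y _ ((fun x : E => (x, (0:ℝ))) ∘ j) _).trans ?_
  rw [embeddedGHP_comp X Y hi hj (h0 0)]
  gcongr
  refine (embeddedGHP_self_le Y ((h0 0).comp hj) ((h0 _).comp hj) (c := (ε / 3 : NNReal))
    fun x => ?_).trans_eq ?_
  · rw [edist_le_coe, ← NNReal.coe_le_coe, coe_nndist]
    simp [Prod.dist_eq]
    positivity
  · norm_cast
    rw [← two_mul, ← add_one_mul]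
    ring_nf

theorem exists_embeddedGHP_lt {X Y : MMSpace} {c : ℝ≥0∞} (h : X.supportGHP Y < c) :
    ∃ (E : Type) (_ : MetricSpace E) (i : X.core → E) (j : Y.core → E), Isometry i ∧ Isometry j ∧
      embeddedGHP X Y i j < c := by
  simp only [supportGHP, iInf_lt_iff] at h
  obtain ⟨d, hl, hr, h⟩ := h
  exact ⟨_, d, Sum.inl, Sum.inr, Isometry.of_dist_eq hl, Isometry.of_dist_eq hr, h⟩

theorem exists_embeddedGHP_le (X Y : MMSpace) {c : ℝ≥0∞} (hc : c ≠ 0) :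
    ∃ (E : Type) (_ : MetricSpace E) (i : X.core → E) (j : Y.core → E), Isometry i ∧ Isometry j ∧
      embeddedGHP X Y i j ≤ X.supportGHP Y + c := by
  by_cases h : X.supportGHP Y = ∞
  · let := Metric.metricSpaceSum (X := X.core) (Y := Y.core)
    exact ⟨X.core ⊕ Y.core, this, Sum.inl, Sum.inr, Metric.isometry_inl, Metric.isometry_inr,
      by simp [h]⟩
  · obtain ⟨E, m, i, j, hi, hj, h⟩ := exists_embeddedGHP_lt (ENNReal.lt_add_right h hc)
    exact ⟨E, m, i, j, hi, hj, h.le⟩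

theorem supportGHP_comm (X Y : MMSpace) : X.supportGHP Y = Y.supportGHP X := by
  have key : ∀ X Y : MMSpace, X.supportGHP Y ≤ Y.supportGHP X := fun X Y => by
    refine le_of_forall_gt fun c hc => ?_
    obtain ⟨E, m, i, j, hi, hj, h⟩ := exists_embeddedGHP_lt hc
    rw [embeddedGHP_comm] at h
    exact (supportGHP_le X Y hj hi).trans_lt h
  exact le_antisymm (key X Y) (key Y X)

/-- Two almost optimal embeddings are amalgamated along the core of `Y`, and the triangle inequality
is used in the resulting space. -/
theorem supportGHP_triangle (X Y Z : MMSpace) :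
    X.supportGHP Z ≤ X.supportGHP Y + Y.supportGHP Z := by
  refine ENNReal.le_of_forall_pos_le_add fun ε hε _ => ?_
  have hε2 : ((ε / 2 : NNReal) : ℝ≥0∞) ≠ 0 := by simpa using hε.ne'
  obtain ⟨E, _, i, j, hi, hj, h⟩ := exists_embeddedGHP_le X Y hε2
  obtain ⟨F, _, j', k, hj', hk, h'⟩ := exists_embeddedGHP_le Y Z hε2
  obtain ⟨G, _, u, v, hu, hv, huv⟩ := exists_amalgam hj hj'
  have e : u ∘ j = v ∘ j' := funext huv
  refine (supportGHP_le X Z (hu.comp hi) (hv.comp hk)).trans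
    ((embeddedGHP_triangle X Y Z _ (u ∘ j) _).trans ?_)
  rw [embeddedGHP_comp X Y hi hj hu, e, embeddedGHP_comp Y Z hj' hk hv]
  refine (add_le_add h h').trans_eq ?_
  rw [add_add_add_comm]
  congr 1
  norm_cast
  exact add_halves ε

theorem supportGHP_self (X : MMSpace) : X.supportGHP X = 0 := by
  refine le_antisymm ((supportGHP_le X X isometry_id isometry_id).trans ?_) zero_le
  refine (embeddedGHP_self_le X isometry_id isometry_id (c := 0) fun x => by simp).trans (by simp)

end SupportGHP
end MMSpace

/-! ### Local comparison of measures and their restriction to balls -/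

section NearAt

variable {E F : Type} [MetricSpace E] [MeasurableSpace E] [BorelSpace E]
  [MetricSpace F] [MeasurableSpace F] [BorelSpace F]

/-- On the closed ball `B̄(o, S)`, the measure `M` and its support are dominated by `N` and its
support, up to an error `ε`. -/
structure NearAt (o : E) (S ε : ℝ) (M N : Measure E) : Prop where
  mass : ∀ B, MeasurableSet B → B ⊆ Metric.closedBall o S →
    M B ≤ N (Metric.thickening ε B) + ENNReal.ofReal ε
  supp : ∀ x ∈ M.support, dist x o ≤ S → ∃ y ∈ N.support, dist x y < ε

theorem NearAt.refl (o : E) (S : ℝ) {ε : ℝ} (hε : 0 < ε) (M : Measure E) : NearAt o S ε M M :=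
  ⟨fun B _ _ => le_add_right (measure_mono (Metric.self_subset_thickening hε B)),
    fun x hx _ => ⟨x, hx, by simpa⟩⟩

theorem NearAt.mono {o o' : E} {S S' ε ε' : ℝ} {M N : Measure E} (h : NearAt o S ε M N)
    (hS : S' + dist o' o ≤ S) (hε : ε ≤ ε') : NearAt o' S' ε' M N where
  mass B hB hBS := (h.mass B hB (hBS.trans (Metric.closedBall_subset_closedBall' hS))).trans
    (add_le_add (measure_mono (Metric.thickening_mono hε B)) (ENNReal.ofReal_le_ofReal hε))
  supp x hx hxS := by
    obtain ⟨y, hy, hxy⟩ := h.supp x hx (by linarith [dist_triangle x o' o])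
    exact ⟨y, hy, hxy.trans_le hε⟩

theorem NearAt.trans {o : E} {S ε ε' : ℝ} {M N L : Measure E} (hε : 0 ≤ ε) (hε' : 0 ≤ ε')
    (h : NearAt o S ε M N) (h' : NearAt o (S + ε) ε' N L) : NearAt o S (ε + ε') M L where
  mass B hB hBS := by
    have h1 : Metric.thickening ε B ⊆ Metric.closedBall o (S + ε) := by
      intro x hx
      obtain ⟨z, hz, hxz⟩ := Metric.mem_thickening_iff.1 hx
      have := hBS hz
      rw [Metric.mem_closedBall] at this ⊢
      linarith [dist_triangle x z o]
    refine (h.mass B hB hBS).trans ((add_le_add (h'.mass _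
      Metric.isOpen_thickening.measurableSet h1) le_rfl).trans ?_)
    rw [add_assoc, ← ENNReal.ofReal_add hε' hε, add_comm ε' ε]
    gcongr
    rw [add_comm ε ε']
    exact Metric.thickening_thickening_subset _ _ _
  supp x hx hxS := by
    obtain ⟨y, hy, hxy⟩ := h.supp x hx hxS
    obtain ⟨z, hz, hyz⟩ := h'.supp y hy (by linarith [dist_triangle_left y o x])
    exact ⟨z, hz, by linarith [dist_triangle x y z]⟩

/-- The mass and the support of `N` change little near the sphere of radius `R` around `s`. -/
structure ShellBound (N : Measure E) (s : E) (R η ε : ℝ) : Prop where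
  mass : N (Metric.closedBall s (R + η) \ Metric.closedBall s (R - η)) ≤ ENNReal.ofReal ε
  supp : ∀ y ∈ N.support, dist y s ≤ R + η → ∃ y' ∈ N.support, dist y' s ≤ R - η ∧ dist y y' < ε

theorem ShellBound.map [CompleteSpace F] [SecondCountableTopology F] {e : F → E} (he : Isometry e)
    {N : Measure F} {s : F} {R η ε : ℝ} (h : ShellBound N s R η ε) :
    ShellBound (N.map e) (e s) R η ε where
  mass := by
    rw [Measure.map_apply he.continuous.measurable (Metric.isClosed_closedBall.measurableSet.diff
      Metric.isClosed_closedBall.measurableSet), preimage_sdiff, he.preimage_closedBall,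
      he.preimage_closedBall]
    exact h.mass
  supp := by
    rw [he.support_map]
    rintro _ ⟨x, hx, rfl⟩ hxo
    rw [he.dist_eq] at hxo
    obtain ⟨y, hy, hy1, hxy⟩ := h.supp x hx hxo
    exact ⟨_, mem_image_of_mem e hy, by rwa [he.dist_eq], by rwa [he.dist_eq]⟩

/-- The inequality is strict because a support point on the sphere can drop out of the support of
the restriction. -/
theorem mem_support_restrict_closedBall {M : Measure E} {r x : E} {R : ℝ} (hx : x ∈ M.support)
    (h : dist x r < R) : x ∈ (M.restrict (Metric.closedBall r R)).support :=
  Measure.interior_inter_support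
    ⟨interior_mono Metric.ball_subset_closedBall (by rwa [Metric.isOpen_ball.interior_eq]), hx⟩

theorem support_restrict_closedBall {M : Measure E} {r x : E} {R : ℝ}
    (hx : x ∈ (M.restrict (Metric.closedBall r R)).support) : x ∈ M.support ∧ dist x r ≤ R := by
  have := Measure.support_restrict_subset hx
  rw [Metric.isClosed_closedBall.closure_eq] at this
  exact ⟨this.2, this.1⟩

variable {M N : Measure E} {r s : E} {S ε ε' R R' η : ℝ}

/-- Thickening by `ε` and moving the centre and the radius by at most `ε` each displaces the
boundary by at most `3 * ε`, which is less than `η`. The mass that crosses it lies in the shell of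
`N`, so only `N` needs a shell bound. For the estimate of `N` by `M`, the test set is first cut down
to radius `R - η`, so that its thickening stays inside the ball of `M`. -/
theorem levyProkhorovEDist_restrict_le (hMN : NearAt r S ε M N) (hNM : NearAt s S ε N M)
    (hrs : dist r s ≤ ε) (hε : 0 < ε) (hε' : 0 < ε') (hη : 4 * ε ≤ η) (hR : |R' - R| ≤ ε)
    (hS : R + ε ≤ S) (hN : ShellBound N s R η ε') :
    levyProkhorovEDist (M.restrict (Metric.closedBall r R'))
      (N.restrict (Metric.closedBall s R)) ≤ ENNReal.ofReal (ε + ε') := by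
  obtain ⟨hR1, hR2⟩ := abs_le.1 hR
  have shell : ∀ A : Set E, A ⊆ Metric.closedBall s (R + η) → ∀ t, R - η ≤ t →
      N A ≤ N (A ∩ Metric.closedBall s t) + ENNReal.ofReal ε' := by
    intro A hA t ht
    refine (measure_mono ?_).trans ((measure_union_le _ _).trans (add_le_add le_rfl hN.mass))
    intro x hx
    by_cases hxt : x ∈ Metric.closedBall s t
    · exact Or.inl ⟨hx, hxt⟩
    · exact Or.inr ⟨hA hx, fun h => hxt (Metric.closedBall_subset_closedBall ht h)⟩
  have thick : ∀ (A : Set E) (o : E) (t : ℝ), A ⊆ Metric.closedBall o t →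
      Metric.thickening ε A ⊆ Metric.closedBall o (t + ε) := by
    intro A o t hA x hx
    obtain ⟨z, hz, hxz⟩ := Metric.mem_thickening_iff.1 hx
    have := hA hz
    rw [Metric.mem_closedBall] at this ⊢
    linarith [dist_triangle x z o]
  refine levyProkhorovEDist_le_ofReal (by positivity) (fun B hB => ?_) fun B hB => ?_
  · rw [Measure.restrict_apply hB, Measure.restrict_apply Metric.isOpen_thickening.measurableSet]
    refine (hMN.mass _ (hB.inter Metric.isClosed_closedBall.measurableSet)
      (inter_subset_right.trans (Metric.closedBall_subset_closedBall (by linarith)))).trans ?_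
    rw [ENNReal.ofReal_add hε.le hε'.le, add_comm (ENNReal.ofReal ε), ← add_assoc]
    gcongr
    have h1 := thick (B ∩ Metric.closedBall r R') r R' inter_subset_right
    refine (shell _ (h1.trans (Metric.closedBall_subset_closedBall' (by linarith))) R
      (by linarith)).trans ?_
    gcongr
    · exact (Metric.thickening_subset_of_subset _ inter_subset_left).trans
        (Metric.thickening_mono (by linarith) B)
  · rw [Measure.restrict_apply hB, Measure.restrict_apply Metric.isOpen_thickening.measurableSet]
    refine (shell _ (inter_subset_right.trans (Metric.closedBall_subset_closedBall (by linarith)))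
      (R - η) le_rfl).trans ?_
    have h0 : B ∩ Metric.closedBall s R ∩ Metric.closedBall s (R - η) ⊆
      Metric.closedBall s (R - η) := inter_subset_right
    refine (add_le_add (hNM.mass _ ((hB.inter Metric.isClosed_closedBall.measurableSet).inter
      Metric.isClosed_closedBall.measurableSet)
      (h0.trans (Metric.closedBall_subset_closedBall (by linarith)))) le_rfl).trans ?_
    rw [ENNReal.ofReal_add hε.le hε'.le, ← add_assoc]
    gcongr
    refine subset_inter ?_ ?_
    · exact (Metric.thickening_subset_of_subset _
        (inter_subset_left.trans inter_subset_left)).trans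
        (Metric.thickening_mono (by linarith) B)
    · refine (thick _ _ _ h0).trans (Metric.closedBall_subset_closedBall' ?_)
      rw [dist_comm] at hrs
      linarith

/-- A support point near the sphere is first replaced by one at distance at most `R - η` from `s`,
using the shell bound. Its approximant then lies strictly inside the other ball and survives the
restriction. -/
theorem hausdorffEDist_support_restrict_le (hMN : NearAt r S ε M N) (hNM : NearAt s S ε N M)
    (hrs : dist r s ≤ ε) (hε : 0 < ε) (hη : 4 * ε ≤ η) (hR : |R' - R| ≤ ε)
    (hS : R + ε ≤ S) (hN : ShellBound N s R η ε') :
    Metric.hausdorffEDist (M.restrict (Metric.closedBall r R')).support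
      (N.restrict (Metric.closedBall s R)).support ≤ ENNReal.ofReal (ε + ε') := by
  obtain ⟨hR1, hR2⟩ := abs_le.1 hR
  refine Metric.hausdorffEDist_le_of_mem_edist (fun x hx => ?_) fun y hy => ?_
  · obtain ⟨hxM, hxr⟩ := support_restrict_closedBall hx
    obtain ⟨y, hy, hxy⟩ := hMN.supp x hxM (by linarith)
    obtain ⟨y', hy', h1, h2⟩ := hN.supp y hy (by
      linarith [dist_triangle y x s, dist_triangle x r s, dist_comm x y])
    refine ⟨y', mem_support_restrict_closedBall hy' (by linarith), ?_⟩
    rw [edist_dist]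
    exact ENNReal.ofReal_le_ofReal (by linarith [dist_triangle x y y'])
  · obtain ⟨hyN, hys⟩ := support_restrict_closedBall hy
    obtain ⟨y', hy', h1, h2⟩ := hN.supp y hyN (by linarith)
    obtain ⟨x, hx, hxy⟩ := hNM.supp y' hy' (by linarith)
    refine ⟨x, mem_support_restrict_closedBall hx ?_, ?_⟩
    · linarith [dist_triangle x y' r, dist_triangle y' s r, dist_comm x y', dist_comm r s]
    · rw [edist_dist]
      exact ENNReal.ofReal_le_ofReal (by linarith [dist_triangle y y' x])

end NearAt

/-! ### Closeness of spaces on large balls -/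

namespace MMSpace

/-- The spaces `X` and `Y` can be embedded into a common metric space such that they are close to
each other on balls of radius `S` around their roots. -/
def Close (X Y : MMSpace) (S ε : ℝ) : Prop :=
  ∃ (E : Type) (_ : MetricSpace E) (_ : MeasurableSpace E) (_ : BorelSpace E)
    (i : X.core → E) (j : Y.core → E), Isometry i ∧ Isometry j ∧
    NearAt (i X.coreRoot) S ε (X.coreMeasure.map i) (Y.coreMeasure.map j) ∧
    NearAt (j Y.coreRoot) S ε (Y.coreMeasure.map j) (X.coreMeasure.map i) ∧
    dist (i X.coreRoot) (j Y.coreRoot) ≤ ε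

/-- The restriction of `X` to the closed ball of radius `R` depends continuously on the radius
at `R`. -/
def GoodRadius (X : MMSpace) (R : ℝ) : Prop :=
  ∀ ε > 0, ∃ η > 0, ShellBound X.coreMeasure X.coreRoot R η ε

theorem supportGHP_restrict_le {X Y : MMSpace} {S ε ε' R R' η : ℝ} (h : X.Close Y S ε)
    (hε : 0 < ε) (hε' : 0 < ε') (hη : 4 * ε ≤ η) (hR : |R' - R| ≤ ε)
    (hS : R + ε ≤ S) (hN : ShellBound Y.coreMeasure Y.coreRoot R η ε') :
    (X.restrict R').supportGHP (Y.restrict R) ≤ ENNReal.ofReal (3 * (ε + ε')) := by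
  obtain ⟨E, _, _, _, i, j, hi, hj, hMN, hNM, hrs⟩ := h
  refine (supportGHP_le _ _ (hi.comp (X.isometry_coreInclusion R'))
    (hj.comp (Y.isometry_coreInclusion R))).trans ?_
  rw [embeddedGHP_eq, ← support_map _ (hi.comp (X.isometry_coreInclusion R')),
    ← support_map _ (hj.comp (Y.isometry_coreInclusion R)), map_restrict_coreMeasure _ _ hi,
    map_restrict_coreMeasure _ _ hj]
  have e : ENNReal.ofReal (3 * (ε + ε')) = ENNReal.ofReal (ε + ε') + ENNReal.ofReal (ε + ε') +
      ENNReal.ofReal (ε + ε') := by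
    rw [← ENNReal.ofReal_add, ← ENNReal.ofReal_add]
    · ring_nf
    all_goals positivity
  rw [e]
  refine add_le_add (add_le_add ?_ ?_) ?_
  · exact levyProkhorovEDist_restrict_le hMN hNM hrs hε hε' hη hR hS (hN.map hj)
  · exact hausdorffEDist_support_restrict_le hMN hNM hrs hε hη hR hS (hN.map hj)
  · rw [edist_dist]
    exact ENNReal.ofReal_le_ofReal (hrs.trans (by linarith))

theorem close_self (X : MMSpace) (S : ℝ) {ε : ℝ} (hε : 0 < ε) : X.Close X S ε :=
  ⟨X.core, inferInstance, inferInstance, inferInstance, id, id, isometry_id, isometry_id,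
    NearAt.refl _ _ hε _, NearAt.refl _ _ hε _, by simpa using hε.le⟩

theorem Close.mono {X Y : MMSpace} {S S' ε ε' : ℝ} (h : X.Close Y S ε) (hS : S' ≤ S)
    (hε : ε ≤ ε') : X.Close Y S' ε' := by
  obtain ⟨E, m1, m2, m3, i, j, hi, hj, hMN, hNM, hrs⟩ := h
  exact ⟨E, m1, m2, m3, i, j, hi, hj, hMN.mono (by simpa) hε, hNM.mono (by simpa) hε,
    hrs.trans hε⟩

/-- Closeness of two restrictions in the Gromov-Hausdorff-Prohorov distance implies closeness of
the unrestricted spaces on smaller balls. -/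
theorem close_of_supportGHP_restrict_lt {X Y : MMSpace} {S S' ε : ℝ} (hε : 0 < ε) (hS : S' < S)
    (h : (X.restrict S).supportGHP (Y.restrict S) < ENNReal.ofReal ε) : X.Close Y S' ε := by
  obtain ⟨P, _, i₀, j₀, hi₀, hj₀, h₀⟩ := exists_embeddedGHP_lt h
  -- The hypothesis embeds only the cores of the restrictions. The full cores are glued on along the
  -- inclusions, first that of `X`, then that of `Y`.
  obtain ⟨Q, _, u, i, hu, hi, hui⟩ := exists_amalgam hi₀ (X.isometry_coreInclusion S)
  obtain ⟨E, _, v, j, hv, hj, hvj⟩ := exists_amalgam (hu.comp hj₀) (Y.isometry_coreInclusion S)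
  rw [← embeddedGHP_comp _ _ hi₀ hj₀ (hv.comp hu)] at h₀
  have e1 : (v ∘ u) ∘ i₀ = (v ∘ i) ∘ X.coreInclusion S := funext fun a => congrArg v (hui a)
  have e2 : (v ∘ u) ∘ j₀ = j ∘ Y.coreInclusion S := funext hvj
  have hvi := hv.comp hi
  borelize E
  rw [e1, e2, embeddedGHP_eq, ← support_map _ (hvi.comp (X.isometry_coreInclusion S)),
    ← support_map _ (hj.comp (Y.isometry_coreInclusion S)), map_restrict_coreMeasure _ _ hvi,
    map_restrict_coreMeasure _ _ hj] at h₀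
  simp only [Function.comp_apply, coreInclusion_coreRoot] at h₀
  have key : ∀ (M N : Measure E) (r s : E), levyProkhorovEDist
      (M.restrict (Metric.closedBall r S)) (N.restrict (Metric.closedBall s S)) <
      ENNReal.ofReal ε → Metric.hausdorffEDist (M.restrict (Metric.closedBall r S)).support
      (N.restrict (Metric.closedBall s S)).support < ENNReal.ofReal ε → NearAt r S' ε M N := by
    intro M N r s h1 h2
    refine ⟨fun B hB hBS => ?_, fun x hx hxr => ?_⟩
    · have := measure_le_of_levyProkhorovEDist_lt hε.le h1 hB
      rw [Measure.restrict_apply hB, inter_eq_self_of_subset_left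
        (hBS.trans (Metric.closedBall_subset_closedBall hS.le))] at this
      exact this.trans (add_le_add (Measure.restrict_apply_le _ _) le_rfl)
    · obtain ⟨y, hy, hxy⟩ := Metric.exists_edist_lt_of_hausdorffEDist_lt
        (mem_support_restrict_closedBall hx (hxr.trans_lt hS)) h2
      refine ⟨y, (support_restrict_closedBall hy).1, ?_⟩
      rw [edist_dist] at hxy
      exact (ENNReal.ofReal_lt_ofReal_iff hε).1 hxy
  have h1 := ((le_self_add.trans le_self_add).trans_lt h₀)
  have h2 := ((le_add_self.trans le_self_add).trans_lt h₀)
  refine ⟨E, inferInstance, inferInstance, inferInstance, v ∘ i, j, hvi, hj, key _ _ _ _ h1 h2,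
    key _ _ (j Y.coreRoot) ((v ∘ i) X.coreRoot) ?_ ?_, ?_⟩
  · rwa [levyProkhorovEDist_comm]
  · rwa [Metric.hausdorffEDist_comm]
  · have h3 := le_add_self.trans_lt h₀
    rw [edist_dist] at h3
    exact ((ENNReal.ofReal_lt_ofReal_iff hε).1 h3).le

end MMSpace

/-! ### Lower mass functions and the distance `dsGHP` -/

namespace MMSpace

section LowerMass

theorem globalLowerMass_eq (X : MMSpace) (δ : ℝ) :
    X.globalLowerMass δ = ⨅ x ∈ X.coreSupport, X.coreMeasure (Metric.closedBall x δ) := by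
  have hball : ∀ x : X.core, X.coreMeasure (Metric.closedBall x δ) =
      X.μ (Metric.closedBall (x : X.carrier) δ) := fun x => by
    rw [← coreMeasure_preimage]; rfl
  refine le_antisymm (le_iInf₂ fun x hx => ?_) ?_
  · rw [hball]
    refine iInf₂_le_of_le (dist (x : X.carrier) X.root + 1) (by positivity)
      (iInf₂_le_of_le (x : X.carrier) ⟨?_, hx⟩ le_rfl)
    simp
  · refine le_iInf₂ fun R hR => le_iInf₂ fun x hx => ?_
    exact (iInf₂_le (⟨x, Or.inl hx.2⟩ : X.core) hx.2).trans_eq (hball _)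

theorem globalLowerMass_mono (X : MMSpace) : Monotone X.globalLowerMass := fun a b hab => by
  rw [globalLowerMass_eq, globalLowerMass_eq]
  exact iInf₂_mono fun x _ => measure_mono (Metric.closedBall_subset_closedBall hab)

/-- A support point `y` of `Y` has a support point `x` of `X` within `ε`, and the `ε`-thickening of
the `δ`-ball at `x` lies in the `(δ + 2ε)`-ball at `y`. -/
theorem globalLowerMass_le_add {X Y : MMSpace} {ε : ℝ} (hε : 0 < ε)
    (h : X.supportGHP Y < ENNReal.ofReal ε) (δ : ℝ) :
    X.globalLowerMass δ ≤ Y.globalLowerMass (δ + 2 * ε) + ENNReal.ofReal ε := by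
  obtain ⟨E, _, i, j, hi, hj, h⟩ := exists_embeddedGHP_lt h
  borelize E
  rw [embeddedGHP_eq] at h
  rw [← tsub_le_iff_right, globalLowerMass_eq Y]
  refine le_iInf₂ fun y hy => tsub_le_iff_right.2 ?_
  rw [Metric.hausdorffEDist_comm] at h
  obtain ⟨_, ⟨x, hx, rfl⟩, hxy⟩ := Metric.exists_edist_lt_of_hausdorffEDist_lt
    (mem_image_of_mem j hy) ((le_add_self.trans le_self_add).trans_lt h)
  rw [globalLowerMass_eq]
  refine (iInf₂_le x hx).trans ?_
  have h1 := measure_le_of_levyProkhorovEDist_lt hε.le ((le_self_add.trans le_self_add).trans_lt h)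
    (Metric.isClosed_closedBall (x := i x) (ε := δ)).measurableSet
  rw [Measure.map_apply hi.continuous.measurable Metric.isClosed_closedBall.measurableSet,
    hi.preimage_closedBall, Measure.map_apply hj.continuous.measurable
    Metric.isOpen_thickening.measurableSet] at h1
  refine h1.trans (add_le_add (measure_mono fun z hz => ?_) le_rfl)
  obtain ⟨w, hw, hzw⟩ := Metric.mem_thickening_iff.1 hz
  rw [edist_dist, ENNReal.ofReal_lt_ofReal_iff hε] at hxy
  rw [Metric.mem_closedBall] at hw ⊢
  rw [← hj.dist_eq]
  linarith [dist_triangle4 (j z) w (i x) (j y), dist_comm (i x) (j y)]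

/-- Finitely many `δ / 2`-balls centred in the support cover it. Each has positive mass, and every
`δ`-ball around a support point contains one of them. -/
theorem globalLowerMass_pos {X : MMSpace} (hX : IsCompact X.coreSupport) {δ : ℝ} (hδ : 0 < δ) :
    0 < X.globalLowerMass δ := by
  obtain ⟨t, htK, ht⟩ := hX.elim_nhds_subcover (fun x => Metric.ball x (δ / 2))
    fun x _ => Metric.ball_mem_nhds x (half_pos hδ)
  have h1 : 0 < t.inf fun x => X.coreMeasure (Metric.ball x (δ / 2)) := by
    refine (Finset.lt_inf_iff ENNReal.zero_lt_top).2 fun x hx => ?_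
    have := htK x hx
    rw [← coreSupport_eq, Measure.mem_support_iff_forall] at this
    exact this _ (Metric.ball_mem_nhds x (half_pos hδ))
  rw [globalLowerMass_eq]
  refine h1.trans_le (le_iInf₂ fun x hx => ?_)
  obtain ⟨y, hy, hxy⟩ := mem_iUnion₂.1 (ht hx)
  refine (Finset.inf_le hy).trans (measure_mono fun z hz => ?_)
  rw [Metric.mem_ball] at hz hxy
  rw [Metric.mem_closedBall]
  linarith [dist_triangle_right z x y]

theorem tendsto_globalLowerMass {X : ℕ → MMSpace} {Y : MMSpace}
    (h : Tendsto (fun n => (X n).supportGHP Y) atTop (𝓝 0)) {δ : ℝ}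
    (hδ : ContinuousAt Y.globalLowerMass δ) :
    Tendsto (fun n => (X n).globalLowerMass δ) atTop (𝓝 (Y.globalLowerMass δ)) := by
  have lim : ∀ c : ℝ, Tendsto (fun ε : ℝ => Y.globalLowerMass (δ + c * ε)) (𝓝[>] 0)
      (𝓝 (Y.globalLowerMass δ)) := fun c => by
    have h1 : Tendsto (fun ε : ℝ => δ + c * ε) (𝓝[>] 0) (𝓝 δ) := by
      have : Tendsto (fun ε : ℝ => δ + c * ε) (𝓝 0) (𝓝 (δ + c * 0)) :=
        (tendsto_const_nhds.add (tendsto_id.const_mul c))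
      rw [mul_zero, add_zero] at this
      exact this.mono_left nhdsWithin_le_nhds
    exact hδ.tendsto.comp h1
  have lim0 : Tendsto (fun ε : ℝ => ENNReal.ofReal ε) (𝓝[>] 0) (𝓝 0) := by
    have : Tendsto (fun ε : ℝ => ENNReal.ofReal ε) (𝓝 0) (𝓝 (ENNReal.ofReal 0)) :=
      ENNReal.continuous_ofReal.tendsto 0
    rw [ENNReal.ofReal_zero] at this
    exact this.mono_left nhdsWithin_le_nhds
  refine tendsto_order.2 ⟨fun a ha => ?_, fun b hb => ?_⟩
  · have := ENNReal.Tendsto.sub (lim (-2)) lim0 (Or.inr ENNReal.zero_ne_top)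
    rw [tsub_zero] at this
    obtain ⟨ε, h1, hε⟩ := ((this.eventually (lt_mem_nhds ha)).and self_mem_nhdsWithin).exists
    filter_upwards [h.eventually (gt_mem_nhds (ENNReal.ofReal_pos.2 hε))] with n hn
    rw [supportGHP_comm] at hn
    have := globalLowerMass_le_add hε hn (δ + -2 * ε)
    rw [show δ + -2 * ε + 2 * ε = δ by ring] at this
    exact h1.trans_le (tsub_le_iff_right.2 this)
  · have := (lim 2).add lim0
    rw [add_zero] at this
    obtain ⟨ε, h1, hε⟩ := ((this.eventually (gt_mem_nhds hb)).and self_mem_nhdsWithin).exists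
    filter_upwards [h.eventually (gt_mem_nhds (ENNReal.ofReal_pos.2 hε))] with n hn
    exact (globalLowerMass_le_add hε hn δ).trans_lt h1

end LowerMass

section DsGHP

/-- The integrand comparing the lower mass functions in the metric `dsGHP`. -/
noncomputable def lowerMassGap (X Y : MMSpace) (δ : ℝ) : ℝ≥0∞ :=
  min 1 (ENNReal.ofReal
    |((X.globalLowerMass δ)⁻¹).toReal - ((Y.globalLowerMass δ)⁻¹).toReal|)

theorem dsGHP_eq (X Y : MMSpace) :
    dsGHP X Y = X.supportGHP Y + ∫⁻ δ in Ioc (0 : ℝ) 1, lowerMassGap X Y δ := rfl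

theorem measurable_lowerMassGap (X Y : MMSpace) : Measurable (lowerMassGap X Y) := by
  have h : ∀ X : MMSpace, Measurable fun δ => ((X.globalLowerMass δ)⁻¹).toReal :=
    fun X => (X.globalLowerMass_mono.measurable.inv).ennreal_toReal
  have := ((h X).sub (h Y)).abs.ennreal_ofReal
  exact measurable_const.min this

theorem lowerMassGap_triangle (X Y Z : MMSpace) (δ : ℝ) :
    lowerMassGap X Z δ ≤ lowerMassGap X Y δ + lowerMassGap Y Z δ := by
  have key : ∀ a b c : ℝ≥0∞, c ≤ a + b → min 1 c ≤ min 1 a + min 1 b := by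
    intro a b c h
    rcases le_total 1 a with ha | ha
    · exact (min_le_left _ _).trans (by rw [min_eq_left ha]; exact le_self_add)
    rcases le_total 1 b with hb | hb
    · exact (min_le_left _ _).trans (by rw [min_eq_left hb]; exact le_add_self)
    rw [min_eq_right ha, min_eq_right hb]
    exact (min_le_right _ _).trans h
  refine key _ _ _ ?_
  rw [← ENNReal.ofReal_add (abs_nonneg _) (abs_nonneg _)]
  exact ENNReal.ofReal_le_ofReal (abs_sub_le _ _ _)

theorem dsGHP_comm (X Y : MMSpace) : dsGHP X Y = dsGHP Y X := by
  rw [dsGHP_eq, dsGHP_eq, supportGHP_comm]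
  congr 2
  ext δ
  rw [lowerMassGap, lowerMassGap, abs_sub_comm]

theorem dsGHP_self (X : MMSpace) : dsGHP X X = 0 := by
  rw [dsGHP_eq, supportGHP_self]
  simp [lowerMassGap]

theorem dsGHP_triangle (X Y Z : MMSpace) : dsGHP X Z ≤ dsGHP X Y + dsGHP Y Z := by
  rw [dsGHP_eq, dsGHP_eq, dsGHP_eq, add_add_add_comm]
  gcongr
  · exact supportGHP_triangle _ _ _
  · rw [← lintegral_add_left (measurable_lowerMassGap X Y)]
    exact lintegral_mono fun δ => lowerMassGap_triangle X Y Z δ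

theorem supportGHP_le_dsGHP (X Y : MMSpace) : X.supportGHP Y ≤ dsGHP X Y := le_self_add

/-- The lower mass integral does not change which sequences converge to a space with compact
support. Its lower mass function is positive, and it is monotone, hence continuous at almost every
`δ`; there the reciprocals converge, and the integrand is bounded by `1`. -/
theorem tendsto_dsGHP {X : ℕ → MMSpace} {Y : MMSpace} (hY : IsCompact Y.coreSupport)
    (h : Tendsto (fun n => (X n).supportGHP Y) atTop (𝓝 0)) :
    Tendsto (fun n => dsGHP (X n) Y) atTop (𝓝 0) := by
  have key : Tendsto (fun n => ∫⁻ δ in Ioc (0 : ℝ) 1, lowerMassGap (X n) Y δ) atTop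
      (𝓝 (∫⁻ δ in Ioc (0 : ℝ) 1, 0)) := by
    refine tendsto_lintegral_of_dominated_convergence (fun _ => 1)
      (fun n => measurable_lowerMassGap _ _)
      (fun n => Eventually.of_forall fun δ => min_le_left _ _) (by simp) ?_
    have hc := Y.globalLowerMass_mono.countable_not_continuousAt
    have h1 : ∀ᵐ δ ∂(volume.restrict (Ioc (0:ℝ) 1)), ContinuousAt Y.globalLowerMass δ := by
      refine ae_restrict_of_ae ?_
      rw [ae_iff]
      exact hc.measure_zero _
    filter_upwards [h1, ae_restrict_mem measurableSet_Ioc] with δ hδ hδ0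
    have hpos := globalLowerMass_pos hY hδ0.1
    have h2 := tendsto_globalLowerMass h hδ
    have h3 := (ENNReal.tendsto_toReal (ENNReal.inv_ne_top.2 hpos.ne')).comp
      (tendsto_inv_iff.2 h2)
    have h4 := (h3.sub_const ((Y.globalLowerMass δ)⁻¹).toReal).abs
    rw [sub_self, abs_zero] at h4
    have h5 := ENNReal.tendsto_ofReal h4
    rw [ENNReal.ofReal_zero] at h5
    exact tendsto_of_tendsto_of_tendsto_of_le_of_le tendsto_const_nhds h5 (fun _ => zero_le)
      fun n => min_le_right _ _
  rw [lintegral_zero] at key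
  have := h.add key
  rwa [add_zero] at this

theorem dsGHP_eq_zero {X Y : MMSpace} (hY : IsCompact Y.coreSupport) (h : X.supportGHP Y = 0) :
    dsGHP X Y = 0 := by
  have := tendsto_dsGHP (X := fun _ => X) hY (by rw [h]; exact tendsto_const_nhds)
  exact tendsto_nhds_unique tendsto_const_nhds this

theorem isCompact_coreSupport_restrict (X : MMSpace) [ProperSpace X.core] (R : ℝ) :
    IsCompact (X.restrict R).coreSupport := by
  have hi := X.isometry_coreInclusion R
  rw [hi.isEmbedding.isCompact_iff]
  refine Metric.isCompact_of_isClosed_isBounded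
    (hi.isClosedEmbedding.isClosedMap _ (X.restrict R).isClosed_coreSupport) ?_
  refine (Metric.isBounded_closedBall (x := X.coreRoot) (r := R)).subset ?_
  rintro _ ⟨x, hx, rfl⟩
  exact (support_restrict_closedBall (M := X.μ) (r := X.root) hx).2

theorem Equivalent.restrict {X Y : MMSpace} (h : X.Equivalent Y) (R : ℝ) :
    (X.restrict R).supportGHP (Y.restrict R) = 0 := by
  obtain ⟨φ, hroot, hμ⟩ := h
  have e1 : Y.coreRoot = φ X.coreRoot := hroot.symm
  have hφ := φ.isometry
  refine le_antisymm ((supportGHP_le _ _ (hφ.comp (X.isometry_coreInclusion R))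
    (isometry_id.comp (Y.isometry_coreInclusion R))).trans ?_) zero_le
  rw [embeddedGHP_eq, ← support_map _ (hφ.comp (X.isometry_coreInclusion R)),
    ← support_map _ (isometry_id.comp (Y.isometry_coreInclusion R)),
    map_restrict_coreMeasure _ _ hφ, map_restrict_coreMeasure _ _ isometry_id, hμ, Measure.map_id,
    hroot]
  simp only [Function.comp_apply, coreInclusion_coreRoot, hroot, id]
  simp

end DsGHP

end MMSpace

/-! ### Good radii and the localized distance -/

namespace MMSpace

/-- The mass of the `R`-ball and the distances from points of a countable dense set to the support
inside that ball are monotone in `R`. Each of these countably many functions has countably many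
discontinuities. At a common continuity point, compactness makes the control of the support uniform
through a finite net. -/
theorem countable_not_goodRadius (X : MMSpace) [ProperSpace X.core] :
    {R | ¬ X.GoodRadius R}.Countable := by
  set M := X.coreMeasure
  set o := X.coreRoot
  let g : ℝ → ℝ≥0∞ := fun R => M (Metric.closedBall o R)
  have hg : Monotone g := fun a b h => measure_mono (Metric.closedBall_subset_closedBall h)
  let f : X.core → ℝ → ℝ≥0∞ := fun z R =>
    Metric.infEDist z (M.support ∩ Metric.closedBall o R)
  have hf : ∀ z, Antitone (f z) := fun z a b h =>
    Metric.infEDist_anti (inter_subset_inter_right _ (Metric.closedBall_subset_closedBall h))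
  obtain ⟨D, hDc, hD⟩ := TopologicalSpace.exists_countable_dense X.core
  refine (hg.countable_not_continuousAt.union
    (hDc.biUnion fun z _ => (hf z).countable_not_continuousAt)).mono fun R hR => ?_
  by_contra hcon
  simp only [mem_union, mem_iUnion, mem_ofPred_eq, not_or, not_not, exists_prop, not_exists,
    not_and] at hcon
  obtain ⟨hgR, hfR⟩ := hcon
  refine hR fun ε hε => ?_
  have plus : Tendsto (fun η : ℝ => R + η) (𝓝[>] 0) (𝓝 R) := by
    have : Tendsto (fun η : ℝ => R + η) (𝓝 0) (𝓝 (R + 0)) := tendsto_const_nhds.add tendsto_id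
    rw [add_zero] at this
    exact this.mono_left nhdsWithin_le_nhds
  have minus : Tendsto (fun η : ℝ => R - η) (𝓝[>] 0) (𝓝 R) := by
    have : Tendsto (fun η : ℝ => R - η) (𝓝 0) (𝓝 (R - 0)) := tendsto_const_nhds.sub tendsto_id
    rw [sub_zero] at this
    exact this.mono_left nhdsWithin_le_nhds
  have hfin : ∀ t, g t ≠ ∞ := fun t => (X.coreMeasure_lt_top Metric.isBounded_closedBall).ne
  have ev1 : ∀ᶠ η in 𝓝[>] (0:ℝ), g (R + η) - g (R - η) < ENNReal.ofReal ε := by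
    have := ENNReal.Tendsto.sub (hgR.tendsto.comp plus) (hgR.tendsto.comp minus)
      (Or.inl (hfin R))
    rw [tsub_self] at this
    exact this.eventually (gt_mem_nhds (ENNReal.ofReal_pos.2 hε))
  have hε3 : 0 < ε / 3 := by positivity
  obtain ⟨t, htD, ht⟩ := (isCompact_closedBall o (R + 1)).elim_finite_subcover_image
    (b := D) (c := fun z => Metric.ball z (ε / 3)) (fun z _ => Metric.isOpen_ball) (by
      intro x _
      obtain ⟨z, hz, hxz⟩ := hD.exists_dist_lt x hε3
      exact mem_iUnion₂.2 ⟨z, hz, hxz⟩)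
  obtain ⟨htf, ht⟩ := ht
  have ev2 : ∀ᶠ η in 𝓝[>] (0:ℝ), ∀ z ∈ t, f z (R + η) < ENNReal.ofReal (ε / 3) →
      f z (R - η) < ENNReal.ofReal (2 * (ε / 3)) := by
    rw [eventually_all_finite htf]
    intro z hz
    -- If the distance at `R` is below `2ε/3`, it stays so at slightly smaller radii. Otherwise it
    -- exceeds `ε/3` also at slightly larger radii, and the premise is false.
    rcases lt_or_ge (f z R) (ENNReal.ofReal (2 * (ε / 3))) with h | h
    · filter_upwards [((hfR z (htD hz)).tendsto.comp minus).eventually (gt_mem_nhds h)] with η hη _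
      exact hη
    · have h' : ENNReal.ofReal (ε / 3) < f z R :=
        lt_of_lt_of_le ((ENNReal.ofReal_lt_ofReal_iff (by positivity)).2 (by linarith)) h
      filter_upwards [((hfR z (htD hz)).tendsto.comp plus).eventually (lt_mem_nhds h')] with η hη h2
      exact absurd h2 hη.le.not_gt
  have ev3 : ∀ᶠ η in 𝓝[>] (0:ℝ), η < 1 := nhdsWithin_le_nhds (gt_mem_nhds one_pos)
  obtain ⟨η, h1, h2, h3, hη⟩ := (ev1.and (ev2.and (ev3.and self_mem_nhdsWithin))).exists
  have hη : 0 < η := hη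
  refine ⟨η, hη, ?_, fun y hy hyo => ?_⟩
  · rw [measure_sdiff (Metric.closedBall_subset_closedBall (by linarith))
      Metric.isClosed_closedBall.measurableSet.nullMeasurableSet (hfin _)]
    exact h1.le
  · have hyt : y ∈ Metric.closedBall o (R + 1) := by
      rw [Metric.mem_closedBall]; linarith
    obtain ⟨z, hz, hyz⟩ := mem_iUnion₂.1 (ht hyt)
    have h4 := h2 z hz (Metric.infEDist_lt_iff.2 ⟨y, ⟨hy, hyo⟩, by
      rw [edist_dist, ENNReal.ofReal_lt_ofReal_iff hε3, dist_comm]; exact hyz⟩)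
    obtain ⟨y', ⟨hy', hyo'⟩, hzy⟩ := Metric.infEDist_lt_iff.1 h4
    rw [edist_dist, ENNReal.ofReal_lt_ofReal_iff (by positivity)] at hzy
    refine ⟨y', hy', hyo', ?_⟩
    rw [Metric.mem_ball] at hyz
    linarith [dist_triangle y z y']

/-- Restrictions of close spaces are close, if the radius is good for the limit. -/
theorem GoodRadius.exists_supportGHP_lt {Y : MMSpace} {R : ℝ} (hR : Y.GoodRadius R)
    {c : ℝ≥0∞} (hc : 0 < c) : ∃ ε > 0, ∀ (X : MMSpace) (R' : ℝ), X.Close Y (R + 1) ε →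
      |R' - R| ≤ ε → (X.restrict R').supportGHP (Y.restrict R) < c := by
  obtain ⟨r, hr, hrc⟩ := ENNReal.lt_iff_exists_nnreal_btwn.1 hc
  have hr' : (0:ℝ) < r := by exact_mod_cast hr
  obtain ⟨η, hη, hs⟩ := hR (r / 6) (by positivity)
  -- `r / 6` twice gives a total `3 * (r / 6 + r / 6) = r`, `η / 4` fits the error into the shell,
  -- and `1` keeps the radius below `R + 1`.
  refine ⟨min (min (r / 6) (η / 4)) 1, by positivity, fun X R' hX hR' => ?_⟩
  have h1 : min (min ((r:ℝ) / 6) (η / 4)) 1 ≤ η / 4 := (min_le_left _ _).trans (min_le_right _ _)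
  have h2 : min (min ((r:ℝ) / 6) (η / 4)) 1 ≤ r / 6 := (min_le_left _ _).trans (min_le_left _ _)
  have h3 : min (min ((r:ℝ) / 6) (η / 4)) 1 ≤ 1 := min_le_right _ _
  refine (supportGHP_restrict_le hX (by positivity) (by positivity) (by linarith) hR'
    (by linarith) hs).trans_lt (lt_of_le_of_lt ?_ hrc)
  rw [← ENNReal.ofReal_coe_nnreal]
  exact ENNReal.ofReal_le_ofReal (by linarith)

theorem GoodRadius.tendsto_supportGHP {X : ℕ → MMSpace} {Y : MMSpace} {R : ℝ}
    (hR : Y.GoodRadius R) {S : ℕ → ℝ} (hS : Tendsto S atTop (𝓝 R))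
    (h : ∀ ε > 0, ∀ᶠ n in atTop, (X n).Close Y (R + 1) ε) :
    Tendsto (fun n => ((X n).restrict (S n)).supportGHP (Y.restrict R)) atTop (𝓝 0) := by
  refine tendsto_order.2 ⟨fun a ha => absurd ha not_lt_zero, fun c hc => ?_⟩
  obtain ⟨ε, hε, H⟩ := hR.exists_supportGHP_lt hc
  filter_upwards [h ε hε, Metric.tendsto_nhds.1 hS ε hε] with n h1 h2
  exact H _ _ h1 h2.le

theorem GoodRadius.tendsto_dsGHP_restrict {X : MMSpace} [ProperSpace X.core] {R : ℝ}
    (hR : X.GoodRadius R) :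
    Tendsto (fun R' => dsGHP (X.restrict R') (X.restrict R)) (𝓝 R) (𝓝 0) :=
  tendsto_of_seq_tendsto fun _ hS => tendsto_dsGHP (X.isCompact_coreSupport_restrict R)
    (hR.tendsto_supportGHP hS fun _ hε => Eventually.of_forall fun _ => X.close_self _ hε)

theorem continuousAt_dsGHP_restrict {X Y : MMSpace} [ProperSpace X.core] [ProperSpace Y.core]
    {R : ℝ} (hX : X.GoodRadius R) (hY : Y.GoodRadius R) :
    ContinuousAt (fun R => dsGHP (X.restrict R) (Y.restrict R)) R := by
  have h0 : Tendsto (fun R' => dsGHP (X.restrict R') (X.restrict R) +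
      dsGHP (Y.restrict R') (Y.restrict R)) (𝓝 R) (𝓝 0) := by
    simpa using hX.tendsto_dsGHP_restrict.add hY.tendsto_dsGHP_restrict
  have up := h0.const_add (dsGHP (X.restrict R) (Y.restrict R))
  have dn := ENNReal.Tendsto.sub
    (tendsto_const_nhds (x := dsGHP (X.restrict R) (Y.restrict R)) (f := 𝓝 R)) h0
    (Or.inr ENNReal.zero_ne_top)
  rw [add_zero] at up
  rw [tsub_zero] at dn
  have four : ∀ A B C D : MMSpace, dsGHP A D ≤ dsGHP B C + (dsGHP A B + dsGHP D C) := by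
    intro A B C D
    refine (dsGHP_triangle A B D).trans ?_
    rw [add_left_comm]
    gcongr
    rw [dsGHP_comm D C]
    exact dsGHP_triangle B C D
  refine tendsto_of_tendsto_of_tendsto_of_le_of_le dn up (fun R' => ?_) fun R' => ?_
  · refine tsub_le_iff_right.2 ((four _ (X.restrict R') (Y.restrict R') _).trans ?_)
    rw [dsGHP_comm (X.restrict R), dsGHP_comm (Y.restrict R)]
  · exact four _ _ _ _

/-- The function is continuous at every radius that is good for both spaces, and the exceptional
radii form a countable null set. -/
theorem aemeasurable_dsGHP_restrict (X Y : MMSpace) [ProperSpace X.core] [ProperSpace Y.core]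
    (s : Set ℝ) : AEMeasurable (fun R => dsGHP (X.restrict R) (Y.restrict R))
      (volume.restrict s) := by
  refine AEMeasurable.mono_measure ?_ Measure.restrict_le_self
  have hc := X.countable_not_goodRadius.union Y.countable_not_goodRadius
  set B := {R | ¬ X.GoodRadius R} ∪ {R | ¬ Y.GoodRadius R}
  have h1 : ContinuousOn (fun R => dsGHP (X.restrict R) (Y.restrict R)) Bᶜ := fun R hR => by
    simp only [B, compl_union, mem_inter_iff, mem_compl_iff, mem_ofPred_eq, not_not] at hR
    exact (continuousAt_dsGHP_restrict hR.1 hR.2).continuousWithinAt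
  have h2 := h1.aemeasurable (μ := volume) hc.measurableSet.compl
  rwa [Measure.restrict_eq_self_of_ae_mem] at h2
  rw [ae_iff]
  simpa using hc.measure_zero volume

/-- The localized distance with values in `[0, ∞]`. -/
noncomputable def localizedEDist (X Y : MMSpace) : ℝ≥0∞ :=
  ∫⁻ R in Ici (0 : ℝ), ENNReal.ofReal (Real.exp (-R))
    * min 1 (dsGHP (X.restrict R) (Y.restrict R))

theorem localizedSGHP_eq (X Y : MMSpace) : localizedSGHP X Y = (localizedEDist X Y).toReal := rfl

theorem lintegral_exp_neg : ∫⁻ R in Ici (0 : ℝ), ENNReal.ofReal (Real.exp (-R)) = 1 := by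
  rw [← ofReal_integral_eq_lintegral_ofReal, integral_Ici_eq_integral_Ioi, integral_exp_neg_Ioi]
  · simp
  · exact (integrableOn_Ici_iff_integrableOn_Ioi).2 (integrableOn_exp_neg_Ioi 0)
  · exact Eventually.of_forall fun R => (Real.exp_pos _).le

theorem localizedEDist_ne_top (X Y : MMSpace) : localizedEDist X Y ≠ ∞ := by
  have : localizedEDist X Y ≤ 1 := by
    rw [← lintegral_exp_neg]
    exact lintegral_mono fun R => mul_le_of_le_one_right' (min_le_left _ _)
  exact ne_top_of_le_ne_top ENNReal.one_ne_top this

theorem localizedEDist_comm (X Y : MMSpace) : localizedEDist X Y = localizedEDist Y X := by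
  simp only [localizedEDist, dsGHP_comm]

theorem localizedEDist_self (X : MMSpace) : localizedEDist X X = 0 := by
  simp [localizedEDist, dsGHP_self]

theorem aemeasurable_localizedEDist (X Y : MMSpace) [ProperSpace X.core] [ProperSpace Y.core] :
    AEMeasurable (fun R : ℝ => ENNReal.ofReal (Real.exp (-R))
      * min 1 (dsGHP (X.restrict R) (Y.restrict R))) (volume.restrict (Ici 0)) := by
  have h1 : Measurable fun R : ℝ => ENNReal.ofReal (Real.exp (-R)) := by fun_prop
  exact h1.aemeasurable.mul (aemeasurable_const.min (aemeasurable_dsGHP_restrict X Y _))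

theorem localizedEDist_triangle (X Y Z : MMSpace) [ProperSpace X.core] [ProperSpace Y.core] :
    localizedEDist X Z ≤ localizedEDist X Y + localizedEDist Y Z := by
  rw [localizedEDist, localizedEDist, localizedEDist,
    ← lintegral_add_left' (aemeasurable_localizedEDist X Y)]
  refine lintegral_mono fun R => ?_
  rw [← mul_add]
  gcongr
  have h := dsGHP_triangle (X.restrict R) (Y.restrict R) (Z.restrict R)
  rcases le_total 1 (dsGHP (X.restrict R) (Y.restrict R)) with ha | ha
  · exact (min_le_left _ _).trans (by rw [min_eq_left ha]; exact le_self_add)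
  rcases le_total 1 (dsGHP (Y.restrict R) (Z.restrict R)) with hb | hb
  · exact (min_le_left _ _).trans (by rw [min_eq_left hb]; exact le_add_self)
  rw [min_eq_right ha, min_eq_right hb]
  exact (min_le_right _ _).trans h

theorem Equivalent.localizedEDist_eq_zero {X Y : MMSpace} [ProperSpace Y.core]
    (h : X.Equivalent Y) : localizedEDist X Y = 0 := by
  have : ∀ R, dsGHP (X.restrict R) (Y.restrict R) = 0 := fun R =>
    dsGHP_eq_zero (Y.isCompact_coreSupport_restrict R) (h.restrict R)
  simp [localizedEDist, this]

theorem tendsto_localizedEDist {X : ℕ → MMSpace} {Y : MMSpace} [∀ n, ProperSpace (X n).core]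
    [ProperSpace Y.core] {B : Set ℝ} (hB : B.Countable)
    (h : ∀ R > 0, R ∉ B → Tendsto (fun n => ((X n).restrict R).supportGHP (Y.restrict R))
      atTop (𝓝 0)) :
    Tendsto (fun n => localizedEDist (X n) Y) atTop (𝓝 0) := by
  have hm : Measurable fun R : ℝ => ENNReal.ofReal (Real.exp (-R)) := by fun_prop
  have key : Tendsto (fun n => localizedEDist (X n) Y) atTop
      (𝓝 (∫⁻ R in Ici (0 : ℝ), (0 : ℝ≥0∞))) := by
    refine tendsto_lintegral_of_dominated_convergence'
      (fun R : ℝ => ENNReal.ofReal (Real.exp (-R)))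
      (fun n => aemeasurable_localizedEDist _ _)
      (fun n => Eventually.of_forall fun R => mul_le_of_le_one_right' (min_le_left _ _))
      (by rw [lintegral_exp_neg]; exact ENNReal.one_ne_top) ?_
    have hB0 : ∀ᵐ R ∂(volume.restrict (Ici (0:ℝ))), R ∉ B ∪ {0} := by
      refine ae_restrict_of_ae ?_
      exact measure_mono_null (fun R hR => not_not.1 hR)
        ((hB.union (countable_singleton 0)).measure_zero volume)
    filter_upwards [hB0, ae_restrict_mem measurableSet_Ici] with R hR hR0
    rw [mem_union, not_or, mem_singleton_iff] at hR
    have h1 := tendsto_dsGHP (Y.isCompact_coreSupport_restrict R)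
      (h R (lt_of_le_of_ne hR0 (Ne.symm hR.2)) hR.1)
    have h2 := ENNReal.Tendsto.const_mul (a := ENNReal.ofReal (Real.exp (-R))) h1
      (Or.inr ENNReal.ofReal_ne_top)
    rw [mul_zero] at h2
    exact tendsto_of_tendsto_of_tendsto_of_le_of_le tendsto_const_nhds h2 (fun _ => zero_le)
      fun n => mul_le_mul_right (min_le_right _ _) _
  rwa [lintegral_zero] at key

theorem tendsto_localizedEDist_of_close {X : ℕ → MMSpace} {Y : MMSpace}
    [∀ n, ProperSpace (X n).core] [ProperSpace Y.core]
    (h : ∀ S, ∀ ε > 0, ∀ᶠ n in atTop, (X n).Close Y S ε) :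
    Tendsto (fun n => localizedEDist (X n) Y) atTop (𝓝 0) :=
  tendsto_localizedEDist Y.countable_not_goodRadius fun R _ hR => by
    have hR : Y.GoodRadius R := by simpa using hR
    exact hR.tendsto_supportGHP tendsto_const_nhds (h (R + 1))

/-- If the spaces were not `Close`, then `dsGHP` of the restrictions would be at least `ε` for every
`R` in `[S + 1, S + 2]`, an interval of length one on which the weight is at least `exp (-(S + 2))`.
-/
theorem close_of_localizedEDist_lt {X Y : MMSpace} {S ε : ℝ} (hS : 0 ≤ S) (hε : 0 < ε)
    (hε1 : ε ≤ 1) (h : localizedEDist X Y < ENNReal.ofReal (ε * Real.exp (-(S + 2)))) :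
    X.Close Y S ε := by
  by_contra hcon
  refine h.not_ge ?_
  have h1 : ∀ R ∈ Icc (S + 1) (S + 2), ENNReal.ofReal (ε * Real.exp (-(S + 2))) ≤
      ENNReal.ofReal (Real.exp (-R)) * min 1 (dsGHP (X.restrict R) (Y.restrict R)) := by
    intro R hR
    rw [mul_comm, ENNReal.ofReal_mul (Real.exp_pos _).le]
    refine mul_le_mul' (ENNReal.ofReal_le_ofReal (Real.exp_le_exp.2 (by linarith [hR.2])))
      (le_min ?_ ?_)
    · rw [← ENNReal.ofReal_one]; exact ENNReal.ofReal_le_ofReal hε1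
    · by_contra hlt
      exact hcon (close_of_supportGHP_restrict_lt hε (by linarith [hR.1])
        ((supportGHP_le_dsGHP _ _).trans_lt (not_le.1 hlt)))
  calc ENNReal.ofReal (ε * Real.exp (-(S + 2)))
      = ∫⁻ R in Icc (S + 1) (S + 2), ENNReal.ofReal (ε * Real.exp (-(S + 2))) := by
        rw [setLIntegral_const, Real.volume_Icc]
        norm_num
    _ ≤ ∫⁻ R in Icc (S + 1) (S + 2), ENNReal.ofReal (Real.exp (-R)) *
          min 1 (dsGHP (X.restrict R) (Y.restrict R)) := setLIntegral_mono' measurableSet_Icc h1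
    _ ≤ localizedEDist X Y := lintegral_mono_set fun R hR => by
        rw [mem_Ici]; linarith [hR.1]

theorem eventually_close {X : ℕ → MMSpace} {Y : MMSpace}
    (h : Tendsto (fun n => localizedEDist (X n) Y) atTop (𝓝 0)) (S : ℝ) {ε : ℝ} (hε : 0 < ε) :
    ∀ᶠ n in atTop, (X n).Close Y S ε := by
  have h1 : 0 < min ε 1 * Real.exp (-(max S 0 + 2)) :=
    mul_pos (lt_min hε one_pos) (Real.exp_pos _)
  filter_upwards [h.eventually (gt_mem_nhds (ENNReal.ofReal_pos.2 h1))] with n hn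
  exact (close_of_localizedEDist_lt (le_max_right _ _) (lt_min hε one_pos) (min_le_right _ _)
    hn).mono (le_max_left _ _) (min_le_left _ _)

end MMSpace

/-! ### Gromov-Hausdorff-vague convergence as metric convergence -/

namespace MMSpace

theorem coreMeasure_compl_coreSupport (X : MMSpace) : X.coreMeasure X.coreSupportᶜ = 0 := by
  rw [← coreSupport_eq]
  exact Measure.measure_compl_support

theorem GHWeakTendsto.tendsto_supportGHP {X : ℕ → MMSpace} {Y : MMSpace}
    [∀ n, IsFiniteMeasure (X n).μ] [IsFiniteMeasure Y.μ] (hY : IsCompact Y.coreSupport)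
    (h : GHWeakTendsto X Y) : Tendsto (fun n => (X n).supportGHP Y) atTop (𝓝 0) := by
  obtain ⟨E, _, _, _, o, φ, ψ, hφ, hψ, hφo, hψo, hw, hH⟩ := h
  have hLP := tendsto_levyProkhorovEDist_of_integral (hY.image hψ.continuous) (by
    rw [Measure.map_apply hψ.continuous.measurable
      (hY.image hψ.continuous).isClosed.isOpen_compl.measurableSet]
    exact measure_mono_null (fun x hx hx' => hx (mem_image_of_mem ψ hx'))
      Y.coreMeasure_compl_coreSupport) hw
  have := hLP.add hH
  rw [add_zero] at this
  refine tendsto_of_tendsto_of_tendsto_of_le_of_le tendsto_const_nhds this (fun _ => zero_le)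
    fun n => (supportGHP_le _ _ (hφ n) hψ).trans ?_
  rw [embeddedGHP_eq, hφo, hψo, edist_self, add_zero]

/-- For each `n` there is a separate almost optimal space. All of them are glued along their copies
of the core of `Y`, and the result is embedded into a normed space, where translations can bring the
roots to one point. -/
theorem ghWeakTendsto_of_supportGHP {X : ℕ → MMSpace} {Y : MMSpace}
    [∀ n, IsFiniteMeasure (X n).μ] [IsFiniteMeasure Y.μ]
    (h : Tendsto (fun n => (X n).supportGHP Y) atTop (𝓝 0)) : GHWeakTendsto X Y := by
  -- At `n = 0` the slack is `∞`, which is harmless.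
  have hε : ∀ n : ℕ, (n : ℝ≥0∞)⁻¹ ≠ 0 := fun n => ENNReal.inv_ne_zero.2 (by simp)
  choose P mP i j hi hj hij using fun n => exists_embeddedGHP_le (X n) Y (hε n)
  obtain ⟨E, _, e, he, hej⟩ := exists_chain_amalgam (A := fun _ => Y.core) hj hj
  have hconst : ∀ n y, e n (j n y) = e 0 (j 0 y) := fun n y => by
    induction n with
    | zero => rfl
    | succ n ih => rw [← hej, ih]
  obtain ⟨κ, hκ⟩ := exists_isometry_boundedContinuousFunction E
  let u : ∀ n, (X n).core → (E →ᵇ ℝ) := fun n => κ ∘ e n ∘ i n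
  let v : Y.core → (E →ᵇ ℝ) := κ ∘ e 0 ∘ j 0
  have hu : ∀ n, Isometry (u n) := fun n => hκ.comp ((he n).comp (hi n))
  have hv : Isometry v := hκ.comp ((he 0).comp (hj 0))
  have hsub : ∀ a : E →ᵇ ℝ, Isometry fun x => x - a := fun a =>
    Isometry.of_dist_eq fun x y => dist_sub_right x y a
  have huv : ∀ n, embeddedGHP (X n) Y (u n) v ≤ (X n).supportGHP Y + (n : ℝ≥0∞)⁻¹ := fun n => by
    have : v = (κ ∘ e n) ∘ j n := funext fun y => congrArg κ (hconst n y).symm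
    rw [this]
    exact (embeddedGHP_comp _ _ (hi n) (hj n) (hκ.comp (he n))).le.trans (hij n)
  -- Each copy is translated by its own root. Compared with translation by the root of `Y`, this
  -- moves every point by the distance of the two roots, at most `c`; this costs `3 * c` on top of
  -- the original `c`.
  let φ : ∀ n, (X n).core → (E →ᵇ ℝ) := fun n x => u n x - u n (X n).coreRoot
  let ψ : Y.core → (E →ᵇ ℝ) := fun y => v y - v Y.coreRoot
  have hφ : ∀ n, Isometry (φ n) := fun n => (hsub _).comp (hu n)
  have hψ : Isometry ψ := (hsub _).comp hv
  have bound : ∀ n, embeddedGHP (X n) Y (φ n) ψ ≤ 4 * ((X n).supportGHP Y + (n : ℝ≥0∞)⁻¹) := by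
    intro n
    let c := (X n).supportGHP Y + (n : ℝ≥0∞)⁻¹
    have h1 : edist (u n (X n).coreRoot) (v Y.coreRoot) ≤ c := by
      refine le_trans ?_ (huv n)
      borelize (E →ᵇ ℝ)
      rw [embeddedGHP_eq]
      exact le_add_self
    let φ' : (X n).core → (E →ᵇ ℝ) := (fun x => x - v Y.coreRoot) ∘ u n
    refine (embeddedGHP_triangle _ (X n) _ _ φ' _).trans ?_
    have h2 : embeddedGHP (X n) (X n) (φ n) φ' ≤ c + c + c := by
      refine embeddedGHP_self_le _ (hφ n) ((hsub _).comp (hu n)) fun x => ?_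
      rw [edist_dist] at h1 ⊢
      have : dist (φ n x) (φ' x) = dist (u n (X n).coreRoot) (v Y.coreRoot) :=
        dist_sub_left _ _ _
      rwa [this]
    have h3 : embeddedGHP (X n) Y φ' ψ ≤ c :=
      (embeddedGHP_comp _ _ (hu n) hv (hsub _)).le.trans (huv n)
    refine (add_le_add h2 h3).trans_eq ?_
    change c + c + c + c = 4 * c
    ring
  have lim : Tendsto (fun n => embeddedGHP (X n) Y (φ n) ψ) atTop (𝓝 0) := by
    have h1 := ENNReal.Tendsto.const_mul (a := 4) (h.add ENNReal.tendsto_inv_nat_nhds_zero)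
      (Or.inr (by simp))
    rw [add_zero, mul_zero] at h1
    exact tendsto_of_tendsto_of_tendsto_of_le_of_le tendsto_const_nhds h1 (fun _ => zero_le) bound
  borelize (E →ᵇ ℝ)
  simp only [embeddedGHP_eq] at lim
  refine ⟨E →ᵇ ℝ, inferInstance, inferInstance, inferInstance, 0, φ, ψ, hφ, hψ,
    fun n => sub_self _, sub_self _, fun f => ?_, ?_⟩
  · have : ∀ n, IsFiniteMeasure ((X n).coreMeasure.map (φ n)) := fun n => inferInstance
    refine tendsto_integral_of_levyProkhorovEDist ?_ f
    exact tendsto_of_tendsto_of_tendsto_of_le_of_le tendsto_const_nhds lim (fun _ => zero_le)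
      fun n => le_self_add.trans le_self_add
  · exact tendsto_of_tendsto_of_tendsto_of_le_of_le tendsto_const_nhds lim (fun _ => zero_le)
      fun n => le_add_self.trans le_self_add

theorem ghVagueTendsto_iff {X : ℕ → MMSpace} {Y : MMSpace} [∀ n, ProperSpace (X n).core]
    [ProperSpace Y.core] :
    GHVagueTendsto X Y ↔ Tendsto (fun n => localizedEDist (X n) Y) atTop (𝓝 0) := by
  refine ⟨fun h => tendsto_localizedEDist h fun R hR0 hR => ?_, fun h => ?_⟩
  · have : GHWeakTendsto (fun n => (X n).restrict R) (Y.restrict R) := by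
      by_contra hcon
      exact hR ⟨hR0, hcon⟩
    exact this.tendsto_supportGHP (Y.isCompact_coreSupport_restrict R)
  · refine Y.countable_not_goodRadius.mono fun R hR =>
      show ¬ Y.GoodRadius R from fun hgood => hR.2 ?_
    exact ghWeakTendsto_of_supportGHP (hgood.tendsto_supportGHP tendsto_const_nhds
      fun ε hε => eventually_close h (R + 1) hε)

end MMSpace

/-! ### Comparing measures on closed bounded sets -/

section MeasureExt

variable {E : Type*} [MetricSpace E] [MeasurableSpace E] [BorelSpace E]

theorem measure_ext_of_isClosed_isBounded {M N : Measure E}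
    (hM : ∀ s, Bornology.IsBounded s → M s < ∞)
    (h : ∀ B, IsClosed B → Bornology.IsBounded B → M B = N B) : M = N := by
  rcases isEmpty_or_nonempty E with hE | ⟨⟨o⟩⟩
  · exact Measure.ext fun s _ => by rw [eq_empty_of_isEmpty s]; simp
  refine Measure.ext_of_generateFrom_of_iUnion {B | IsClosed B ∧ Bornology.IsBounded B}
    (fun n : ℕ => Metric.closedBall o n) (le_antisymm ?_ ?_) ?_ (Metric.iUnion_closedBall_nat o)
    (fun n => ⟨Metric.isClosed_closedBall, Metric.isBounded_closedBall⟩)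
    (fun n => (hM _ Metric.isBounded_closedBall).ne) fun B hB => h B hB.1 hB.2
  · rw [BorelSpace.measurable_eq (α := E), borel_eq_generateFrom_isClosed]
    refine MeasurableSpace.generateFrom_le fun F hF => ?_
    have : F = ⋃ n : ℕ, F ∩ Metric.closedBall o n := by
      rw [← inter_iUnion, Metric.iUnion_closedBall_nat, inter_univ]
    rw [this]
    exact MeasurableSet.iUnion fun n => MeasurableSpace.measurableSet_generateFrom
      ⟨IsClosed.inter hF Metric.isClosed_closedBall,
        Metric.isBounded_closedBall.subset inter_subset_right⟩
  · exact MeasurableSpace.generateFrom_le fun B hB => hB.1.measurableSet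
  · rintro A hA B hB -
    exact ⟨hA.1.inter hB.1, hA.2.subset inter_subset_left⟩

theorem measure_le_of_forall_thickening {M N : Measure E}
    (hN : ∀ s, Bornology.IsBounded s → N s < ∞) {B : Set E} (hB : IsClosed B)
    (hBb : Bornology.IsBounded B) {c : ℝ}
    (h : ∀ η > 0, M B ≤ N (Metric.thickening (c * η) B) + ENNReal.ofReal η) (hc : 0 < c) :
    M B ≤ N B := by
  have h1 := tendsto_measure_thickening_of_isClosed (μ := N) (s := B)
    ⟨1, one_pos, (hN _ hBb.thickening).ne⟩ hB
  have h2 : Tendsto (fun η : ℝ => c * η) (𝓝[>] 0) (𝓝[>] 0) := by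
    refine tendsto_nhdsWithin_iff.2 ⟨?_, ?_⟩
    · have : Tendsto (fun η : ℝ => c * η) (𝓝 0) (𝓝 (c * 0)) := tendsto_id.const_mul c
      rw [mul_zero] at this
      exact this.mono_left nhdsWithin_le_nhds
    · filter_upwards [self_mem_nhdsWithin] with η hη using mul_pos hc hη
  have h3 : Tendsto (fun ε : ℝ => ENNReal.ofReal ε) (𝓝[>] 0) (𝓝 0) := by
    have : Tendsto (fun ε : ℝ => ENNReal.ofReal ε) (𝓝 0) (𝓝 (ENNReal.ofReal 0)) :=
      ENNReal.continuous_ofReal.tendsto 0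
    rw [ENNReal.ofReal_zero] at this
    exact this.mono_left nhdsWithin_le_nhds
  have h4 := (h1.comp h2).add h3
  rw [add_zero] at h4
  refine ge_of_tendsto h4 ?_
  filter_upwards [self_mem_nhdsWithin] with η hη using h η hη

end MeasureExt

/-! ### Spaces that are close at every scale are equivalent -/

namespace MMSpace

/-- The root may lie outside the support, so it is matched through `hr` instead of `NearAt.supp`. -/
theorem Close.exists_dist_le {X Y : MMSpace} {E : Type} [MetricSpace E] [MeasurableSpace E]
    [BorelSpace E] {i : X.core → E} {j : Y.core → E} (hi : Isometry i) (hj : Isometry j)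
    {S ε : ℝ} (h : NearAt (i X.coreRoot) S ε (X.coreMeasure.map i) (Y.coreMeasure.map j))
    (hr : dist (i X.coreRoot) (j Y.coreRoot) ≤ ε) (x : X.core) (hx : dist x X.coreRoot ≤ S) :
    ∃ y, dist (i x) (j y) ≤ ε := by
  rcases X.core_eq x with hs | rfl
  · obtain ⟨y, hy, hxy⟩ := h.supp (i x) (by rw [support_map _ hi]; exact mem_image_of_mem i hs)
      (by rwa [hi.dist_eq])
    rw [support_map _ hj] at hy
    obtain ⟨y, -, rfl⟩ := hy
    exact ⟨y, hxy.le⟩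
  · exact ⟨_, hr⟩

/-- Matching nearby points gives maps `p n` that preserve distances up to `2 * ε n`. Balls in
`Y.core` are compact, so `p n` has a pointwise ultrafilter limit `f`, an isometry that fixes the
roots. Uniform control on compact sets identifies the measures. Surjectivity then follows from the
equality of measures, since it carries support onto support. -/
theorem equivalent_of_close {X Y : MMSpace} [ProperSpace X.core] [ProperSpace Y.core]
    (h : ∀ S, ∀ ε > 0, X.Close Y S ε) : X.Equivalent Y := by
  let ε : ℕ → ℝ := fun n => 1 / ((n : ℝ) + 1)
  have hε : ∀ n, 0 < ε n := fun n => Nat.one_div_pos_of_nat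
  have hε1 : ∀ n, ε n ≤ 1 := fun n => by
    refine (div_le_one (by positivity)).2 ?_
    linarith [(Nat.cast_nonneg n : (0:ℝ) ≤ n)]
  choose P mP msP bP i j hi hj hMN hNM hr using fun n : ℕ => h n (ε n) (hε n)
  set 𝒰 : Ultrafilter ℕ := hyperfilter ℕ
  have hU : (𝒰 : Filter ℕ) ≤ atTop := by
    rw [← Nat.cofinite_eq_atTop]; exact hyperfilter_le_cofinite
  have hεlim : Tendsto ε 𝒰 (𝓝 0) := tendsto_one_div_add_atTop_nhds_zero_nat.mono_left hU
  have hlarge : ∀ t : ℝ, ∀ᶠ n : ℕ in 𝒰, t ≤ n := fun t =>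
    hU (tendsto_natCast_atTop_atTop.eventually_ge_atTop t)
  -- Nothing is required outside the ball of radius `n`; each fixed `x` lies inside it eventually.
  have hp : ∀ (n : ℕ) x, ∃ y, dist x X.coreRoot ≤ n → dist (i n x) (j n y) ≤ ε n := by
    intro n x
    by_cases hx : dist x X.coreRoot ≤ n
    · obtain ⟨y, hy⟩ := Close.exists_dist_le (hi n) (hj n) (hMN n) (hr n) x hx
      exact ⟨y, fun _ => hy⟩
    · exact ⟨Y.coreRoot, fun h => absurd h hx⟩
  choose p hp using hp
  have hpd : ∀ (n : ℕ) x x', dist x X.coreRoot ≤ n → dist x' X.coreRoot ≤ n →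
      |dist (p n x) (p n x') - dist x x'| ≤ 2 * ε n := by
    intro n x x' hx hx'
    have h1 := hp n x hx
    have h2 := hp n x' hx'
    rw [← (hi n).dist_eq, ← (hj n).dist_eq]
    rw [abs_le]
    constructor
    · linarith [dist_triangle4 (i n x) (j n (p n x)) (j n (p n x')) (i n x'),
        dist_comm (i n x') (j n (p n x'))]
    · linarith [dist_triangle4 (j n (p n x)) (i n x) (i n x') (j n (p n x')),
        dist_comm (i n x) (j n (p n x))]
  have hpr : ∀ n : ℕ, dist (p n X.coreRoot) Y.coreRoot ≤ 2 * ε n := by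
    intro n
    have h1 := hp n X.coreRoot (by simp)
    rw [← (hj n).dist_eq]
    linarith [hr n, dist_triangle_left (j n (p n X.coreRoot)) (j n Y.coreRoot) (i n X.coreRoot)]
  have hlim : ∀ x, ∃ y, Tendsto (fun n => p n x) 𝒰 (𝓝 y) := by
    intro x
    have hmem : ∀ᶠ n in 𝒰, p n x ∈ Metric.closedBall Y.coreRoot (dist x X.coreRoot + 4) := by
      filter_upwards [hlarge (dist x X.coreRoot)] with n hn
      rw [Metric.mem_closedBall]
      have h1 := (abs_le.1 (hpd n x X.coreRoot hn (by simp))).2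
      linarith [hpr n, hε1 n, dist_triangle (p n x) (p n X.coreRoot) Y.coreRoot]
    obtain ⟨y, -, hy⟩ := (isCompact_closedBall Y.coreRoot (dist x X.coreRoot + 4)).ultrafilter_le_nhds'
      (𝒰.map fun n => p n x) hmem
    exact ⟨y, hy⟩
  choose f hf using hlim
  have hε2 : Tendsto (fun n => 2 * ε n) 𝒰 (𝓝 0) := by simpa using hεlim.const_mul 2
  have hfi : Isometry f := by
    refine Isometry.of_dist_eq fun x x' => ?_
    have h1 : Tendsto (fun n => dist (p n x) (p n x')) 𝒰 (𝓝 (dist (f x) (f x'))) :=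
      (hf x).dist (hf x')
    have h2 : Tendsto (fun n => dist (p n x) (p n x')) 𝒰 (𝓝 (dist x x')) := by
      refine tendsto_iff_dist_tendsto_zero.2 (squeeze_zero' (Eventually.of_forall fun _ =>
        dist_nonneg) ?_ hε2)
      filter_upwards [hlarge (dist x X.coreRoot), hlarge (dist x' X.coreRoot)] with n h1 h2
      exact hpd n x x' h1 h2
    exact tendsto_nhds_unique h1 h2
  have hfr : f X.coreRoot = Y.coreRoot := by
    refine tendsto_nhds_unique (hf X.coreRoot) (tendsto_iff_dist_tendsto_zero.2 (squeeze_zero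
      (fun _ => dist_nonneg) hpr hε2))
  have unif : ∀ C : Set X.core, IsCompact C → ∀ η > 0, ∀ᶠ n in 𝒰,
      ∀ x ∈ C, dist (i n x) (j n (f x)) < η := by
    intro C hC η hη
    obtain ⟨t, htf, ht⟩ := Metric.totallyBounded_iff.1 hC.totallyBounded (η / 4) (by positivity)
    have e1 : ∀ᶠ n in 𝒰, ∀ z ∈ t, dist (p n z) (f z) < η / 4 ∧ dist z X.coreRoot ≤ n := by
      refine (eventually_all_finite htf).2 fun z _ => ?_
      exact (Metric.tendsto_nhds.1 (hf z) _ (by positivity)).and (hlarge _)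
    filter_upwards [e1, (tendsto_order.1 hεlim).2 (η / 4) (by positivity)] with n h1 h2 x hx
    obtain ⟨z, hz, hxz⟩ := mem_iUnion₂.1 (ht hx)
    have h3 := hp n z (h1 z hz).2
    have h4 := (h1 z hz).1
    rw [Metric.mem_ball] at hxz
    have h5 := dist_triangle4 (i n x) (i n z) (j n (p n z)) (j n (f z))
    have h6 := dist_triangle (i n x) (j n (f z)) (j n (f x))
    rw [(hi n).dist_eq, (hj n).dist_eq] at h5
    rw [(hj n).dist_eq, hfi.dist_eq, dist_comm z x] at h6
    linarith
  have hfm := hfi.continuous.measurable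
  have hfin1 : ∀ s, Bornology.IsBounded s → X.coreMeasure.map f s < ∞ :=
    fun s hs => X.map_coreMeasure_lt_top hfi hs
  have hfin2 : ∀ s, Bornology.IsBounded s → Y.coreMeasure s < ∞ := fun s hs =>
    Y.coreMeasure_lt_top hs
  have hmeas : X.coreMeasure.map f = Y.coreMeasure := by
    refine measure_ext_of_isClosed_isBounded hfin1 fun B hB hBb => le_antisymm ?_ ?_
    · refine measure_le_of_forall_thickening hfin2 hB hBb (c := 2) (fun η hη => ?_) two_pos
      have hCb : Bornology.IsBounded (f ⁻¹' B) := hfi.antilipschitz.isBounded_preimage hBb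
      have hC : IsCompact (f ⁻¹' B) :=
        Metric.isCompact_of_isClosed_isBounded (hB.preimage hfi.continuous) hCb
      obtain ⟨t, ht⟩ := hCb.subset_closedBall X.coreRoot
      obtain ⟨n, h1, h2, h3⟩ := ((unif _ hC η hη).and (((tendsto_order.1 hεlim).2 η hη).and
        (hlarge t))).exists
      rw [Measure.map_apply hfm hB.measurableSet]
      have hm := (hMN n).mass (i n '' (f ⁻¹' B))
        (hC.image (hi n).continuous).isClosed.measurableSet (by
          rintro _ ⟨x, hx, rfl⟩
          rw [Metric.mem_closedBall, (hi n).dist_eq]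
          exact (ht hx).trans h3)
      rw [Measure.map_apply (hi n).continuous.measurable
        (hC.image (hi n).continuous).isClosed.measurableSet,
        preimage_image_eq _ (hi n).injective, Measure.map_apply (hj n).continuous.measurable
        Metric.isOpen_thickening.measurableSet] at hm
      refine hm.trans (add_le_add (measure_mono fun y hy => ?_) (ENNReal.ofReal_le_ofReal h2.le))
      obtain ⟨_, ⟨x, hx, rfl⟩, hxy⟩ := Metric.mem_thickening_iff.1 hy
      refine Metric.mem_thickening_iff.2 ⟨f x, hx, ?_⟩
      rw [← (hj n).dist_eq]
      linarith [dist_triangle (j n y) (i n x) (j n (f x)), h1 x hx]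
    · refine measure_le_of_forall_thickening hfin1 hB hBb (c := 2) (fun η hη => ?_) two_pos
      obtain ⟨t, ht⟩ := hBb.subset_closedBall Y.coreRoot
      -- Points of `X` matched with `B` lie within `t + 2 * ε n ≤ t + 2` of the root, so uniformity
      -- is needed only on this ball, before `n` is chosen.
      obtain ⟨n, h1, h2, h3⟩ := ((unif _ (isCompact_closedBall X.coreRoot (t + 2)) η hη).and
        (((tendsto_order.1 hεlim).2 η hη).and (hlarge t))).exists
      have hBc : IsCompact B := Metric.isCompact_of_isClosed_isBounded hB hBb
      have hm := (hNM n).mass (j n '' B)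
        (hBc.image (hj n).continuous).isClosed.measurableSet (by
          rintro _ ⟨x, hx, rfl⟩
          rw [Metric.mem_closedBall, (hj n).dist_eq]
          exact (ht hx).trans h3)
      rw [Measure.map_apply (hj n).continuous.measurable
        (hBc.image (hj n).continuous).isClosed.measurableSet,
        preimage_image_eq _ (hj n).injective, Measure.map_apply (hi n).continuous.measurable
        Metric.isOpen_thickening.measurableSet] at hm
      rw [Measure.map_apply hfm Metric.isOpen_thickening.measurableSet]
      refine hm.trans (add_le_add (measure_mono fun x hx => ?_) (ENNReal.ofReal_le_ofReal h2.le))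
      obtain ⟨_, ⟨y, hy, rfl⟩, hxy⟩ := Metric.mem_thickening_iff.1 hx
      refine Metric.mem_thickening_iff.2 ⟨y, hy, ?_⟩
      have hyt := ht hy
      rw [Metric.mem_closedBall, ← (hj n).dist_eq] at hyt
      have hxC : x ∈ Metric.closedBall X.coreRoot (t + 2) := by
        rw [Metric.mem_closedBall, ← (hi n).dist_eq]
        linarith [dist_triangle4 (i n x) (j n y) (j n Y.coreRoot) (i n X.coreRoot), hr n, hε1 n,
          dist_comm (i n X.coreRoot) (j n Y.coreRoot)]
      rw [← (hj n).dist_eq]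
      linarith [dist_triangle_left (j n (f x)) (j n y) (i n x), h1 x hxC]
  have hsurj : Function.Surjective f := by
    intro y
    rcases Y.core_eq y with hy | rfl
    · rw [← coreSupport_eq, ← hmeas, support_map _ hfi] at hy
      obtain ⟨x, -, hx⟩ := hy
      exact ⟨x, hx⟩
    · exact ⟨_, hfr⟩
  exact ⟨⟨Equiv.ofBijective f ⟨hfi.injective, hsurj⟩, hfi⟩, hfr, hmeas⟩

end MMSpace

/-! ### Vague limits on proper spaces -/

section VagueLimit

open scoped NNReal CompactlySupported

variable {W : Type*} [MetricSpace W] [ProperSpace W] [MeasurableSpace W] [BorelSpace W]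

/-- Compactness of locally bounded families of measures in the vague topology. -/
theorem exists_vague_limit (𝒰 : Ultrafilter ℕ) (M : ℕ → Measure W)
    (hb : ∀ B, Bornology.IsBounded B → ∃ C : ℝ≥0, ∀ᶠ k in 𝒰, M k B ≤ C) :
    ∃ μ : Measure W, (∀ B, Bornology.IsBounded B → μ B < ∞) ∧
      ∀ f : C_c(W, ℝ≥0), Tendsto (fun k => ∫⁻ x, f x ∂M k) 𝒰 (𝓝 (∫⁻ x, f x ∂μ)) := by
  have hlim : ∀ f : C_c(W, ℝ≥0), ∃ c : ℝ≥0, Tendsto (fun k => ∫⁻ x, f x ∂M k) 𝒰 (𝓝 c) := by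
    intro f
    obtain ⟨y, -, hy⟩ := isCompact_univ.ultrafilter_le_nhds'
      (𝒰.map fun k => ∫⁻ x, f x ∂M k) univ_mem
    obtain ⟨C, hC⟩ := hb _ f.hasCompactSupport.isCompact.isBounded
    obtain ⟨D, hD⟩ := (f.hasCompactSupport.isCompact_range f.continuous).bddAbove
    have hle : y ≤ D * C := by
      have hy : Tendsto (fun k => ∫⁻ x, f x ∂M k) 𝒰 (𝓝 y) := hy
      refine le_of_tendsto hy ?_
      filter_upwards [hC] with k hk
      calc ∫⁻ x, f x ∂M k ≤ ∫⁻ x, (tsupport f).indicator (fun _ => (D : ℝ≥0∞)) x ∂M k := by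
            refine lintegral_mono fun x => ?_
            by_cases hx : x ∈ tsupport f
            · rw [indicator_of_mem hx]
              exact ENNReal.coe_le_coe.2 (hD (mem_range_self x))
            · simp [image_eq_zero_of_notMem_tsupport hx]
        _ = D * M k (tsupport f) := by
            rw [lintegral_indicator (isClosed_tsupport f).measurableSet, setLIntegral_const]
        _ ≤ D * C := by gcongr
    have hy' : y ≠ ∞ := ne_top_of_le_ne_top (by finiteness) hle
    refine ⟨y.toNNReal, ?_⟩
    rw [ENNReal.coe_toNNReal hy']
    exact hy
  choose Λ hΛ using hlim
  -- The ultrafilter limits of the integrals are finite and additive in `f`; the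
  -- Riesz-Markov-Kakutani theorem represents them by a measure.
  let L : C_c(W, ℝ≥0) →ₗ[ℝ≥0] ℝ≥0 :=
    { toFun := Λ
      map_add' := fun f g => by
        have h1 := (hΛ f).add (hΛ g)
        have h2 := hΛ (f + g)
        have h3 : (fun k => ∫⁻ x, (f + g) x ∂M k) =
            fun k => ∫⁻ x, f x ∂M k + ∫⁻ x, g x ∂M k := by
          ext k
          rw [← lintegral_add_left (by fun_prop)]
          simp
        rw [h3] at h2
        exact_mod_cast tendsto_nhds_unique h2 h1
      map_smul' := fun c f => by
        have h1 := ENNReal.Tendsto.const_mul (a := (c : ℝ≥0∞)) (hΛ f)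
          (Or.inr ENNReal.coe_ne_top)
        have h2 := hΛ (c • f)
        have h3 : (fun k => ∫⁻ x, (c • f) x ∂M k) = fun k => c * ∫⁻ x, f x ∂M k := by
          ext k
          rw [← lintegral_const_mul _ (by fun_prop)]
          simp
        rw [h3] at h2
        have := tendsto_nhds_unique h2 h1
        rw [RingHom.id_apply, smul_eq_mul]
        exact_mod_cast this }
  refine ⟨NNRealRMK.rieszMeasure L, fun B hB => ?_, fun f => ?_⟩
  · exact (measure_mono subset_closure).trans_lt
      (Metric.isCompact_of_isClosed_isBounded isClosed_closure hB.closure).measure_lt_top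
  · rw [NNRealRMK.lintegral_rieszMeasure]
    exact hΛ f

variable {𝒰 : Ultrafilter ℕ} {M : ℕ → Measure W} {μ : Measure W}

/-- A compactly supported bump function around a bounded set. -/
theorem exists_bump {B : Set W} (hB : Bornology.IsBounded B) {η : ℝ} (hη : 0 < η) :
    ∃ g : C_c(W, ℝ≥0), ∀ ν : Measure W,
      ν B ≤ ∫⁻ x, g x ∂ν ∧ ∫⁻ x, g x ∂ν ≤ ν (Metric.thickening η B) := by
  let t := thickenedIndicator hη B
  have hz : ∀ x, x ∉ Metric.thickening η B → t x = 0 := fun x hx => thickenedIndicator_zero hη _ hx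
  have hc : HasCompactSupport t := by
    refine HasCompactSupport.intro (K := closure (Metric.thickening η B))
      (Metric.isCompact_of_isClosed_isBounded isClosed_closure hB.thickening.closure)
      fun x hx => hz x fun h => hx (subset_closure h)
  refine ⟨⟨t.toContinuousMap, hc⟩, fun ν => ⟨?_, ?_⟩⟩
  · have h1 : Measurable fun x => (t x : ℝ≥0∞) := by
      have := t.continuous.measurable
      fun_prop
    have := mul_meas_ge_le_lintegral (μ := ν) h1 1
    rw [one_mul] at this
    refine le_trans (measure_mono fun x hx => ?_) this
    have : t x = 1 := thickenedIndicator_one hη _ hx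
    simp [this]
  · rw [← lintegral_indicator_one Metric.isOpen_thickening.measurableSet]
    refine lintegral_mono fun x => ?_
    by_cases hx : x ∈ Metric.thickening η B
    · rw [indicator_of_mem hx]
      change (t x : ℝ≥0∞) ≤ 1
      exact_mod_cast thickenedIndicator_le_one hη B x
    · rw [indicator_of_notMem hx]
      change (t x : ℝ≥0∞) ≤ 0
      exact_mod_cast (hz x hx).le

/-- Vague convergence sees only continuous functions, so a bump between `B` and its thickening
stands in for the indicator. The thickening is the price. -/
theorem le_measure_thickening_of_vague
    (h : ∀ f : C_c(W, ℝ≥0), Tendsto (fun k => ∫⁻ x, f x ∂M k) 𝒰 (𝓝 (∫⁻ x, f x ∂μ)))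
    {B : Set W} (hB : Bornology.IsBounded B) {η : ℝ} (hη : 0 < η) {c : ℝ≥0∞}
    (hc : ∀ᶠ k in 𝒰, c ≤ M k B) : c ≤ μ (Metric.thickening η B) := by
  obtain ⟨g, hg⟩ := exists_bump hB hη
  exact (ge_of_tendsto (h g) (hc.mono fun k hk => hk.trans (hg (M k)).1)).trans (hg μ).2

theorem measure_le_of_vague
    (h : ∀ f : C_c(W, ℝ≥0), Tendsto (fun k => ∫⁻ x, f x ∂M k) 𝒰 (𝓝 (∫⁻ x, f x ∂μ)))
    {B : Set W} (hB : Bornology.IsBounded B) {η : ℝ} (hη : 0 < η) {c : ℝ≥0∞}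
    (hc : ∀ᶠ k in 𝒰, M k (Metric.thickening η B) ≤ c) : μ B ≤ c := by
  obtain ⟨g, hg⟩ := exists_bump hB hη
  exact (hg μ).1.trans (le_of_tendsto (h g) (hc.mono fun k hk => (hg (M k)).2.trans hk))

end VagueLimit

/-! ### Accumulating the errors of a chain of approximations -/

section Telescope

variable {E : Type} [MetricSpace E]

theorem half_pow_le_one (k : ℕ) : (1 / 2 : ℝ) ^ k ≤ 1 := pow_le_one₀ (by norm_num) (by norm_num)

/-- The step from `k + 1` to `k` costs `(1 / 2) ^ k / 4`, exactly the decrease of `(1 / 2) ^ k / 2`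
when `k` grows by one. Error and radius therefore telescope, and the path stays where the next step
is allowed. -/
theorem exists_dist_le_of_chain {A : ℕ → Set E} {o : E}
    (h : ∀ k, ∀ x ∈ A (k + 1), dist x o ≤ k → ∃ y ∈ A k, dist x y ≤ (1 / 2 : ℝ) ^ k / 4)
    {n k : ℕ} (hnk : n ≤ k) : ∀ x ∈ A k, dist x o ≤ n - 1 + (1 / 2 : ℝ) ^ k / 2 →
      ∃ y ∈ A n, dist x y ≤ (1 / 2 : ℝ) ^ n - (1 / 2 : ℝ) ^ k / 2 := by
  induction k, hnk using Nat.le_induction with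
  | base => exact fun x hx _ => ⟨x, hx, by rw [dist_self]; linarith [pow_pos (by norm_num : (0:ℝ) < 1 / 2) n]⟩
  | succ k hnk ih =>
    intro x hx hxo
    have hk : (n : ℝ) ≤ k := by exact_mod_cast hnk
    have hp := pow_pos (by norm_num : (0:ℝ) < 1 / 2) k
    have h1 := half_pow_le_one k
    have hs : (1 / 2 : ℝ) ^ (k + 1) = (1 / 2 : ℝ) ^ k / 2 := by rw [pow_succ]; ring
    rw [hs] at hxo ⊢
    obtain ⟨y, hy, hxy⟩ := h k x hx (by linarith)
    obtain ⟨z, hz, hyz⟩ := ih y hy (by linarith [dist_triangle_left y o x])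
    exact ⟨z, hz, by linarith [dist_triangle x y z]⟩

variable [MeasurableSpace E] [BorelSpace E]

theorem nearAt_chain {M : ℕ → Measure E} {o : E}
    (h : ∀ k : ℕ, NearAt o k ((1 / 2 : ℝ) ^ k / 4) (M k) (M (k + 1))) {n k : ℕ} (hnk : n ≤ k) :
    NearAt o (n - 1) ((1 / 2 : ℝ) ^ n - (1 / 2 : ℝ) ^ k / 2) (M n) (M k) := by
  induction k, hnk using Nat.le_induction with
  | base => exact NearAt.refl _ _ (by linarith [pow_pos (by norm_num : (0:ℝ) < 1 / 2) n]) _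
  | succ k hnk ih =>
    have hk : (n : ℝ) ≤ k := by exact_mod_cast hnk
    have hp := pow_pos (by norm_num : (0:ℝ) < 1 / 2) k
    have h1 := half_pow_le_one n
    have h2 : (1 / 2 : ℝ) ^ k ≤ (1 / 2 : ℝ) ^ n :=
      pow_le_pow_of_le_one (by norm_num) (by norm_num) hnk
    have hs : (1 / 2 : ℝ) ^ (k + 1) = (1 / 2 : ℝ) ^ k / 2 := by rw [pow_succ]; ring
    rw [hs]
    convert! ih.trans (by linarith) (by positivity) ((h k).mono (S' := n - 1 +
      ((1 / 2 : ℝ) ^ n - (1 / 2 : ℝ) ^ k / 2)) (by rw [dist_self]; linarith) le_rfl) using 1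
    ring

/-- Here the newest step comes first and enlarges the ball for the remaining ones, so the induction
must carry all radii `R` up to a bound. -/
theorem nearAt_chain_symm {M : ℕ → Measure E} {o : E}
    (h : ∀ k : ℕ, NearAt o k ((1 / 2 : ℝ) ^ k / 4) (M (k + 1)) (M k)) {n k : ℕ} (hnk : n ≤ k) :
    ∀ R ≤ n - 1 + (1 / 2 : ℝ) ^ k / 2,
      NearAt o R ((1 / 2 : ℝ) ^ n - (1 / 2 : ℝ) ^ k / 2) (M k) (M n) := by
  induction k, hnk using Nat.le_induction with
  | base =>
    exact fun R _ => NearAt.refl _ _ (by linarith [pow_pos (by norm_num : (0:ℝ) < 1 / 2) n]) _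
  | succ k hnk ih =>
    intro R hR
    have hk : (n : ℝ) ≤ k := by exact_mod_cast hnk
    have hp := pow_pos (by norm_num : (0:ℝ) < 1 / 2) k
    have h1 := half_pow_le_one k
    have h2 : (1 / 2 : ℝ) ^ k ≤ (1 / 2 : ℝ) ^ n :=
      pow_le_pow_of_le_one (by norm_num) (by norm_num) hnk
    have hs : (1 / 2 : ℝ) ^ (k + 1) = (1 / 2 : ℝ) ^ k / 2 := by rw [pow_succ]; ring
    rw [hs] at hR ⊢
    convert! ((h k).mono (o' := o) (S' := R) (by rw [dist_self]; linarith) le_rfl).trans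
      (by positivity) (by linarith) (ih (R + (1 / 2 : ℝ) ^ k / 4) (by linarith)) using 1
    ring

end Telescope

/-! ### Transport of local comparisons along isometries -/

namespace MMSpace

theorem nearAt_comp {X Y : MMSpace} {E F : Type} [MetricSpace E] [MeasurableSpace E]
    [BorelSpace E] [MetricSpace F] [MeasurableSpace F] [BorelSpace F] {i : X.core → E}
    {j : Y.core → E} (hi : Isometry i) (hj : Isometry j) {e : E → F} (he : Isometry e) {o : E}
    {S ε : ℝ} (h : NearAt o S ε (X.coreMeasure.map i) (Y.coreMeasure.map j)) :
    NearAt (e o) S ε (X.coreMeasure.map (e ∘ i)) (Y.coreMeasure.map (e ∘ j)) where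
  mass B hB hBS := by
    have hm := he.continuous.measurable
    rw [← Measure.map_map hm hi.continuous.measurable, ← Measure.map_map hm hj.continuous.measurable,
      Measure.map_apply hm hB, Measure.map_apply hm Metric.isOpen_thickening.measurableSet]
    refine (h.mass _ (hm hB) fun x hx => ?_).trans (add_le_add (measure_mono ?_) le_rfl)
    · simpa [he.dist_eq] using hBS hx
    · rw [← he.preimage_thickening_image]
      exact preimage_mono (Metric.thickening_subset_of_subset _ (image_preimage_subset _ _))
  supp := by
    rw [support_map _ (he.comp hi), support_map _ (he.comp hj)]
    rintro _ ⟨x, hx, rfl⟩ hxo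
    rw [Function.comp_apply, he.dist_eq] at hxo
    obtain ⟨y, hy, hxy⟩ := h.supp (i x) (by rw [support_map _ hi]; exact mem_image_of_mem i hx) hxo
    rw [support_map _ hj] at hy
    obtain ⟨y, hy, rfl⟩ := hy
    exact ⟨_, mem_image_of_mem _ hy, by rwa [Function.comp_apply, Function.comp_apply, he.dist_eq]⟩

/-- Used to descend from a completion to a closed subspace. Completeness of `E` makes `e` a closed
embedding, so images of Borel sets are Borel. -/
theorem nearAt_of_comp {X Y : MMSpace} {E F : Type} [MetricSpace E] [CompleteSpace E]
    [MeasurableSpace E] [BorelSpace E] [MetricSpace F] [MeasurableSpace F] [BorelSpace F]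
    {i : X.core → E} {j : Y.core → E} (hi : Isometry i) (hj : Isometry j) {e : E → F}
    (he : Isometry e) {o : E} {S ε : ℝ}
    (h : NearAt (e o) S ε (X.coreMeasure.map (e ∘ i)) (Y.coreMeasure.map (e ∘ j))) :
    NearAt o S ε (X.coreMeasure.map i) (Y.coreMeasure.map j) where
  mass B hB hBS := by
    have hm := he.isClosedEmbedding.measurableEmbedding
    have := h.mass (e '' B) (hm.measurableSet_image.2 hB) (by
      rintro _ ⟨x, hx, rfl⟩
      simpa [he.dist_eq] using hBS hx)
    rwa [← Measure.map_map hm.measurable hi.continuous.measurable,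
      ← Measure.map_map hm.measurable hj.continuous.measurable, hm.map_apply, hm.map_apply,
      preimage_image_eq _ he.injective, he.preimage_thickening_image] at this
  supp := by
    have := h.supp
    rw [support_map _ (he.comp hi), support_map _ (he.comp hj)] at this
    rw [support_map _ hi, support_map _ hj]
    rintro _ ⟨x, hx, rfl⟩ hxo
    obtain ⟨_, ⟨y, hy, rfl⟩, hxy⟩ := this _ (mem_image_of_mem _ hx)
      (by rwa [Function.comp_apply, he.dist_eq])
    exact ⟨_, mem_image_of_mem _ hy, by rwa [Function.comp_apply, Function.comp_apply,
      he.dist_eq] at hxy⟩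

end MMSpace

/-! ### Limits of consecutively close sequences -/

namespace MMSpace

/-- A sequence of consecutively close spaces can be embedded into a single proper space. -/
theorem exists_proper_of_close {X : ℕ → MMSpace} [∀ n, ProperSpace (X n).core]
    (h : ∀ n : ℕ, (X n).Close (X (n + 1)) (n + 1) ((1 / 2 : ℝ) ^ n / 4)) :
    ∃ (W : Type) (_ : MetricSpace W) (_ : ProperSpace W) (_ : MeasurableSpace W)
      (_ : BorelSpace W) (o : W) (f : ∀ n, (X n).core → W), (∀ n, Isometry (f n)) ∧
      (∀ n, dist (f n (X n).coreRoot) o ≤ (1 / 2 : ℝ) ^ n / 2) ∧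
      (∀ n : ℕ, NearAt o n ((1 / 2 : ℝ) ^ n / 4) ((X n).coreMeasure.map (f n))
        ((X (n + 1)).coreMeasure.map (f (n + 1)))) ∧
      ∀ n : ℕ, NearAt o n ((1 / 2 : ℝ) ^ n / 4) ((X (n + 1)).coreMeasure.map (f (n + 1)))
        ((X n).coreMeasure.map (f n)) := by
  choose P mP msP bP i j hi hj hMN hNM hr using h
  obtain ⟨E, _, g, hg, hgc⟩ := exists_chain_amalgam hi hj
  let Ē := UniformSpace.Completion E
  let c : E → Ē := (↑)
  have hc : Isometry c := UniformSpace.Completion.coe_isometry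
  let F : ∀ n, (X n).core → Ē := fun n => c ∘ g n ∘ i n
  have hF : ∀ n, Isometry (F n) := fun n => hc.comp ((hg n).comp (hi n))
  have hFj : ∀ n, (c ∘ g n) ∘ j n = F (n + 1) := fun n => funext fun a => congrArg c (hgc n a)
  have hFi : ∀ n, (c ∘ g n) ∘ i n = F n := fun n => rfl
  have hroot : ∀ n, dist (F n (X n).coreRoot) (F (n + 1) (X (n + 1)).coreRoot) ≤
      (1 / 4) * (1 / 2 : ℝ) ^ n := fun n => by
    have h1 := hr n
    rw [← (hc.comp (hg n)).dist_eq] at h1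
    rw [← hFj, ← hFi]
    exact h1.trans_eq (by ring)
  obtain ⟨o', ho'⟩ := cauchySeq_tendsto_of_complete
    (cauchySeq_of_le_geometric (1 / 2) (1 / 4) (by norm_num) hroot)
  have hdist : ∀ n, dist (F n (X n).coreRoot) o' ≤ (1 / 2 : ℝ) ^ n / 2 := fun n =>
    (dist_le_of_le_geometric_of_tendsto (1 / 2) (1 / 4) (by norm_num) hroot ho' n).trans_eq
      (by ring)
  -- The completion need not be proper, since the auxiliary spaces `P n` are arbitrary. Only the
  -- closure of the embedded cores is kept.
  let V : Set Ē := closure (⋃ n, range (F n))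
  have hV : IsClosed V := isClosed_closure
  have hFV : ∀ n x, F n x ∈ V := fun n x => subset_closure (mem_iUnion.2 ⟨n, mem_range_self x⟩)
  have ho'V : o' ∈ V := hV.mem_of_tendsto ho' (Eventually.of_forall fun n => hFV n _)
  have back : ∀ k, ∀ x ∈ range (F (k + 1)), dist x o' ≤ k →
      ∃ y ∈ range (F k), dist x y ≤ (1 / 2 : ℝ) ^ k / 4 := by
    rintro k _ ⟨x, rfl⟩ hx
    have h1 : dist x (X (k + 1)).coreRoot ≤ k + 1 := by
      rw [← (hF (k + 1)).dist_eq]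
      have := hdist (k + 1)
      have := half_pow_le_one (k + 1)
      linarith [dist_triangle_right (F (k + 1) x) (F (k + 1) (X (k + 1)).coreRoot) o']
    obtain ⟨y, hy⟩ := Close.exists_dist_le (hj k) (hi k) (hNM k)
      (by rw [dist_comm]; exact hr k) x h1
    refine ⟨_, mem_range_self y, ?_⟩
    rw [← hFj, ← hFi]
    exact ((hc.comp (hg k)).dist_eq _ _).trans_le hy
  -- Bounded points of late cores can be traced back to core `n` with an error below `ε / 4`. The
  -- cores up to `n` contribute a compact set, so a finite net of it serves for all.
  have proper : ∀ R : ℝ, IsCompact (V ∩ Metric.closedBall o' R) := by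
    intro R
    refine TotallyBounded.isCompact_of_isClosed ?_ (hV.inter Metric.isClosed_closedBall)
    refine Metric.totallyBounded_iff.2 fun ε hε => ?_
    obtain ⟨n, hn1, hn2⟩ : ∃ n : ℕ, (1 / 2 : ℝ) ^ n < ε / 4 ∧ R + 2 ≤ n := by
      have e1 : ∀ᶠ n : ℕ in atTop, (1 / 2 : ℝ) ^ n < ε / 4 :=
        (tendsto_pow_atTop_nhds_zero_of_lt_one (by norm_num) (by norm_num)).eventually
          (gt_mem_nhds (by positivity))
      exact (e1.and (tendsto_natCast_atTop_atTop.eventually_ge_atTop (R + 2))).exists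
    let K : Set Ē := ⋃ k ∈ Iic n, F k '' Metric.closedBall (X k).coreRoot (R + 3)
    have hK : IsCompact K := (finite_Iic n).isCompact_biUnion fun k _ =>
      (isCompact_closedBall _ _).image (hF k).continuous
    have memK : ∀ k ≤ n, ∀ x ∈ range (F k), dist x o' ≤ R + 2 → x ∈ K := by
      rintro k hk _ ⟨x, rfl⟩ hx
      refine mem_iUnion₂.2 ⟨k, hk, mem_image_of_mem _ ?_⟩
      rw [Metric.mem_closedBall, ← (hF k).dist_eq]
      have := hdist k
      have := half_pow_le_one k
      linarith [dist_triangle_right (F k x) (F k (X k).coreRoot) o']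
    obtain ⟨t, htf, ht⟩ := Metric.totallyBounded_iff.1 hK.totallyBounded (ε / 4) (by positivity)
    refine ⟨t, htf, ?_⟩
    rintro x ⟨hxV, hxR⟩
    rw [Metric.mem_closedBall] at hxR
    obtain ⟨z, hz, hxz⟩ := Metric.mem_closure_iff.1 hxV (min (ε / 4) 1) (by positivity)
    have hxz1 := hxz.trans_le (min_le_left _ _)
    have hxz2 := hxz.trans_le (min_le_right _ _)
    obtain ⟨k, hk⟩ := mem_iUnion.1 hz
    have hzo : dist z o' ≤ R + 1 := by linarith [dist_triangle_left z o' x]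
    have hw : ∃ w ∈ K, dist z w ≤ ε / 4 := by
      rcases le_total k n with hkn | hkn
      · exact ⟨z, memK k hkn z hk (by linarith), by rw [dist_self]; positivity⟩
      · have hp := pow_pos (by norm_num : (0:ℝ) < 1 / 2) k
        obtain ⟨w, hw, hzw⟩ := exists_dist_le_of_chain (A := fun k => range (F k)) back hkn z hk
          (by linarith)
        have := half_pow_le_one n
        exact ⟨w, memK n le_rfl w hw (by linarith [dist_triangle_left w o' z]), by linarith⟩
    obtain ⟨w, hw, hzw⟩ := hw
    obtain ⟨y, hy, hwy⟩ := mem_iUnion₂.1 (ht hw)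
    refine mem_iUnion₂.2 ⟨y, hy, ?_⟩
    rw [Metric.mem_ball] at hwy ⊢
    linarith [dist_triangle4 x z w y]
  have hval : Isometry (Subtype.val : V → Ē) := isometry_subtype_coe
  have hVp : ProperSpace V := by
    refine ProperSpace.of_isCompact_closedBall_of_le (0:ℝ) fun x r hr => ?_
    rw [hval.isEmbedding.isCompact_iff]
    refine (proper (r + dist (x : Ē) o')).of_isClosed_subset
      (hV.isClosedEmbedding_subtypeVal.isClosedMap _ Metric.isClosed_closedBall) ?_
    rintro _ ⟨y, hy, rfl⟩
    have hy : dist (y : Ē) x ≤ r := hy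
    exact ⟨y.2, by rw [Metric.mem_closedBall]; linarith [dist_triangle (y : Ē) x o']⟩
  have : CompleteSpace V := hV.completeSpace_coe
  let f : ∀ n, (X n).core → V := fun n x => ⟨F n x, hFV n x⟩
  have hf : ∀ n, Isometry (f n) := fun n => Isometry.of_dist_eq (hF n).dist_eq
  borelize ↥V
  borelize Ē
  refine ⟨↥V, inferInstance, hVp, inferInstance, inferInstance, ⟨o', ho'V⟩, f, hf, hdist,
    fun n => nearAt_of_comp (hf n) (hf (n + 1)) hval ?_,
    fun n => nearAt_of_comp (hf (n + 1)) (hf n) hval ?_⟩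
  · have h1 := nearAt_comp (hi n) (hj n) (hc.comp (hg n)) (hMN n)
    rw [hFi, hFj] at h1
    refine h1.mono ?_ le_rfl
    have := hdist n
    have := half_pow_le_one n
    rw [dist_comm]
    change _ + dist (F n (X n).coreRoot) o' ≤ _
    linarith
  · have h1 := nearAt_comp (hj n) (hi n) (hc.comp (hg n)) (hNM n)
    rw [hFi, hFj] at h1
    refine h1.mono ?_ le_rfl
    have h2 := hdist (n + 1)
    have h3 := half_pow_le_one (n + 1)
    have h4 : (c ∘ g n) (j n (X (n + 1)).coreRoot) = F (n + 1) (X (n + 1)).coreRoot :=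
      congrFun (hFj n) _
    rw [dist_comm, h4]
    change _ + dist (F (n + 1) (X (n + 1)).coreRoot) o' ≤ _
    linarith

theorem globalLowerMass_restrict_le (X : MMSpace) {S δ : ℝ} {x : X.core} (hx : x ∈ X.coreSupport)
    (hxS : dist x X.coreRoot < S) :
    (X.restrict S).globalLowerMass δ ≤ X.coreMeasure (Metric.closedBall x δ) := by
  have h1 : (x : X.carrier) ∈ (X.restrict S).μ.support :=
    mem_support_restrict_closedBall (M := X.μ) (r := X.root) hx hxS
  rw [globalLowerMass_eq]
  refine (iInf₂_le (⟨x.1, Or.inl h1⟩ : (X.restrict S).core) h1).trans ?_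
  have h2 := (X.restrict S).coreMeasure_preimage (Metric.closedBall (x : X.carrier) δ)
  have h3 := X.coreMeasure_preimage (Metric.closedBall (x : X.carrier) δ)
  refine h2.trans_le ((Measure.restrict_apply_le _ _).trans h3.ge)

/-- A sequence of consecutively close spaces with uniform lower mass bounds has a limit. -/
theorem exists_limit_of_close {X : ℕ → MMSpace} [∀ n, ProperSpace (X n).core]
    (h : ∀ n : ℕ, (X n).Close (X (n + 1)) (n + 1) ((1 / 2 : ℝ) ^ n / 4))
    (hlow : ∀ R : ℝ, ∃ S > R, ∀ δ > 0, ∃ δ' ≤ δ, ∃ c > 0, ∀ᶠ k in atTop,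
      c ≤ ((X k).restrict S).globalLowerMass δ') :
    ∃ Y : MMSpace, ProperSpace Y.carrier ∧ ∀ S, ∀ ε > 0, ∀ᶠ n in atTop, (X n).Close Y S ε := by
  obtain ⟨W, _, _, _, _, o, f, hf, hr, hM, hN⟩ := exists_proper_of_close h
  let M : ℕ → Measure W := fun n => (X n).coreMeasure.map (f n)
  have hMfin : ∀ n B, Bornology.IsBounded B → M n B < ∞ :=
    fun n B hB => (X n).map_coreMeasure_lt_top (hf n) hB
  have pow_pos' : ∀ n : ℕ, 0 < (1 / 2 : ℝ) ^ n := fun n => pow_pos (by norm_num) n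
  have fwd : ∀ {n k : ℕ}, n ≤ k → NearAt o (n - 1) ((1 / 2 : ℝ) ^ n) (M n) (M k) :=
    fun {n k} hnk => (nearAt_chain hM hnk).mono (by simp) (by linarith [pow_pos' k])
  have bwd : ∀ {n k : ℕ}, n ≤ k → NearAt o (n - 1) ((1 / 2 : ℝ) ^ n) (M k) (M n) :=
    fun {n k} hnk => (nearAt_chain_symm hN hnk (n - 1) (by linarith [pow_pos' k])).mono (by simp)
      (by linarith [pow_pos' k])
  set 𝒰 : Ultrafilter ℕ := hyperfilter ℕ
  have hU : (𝒰 : Filter ℕ) ≤ atTop := by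
    rw [← Nat.cofinite_eq_atTop]; exact hyperfilter_le_cofinite
  have hge : ∀ n, ∀ᶠ k in (𝒰 : Filter ℕ), n ≤ k :=
    fun n => (eventually_ge_atTop n).filter_mono hU
  have thick : ∀ (B : Set W) (R ε : ℝ), B ⊆ Metric.closedBall o R →
      Metric.thickening ε B ⊆ Metric.closedBall o (R + ε) := by
    intro B R ε hB x hx
    obtain ⟨z, hz, hxz⟩ := Metric.mem_thickening_iff.1 hx
    have := hB hz
    rw [Metric.mem_closedBall] at this ⊢
    linarith [dist_triangle x z o]
  -- On a bounded set, all later masses are dominated by that of one fixed `M n` on a thickening.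
  obtain ⟨μ, hμfin, hμ⟩ := exists_vague_limit 𝒰 M fun B hB => by
    obtain ⟨R, hR⟩ := hB.subset_closedBall o
    obtain ⟨n, hn⟩ := exists_nat_ge (R + 1)
    have hfin : M n (Metric.thickening ((1 / 2 : ℝ) ^ n) (Metric.closedBall o R)) +
        ENNReal.ofReal ((1 / 2 : ℝ) ^ n) ≠ ∞ :=
      ENNReal.add_ne_top.2 ⟨(hMfin n _ Metric.isBounded_closedBall.thickening).ne,
        ENNReal.ofReal_ne_top⟩
    refine ⟨_, (hge n).mono fun k hk => (measure_mono hR).trans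
      (((bwd hk).mass _ Metric.isClosed_closedBall.measurableSet
        (Metric.closedBall_subset_closedBall (by linarith))).trans
        (ENNReal.coe_toNNReal hfin).ge)⟩
  have near1 : ∀ (n : ℕ) (R : ℝ), R + 2 ≤ n → NearAt o R (3 * (1 / 2 : ℝ) ^ n) (M n) μ := by
    intro n R hR
    refine ⟨fun B hB hBR => ?_, fun x hx hxR => ?_⟩
    · have hBb : Bornology.IsBounded B := Metric.isBounded_closedBall.subset hBR
      -- One thickening comes from passing to `M k`, the other from the bump function in the vague
      -- limit; the constant `3` covers both.
      have h1 : M n B - ENNReal.ofReal ((1 / 2 : ℝ) ^ n) ≤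
          μ (Metric.thickening ((1 / 2 : ℝ) ^ n) (Metric.thickening ((1 / 2 : ℝ) ^ n) B)) :=
        le_measure_thickening_of_vague hμ hBb.thickening (pow_pos' n) ((hge n).mono fun k hk =>
          tsub_le_iff_right.2 ((fwd hk).mass B hB
            (hBR.trans (Metric.closedBall_subset_closedBall (by linarith)))))
      refine (tsub_le_iff_right.1 h1).trans (add_le_add (measure_mono ?_)
        (ENNReal.ofReal_le_ofReal (by linarith [pow_pos' n])))
      exact (Metric.thickening_thickening_subset _ _ _).trans
        (Metric.thickening_mono (by linarith [pow_pos' n]) _)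
    · have hx' : ∀ k, ∃ y, n ≤ k → y ∈ (M k).support ∧ dist x y < (1 / 2 : ℝ) ^ n := by
        intro k
        by_cases hk : n ≤ k
        · obtain ⟨y, hy⟩ := (fwd hk).supp x hx (by linarith)
          exact ⟨y, fun _ => hy⟩
        · exact ⟨x, fun h => absurd h hk⟩
      choose y hy using hx'
      obtain ⟨z, hz, hyz⟩ := (isCompact_closedBall x ((1 / 2 : ℝ) ^ n)).ultrafilter_le_nhds'
        (𝒰.map y) ((hge n).mono fun k hk => by
          change dist (y k) x ≤ _
          rw [dist_comm]; exact (hy k hk).2.le)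
      have hyz : Tendsto y 𝒰 (𝓝 z) := hyz
      rw [Metric.mem_closedBall, dist_comm] at hz
      refine ⟨z, ?_, by linarith [pow_pos' n]⟩
      rw [Metric.nhds_basis_ball.mem_measureSupport]
      intro δ hδ
      -- The mass around `y k` could vanish in the limit, and `z` would then leave the support. The
      -- uniform lower bound `c` excludes this. The radii satisfy `δ/3 + δ/4 + δ/3 < δ`.
      obtain ⟨S, hS, hlow⟩ := hlow (R + 2)
      obtain ⟨δ', hδ', c, hc, hlow⟩ := hlow (δ / 3) (by positivity)
      have key : c ≤ μ (Metric.thickening (δ / 3) (Metric.closedBall z (δ / 3 + δ / 4))) := by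
        refine le_measure_thickening_of_vague hμ Metric.isBounded_closedBall (by positivity) ?_
        filter_upwards [hU hlow, hge n, Metric.tendsto_nhds.1 hyz (δ / 4) (by positivity)]
          with k h1 h2 h3
        obtain ⟨hyk, hxy⟩ := hy k h2
        rw [support_map _ (hf k)] at hyk
        obtain ⟨w, hw, hwy⟩ := hyk
        have h4 : dist w (X k).coreRoot < S := by
          rw [← (hf k).dist_eq, hwy]
          linarith [dist_triangle4 (y k) x o (f k (X k).coreRoot), dist_comm x (y k), hr k,
            dist_comm o (f k (X k).coreRoot), half_pow_le_one k, half_pow_le_one n]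
        refine h1.trans ((globalLowerMass_restrict_le _ hw h4).trans ?_)
        rw [Measure.map_apply (hf k).continuous.measurable
          Metric.isClosed_closedBall.measurableSet]
        refine measure_mono fun v hv => ?_
        rw [mem_preimage, Metric.mem_closedBall]
        rw [Metric.mem_closedBall, ← (hf k).dist_eq, hwy] at hv
        linarith [dist_triangle (f k v) (y k) z]
      refine (hc.trans_le key).trans_le (measure_mono fun v hv => ?_)
      obtain ⟨w, hw, hvw⟩ := Metric.mem_thickening_iff.1 hv
      rw [Metric.mem_closedBall] at hw
      rw [Metric.mem_ball]
      linarith [dist_triangle v w z]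
  have near2 : ∀ (n : ℕ) (R : ℝ), R + 2 ≤ n → NearAt o R (3 * (1 / 2 : ℝ) ^ n) μ (M n) := by
    intro n R hR
    have h1 := half_pow_le_one n
    refine ⟨fun B hB hBR => ?_, fun x hx hxR => ?_⟩
    · have hBb : Bornology.IsBounded B := Metric.isBounded_closedBall.subset hBR
      refine (measure_le_of_vague hμ hBb (pow_pos' n) (c := M n (Metric.thickening
        ((1 / 2 : ℝ) ^ n) (Metric.thickening ((1 / 2 : ℝ) ^ n) B)) +
        ENNReal.ofReal ((1 / 2 : ℝ) ^ n)) ((hge n).mono fun k hk => ?_)).trans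
        (add_le_add (measure_mono ?_) (ENNReal.ofReal_le_ofReal (by linarith [pow_pos' n])))
      · exact (bwd hk).mass _ Metric.isOpen_thickening.measurableSet
          ((thick _ _ _ hBR).trans (Metric.closedBall_subset_closedBall (by linarith)))
      · exact (Metric.thickening_thickening_subset _ _ _).trans
          (Metric.thickening_mono (by linarith [pow_pos' n]) _)
    -- This direction needs no lower mass bound: positive limit mass near `x` already forces mass of
    -- some later `M k`, hence support points.
    · have h2 : ∃ᶠ k in 𝒰, M k (Metric.ball x ((1 / 2 : ℝ) ^ n)) ≠ 0 := by
        intro hcon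
        simp only [not_not] at hcon
        have := measure_le_of_vague hμ (Metric.isBounded_ball (x := x) (r := (1 / 2 : ℝ) ^ n / 2))
          (half_pos (pow_pos' n)) (c := 0) (hcon.mono fun k hk => by
            rw [← hk]
            refine measure_mono fun v hv => ?_
            obtain ⟨w, hw, hvw⟩ := Metric.mem_thickening_iff.1 hv
            rw [Metric.mem_ball] at hw ⊢
            linarith [dist_triangle v w x])
        rw [Measure.mem_support_iff_forall] at hx
        exact (hx _ (Metric.ball_mem_nhds x (half_pos (pow_pos' n)))).not_ge this
      obtain ⟨k, hk, hnk⟩ := (h2.and_eventually (hge n)).exists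
      obtain ⟨y, hyx, hy⟩ := Measure.nonempty_inter_support_of_pos (pos_iff_ne_zero.2 hk)
      rw [Metric.mem_ball] at hyx
      obtain ⟨z, hz, hyz⟩ := (bwd hnk).supp y hy (by linarith [dist_triangle y x o])
      exact ⟨z, hz, by linarith [dist_triangle_left x z y, pow_pos' n]⟩
  let Y : MMSpace := { carrier := W, root := o, μ := μ, boundedlyFinite := hμfin }
  refine ⟨Y, ‹ProperSpace W›, fun S ε hε => ?_⟩
  have e1 : ∀ᶠ n : ℕ in atTop, (1 / 2 : ℝ) ^ n < ε / 4 :=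
    (tendsto_pow_atTop_nhds_zero_of_lt_one (by norm_num) (by norm_num)).eventually
      (gt_mem_nhds (by positivity))
  filter_upwards [e1, tendsto_natCast_atTop_atTop.eventually_ge_atTop (S + 3)] with n h1 h2
  have h3 := hr n
  have h4 := half_pow_le_one n
  have h5 := pow_pos' n
  have hY : Y.coreMeasure.map (Subtype.val : Y.core → W) = μ := Y.coreMeasure_map_val
  refine ⟨W, inferInstance, inferInstance, inferInstance, f n, Subtype.val, hf n,
    isometry_subtype_coe, ?_, ?_, ?_⟩
  · rw [hY]
    exact (near1 n (S + 1) (by linarith)).mono (by linarith) (by linarith)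
  · rw [hY]
    exact (near2 n (S + 1) (by linarith)).mono (by change _ + dist o o ≤ _; simp) (by linarith)
  · change dist (f n (X n).coreRoot) o ≤ ε
    linarith

end MMSpace

/-! ### Uniform lower mass bounds and completeness -/

namespace MMSpace

theorem lintegral_lowerMassGap_le (X Y : MMSpace) :
    ∫⁻ δ in Ioc (0 : ℝ) 1, lowerMassGap X Y δ ≤ min 1 (dsGHP X Y) := by
  refine le_min ?_ le_add_self
  calc ∫⁻ δ in Ioc (0 : ℝ) 1, lowerMassGap X Y δ ≤ ∫⁻ _ in Ioc (0 : ℝ) 1, 1 :=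
        lintegral_mono fun δ => min_le_left _ _
    _ = 1 := by simp

theorem lowerMassGap_le_sum (X : ℕ → MMSpace) (δ : ℝ) (N k : ℕ) :
    lowerMassGap (X N) (X (N + k)) δ ≤
      ∑ n ∈ Finset.range k, lowerMassGap (X (n + N)) (X (n + N + 1)) δ := by
  induction k with
  | zero => simp [lowerMassGap]
  | succ k ih =>
    rw [Finset.sum_range_succ, add_comm k N]
    exact (lowerMassGap_triangle _ (X (N + k)) _ δ).trans (add_le_add_left ih _)

theorem exists_mem_of_ae_restrict {s t : Set ℝ} (hst : t ⊆ s) (ht : volume t ≠ 0)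
    (htm : MeasurableSet t) {p : ℝ → Prop} (h : ∀ᵐ x ∂volume.restrict s, p x) : ∃ x ∈ t, p x := by
  have := ae_restrict_neBot.2 ht
  exact ((ae_restrict_mem htm).and (ae_restrict_of_ae_restrict_of_subset hst h)).exists

/-- Sequences whose consecutive distances are summable satisfy uniform lower mass bounds. -/
theorem exists_le_globalLowerMass {X : ℕ → MMSpace} [∀ n, ProperSpace (X n).core]
    (h : ∑' n, localizedEDist (X n) (X (n + 1)) ≠ ∞) (R : ℝ) :
    ∃ S > R, ∀ δ > 0, ∃ δ' ≤ δ, ∃ c > 0, ∀ᶠ k in atTop,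
      c ≤ ((X k).restrict S).globalLowerMass δ' := by
  -- Exchanging sum and integral shows that the distances of the restrictions are summable for
  -- almost every `S`. The same argument in `δ` then gives arbitrarily small `δ'` with summable
  -- lower mass gaps.
  have h1 : ∫⁻ S in Ici (0 : ℝ), ∑' n, ENNReal.ofReal (Real.exp (-S)) *
      min 1 (dsGHP ((X n).restrict S) ((X (n + 1)).restrict S)) ≠ ∞ := by
    rwa [lintegral_tsum fun n => aemeasurable_localizedEDist (X n) (X (n + 1))]
  have h2 := ae_lt_top' (AEMeasurable.tsum fun n =>
    aemeasurable_localizedEDist (X n) (X (n + 1))) h1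
  obtain ⟨S, hS, hSsum⟩ := exists_mem_of_ae_restrict (t := Ioi (max R 0))
    (fun x hx => (le_max_right R 0).trans (le_of_lt hx)) (by simp) measurableSet_Ioi h2
  refine ⟨S, (le_max_left _ _).trans_lt hS, fun δ hδ => ?_⟩
  rw [ENNReal.tsum_mul_left] at hSsum
  have h3 : ∑' n, min 1 (dsGHP ((X n).restrict S) ((X (n + 1)).restrict S)) ≠ ∞ := by
    intro htop
    rw [htop, ENNReal.mul_top (ENNReal.ofReal_pos.2 (Real.exp_pos _)).ne'] at hSsum
    exact lt_irrefl _ hSsum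
  let Z : ℕ → MMSpace := fun n => (X n).restrict S
  have h4 : ∫⁻ δ in Ioc (0 : ℝ) 1, ∑' n, lowerMassGap (Z n) (Z (n + 1)) δ ≠ ∞ := by
    rw [lintegral_tsum fun n => (measurable_lowerMassGap _ _).aemeasurable]
    exact ne_top_of_le_ne_top h3 (ENNReal.tsum_le_tsum fun n => lintegral_lowerMassGap_le _ _)
  have h5 := ae_lt_top' (AEMeasurable.tsum fun n =>
    (measurable_lowerMassGap (Z n) (Z (n + 1))).aemeasurable) h4
  obtain ⟨δ', hδ', hsum⟩ := exists_mem_of_ae_restrict (t := Ioc 0 (min δ 1))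
    (Ioc_subset_Ioc_right (min_le_right δ 1)) (by simp [hδ]) measurableSet_Ioc h5
  -- Once the tail is below `1`, the truncation in the gap is inactive, and the reciprocals of the
  -- lower masses stay within `1` of the value at `N`.
  obtain ⟨N, hN⟩ := ((ENNReal.tendsto_sum_nat_add (fun n => lowerMassGap (Z n) (Z (n + 1)) δ')
    hsum.ne).eventually (gt_mem_nhds one_pos)).exists
  let a : ℕ → ℝ := fun k => (((Z k).globalLowerMass δ')⁻¹).toReal
  have ha : 0 ≤ a N := ENNReal.toReal_nonneg
  refine ⟨δ', hδ'.2.trans (min_le_left _ _), (ENNReal.ofReal (a N + 1))⁻¹,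
    ENNReal.inv_pos.2 ENNReal.ofReal_ne_top, ?_⟩
  filter_upwards [eventually_ge_atTop N] with k hk
  obtain ⟨j, rfl⟩ := Nat.exists_eq_add_of_le hk
  have h6 := ((lowerMassGap_le_sum Z δ' N j).trans (ENNReal.sum_le_tsum _)).trans_lt hN
  rw [lowerMassGap, min_lt_iff, or_iff_right (lt_irrefl _), ← ENNReal.ofReal_one,
    ENNReal.ofReal_lt_ofReal_iff one_pos] at h6
  have h7 : a (N + j) ≤ a N + 1 := by linarith [(abs_lt.1 h6).1]
  -- Positivity excludes the value `0` that `toReal` assigns to an infinite reciprocal.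
  have hpos : 0 < (Z (N + j)).globalLowerMass δ' :=
    globalLowerMass_pos ((X (N + j)).isCompact_coreSupport_restrict S) hδ'.1
  rw [ENNReal.inv_le_iff_inv_le]
  exact ENNReal.le_ofReal_iff_toReal_le (ENNReal.inv_ne_top.2 hpos.ne') (by linarith) |>.2 h7

instance (X : MMSpace) [ProperSpace X.carrier] : ProperSpace X.core :=
  LipschitzWith.properSpace X.isClosed_core.isClosedEmbedding_subtypeVal.isProperMap
    isometry_subtype_coe.lipschitz

/-- A quantitative form of the completeness of the localized metric. -/
theorem exists_tendsto_localizedEDist {X : ℕ → MMSpace} [∀ n, ProperSpace (X n).core]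
    (h : ∀ n : ℕ, localizedEDist (X n) (X (n + 1)) <
      ENNReal.ofReal ((1 / 2 : ℝ) ^ n / 4 * Real.exp (-((n + 1 : ℝ) + 2)))) :
    ∃ Y : MMSpace, ProperSpace Y.carrier ∧
      Tendsto (fun n => localizedEDist (X n) Y) atTop (𝓝 0) := by
  have pw : ∀ n : ℕ, 0 < (1 / 2 : ℝ) ^ n := fun n => by positivity
  have hsum : ∑' n, localizedEDist (X n) (X (n + 1)) ≠ ∞ := by
    refine ne_top_of_le_ne_top ?_ (ENNReal.tsum_le_tsum fun n => (h n).le)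
    have h1 : Summable fun n : ℕ => (1 / 2 : ℝ) ^ n / 4 * Real.exp (-((n + 1 : ℝ) + 2)) := by
      refine Summable.of_nonneg_of_le (fun n => by positivity) (fun n => ?_)
        summable_geometric_two
      have h2 : Real.exp (-((n + 1 : ℝ) + 2)) ≤ 1 := Real.exp_le_one_iff.2 (by
        have : (0:ℝ) ≤ n := n.cast_nonneg
        linarith)
      calc _ ≤ (1 / 2 : ℝ) ^ n / 4 * 1 := mul_le_mul_of_nonneg_left h2 (by positivity)
        _ ≤ (1 / 2 : ℝ) ^ n := by linarith [pw n]
    rw [← ENNReal.ofReal_tsum_of_nonneg (fun n => by positivity) h1]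
    exact ENNReal.ofReal_ne_top
  obtain ⟨Y, hY, hYX⟩ := exists_limit_of_close (X := X) (fun n =>
    close_of_localizedEDist_lt (by positivity) (by positivity)
      (by linarith [pw n, half_pow_le_one n]) (h n)) (exists_le_globalLowerMass hsum)
  exact ⟨Y, hY, tendsto_localizedEDist_of_close hYX⟩

end MMSpace

/-! ### Density of finite atomic spaces with rational data -/

namespace MMSpace

section Atoms

variable {E : Type} [MetricSpace E] [MeasurableSpace E] [BorelSpace E]

theorem finset_sum_smul_dirac_apply {k : ℕ} (w : Fin k → ℝ≥0∞) (p : Fin k → E) {B : Set E}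
    (hB : MeasurableSet B) :
    (∑ a, w a • Measure.dirac (p a)) B = ∑ a, w a * B.indicator 1 (p a) := by
  simp [Measure.finsetSum_apply, Measure.dirac_apply' _ hB]

theorem mem_support_sum_smul_dirac {k : ℕ} {w : Fin k → ℝ≥0∞} {p : Fin k → E} (hw : ∀ a, w a ≠ 0)
    {x : E} : x ∈ (∑ a, w a • Measure.dirac (p a)).support ↔ x ∈ range p := by
  rw [Measure.mem_support_iff_forall]
  constructor
  · intro h
    by_contra hx
    have h1 := h _ ((finite_range p).isClosed.isOpen_compl.mem_nhds hx)
    rw [finset_sum_smul_dirac_apply _ _ (finite_range p).isClosed.isOpen_compl.measurableSet] at h1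
    simp at h1
  · rintro ⟨a, rfl⟩ U hU
    obtain ⟨V, hVU, hV, ha⟩ := mem_nhds_iff.1 hU
    refine lt_of_lt_of_le ?_ (measure_mono hVU)
    rw [finset_sum_smul_dirac_apply _ _ hV.measurableSet]
    refine lt_of_lt_of_le (pos_iff_ne_zero.2 (hw a)) ?_
    refine le_trans ?_ (Finset.single_le_sum (fun _ _ => zero_le) (Finset.mem_univ a))
    simp [ha]

/-- Discretization of a measure along a partition into small pieces. -/
theorem nearAt_sum_smul_dirac {M : Measure E} {o : E} {S ε : ℝ} (hε : 0 < ε) {k : ℕ}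
    {A : Fin k → Set E}
    {w : Fin k → ℝ≥0∞} {p : Fin k → E} (hA : ∀ a, MeasurableSet (A a))
    (hd : Pairwise (Function.onFun Disjoint A)) (hcov : M (Metric.closedBall o S \ ⋃ a, A a) = 0)
    (hAp : ∀ a, ∀ y ∈ A a, dist y (p a) < ε) (hw0 : ∀ a, w a ≠ 0) (hMw : ∀ a, M (A a) ≤ w a)
    (hwM : ∀ a, w a ≤ M (A a) + ENNReal.ofReal (ε / k))
    (hp : ∀ a, ∃ x ∈ M.support, dist (p a) x < ε)
    (hs : ∀ x ∈ M.support, dist x o ≤ S → ∃ a, dist x (p a) < ε) :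
    NearAt o S ε M (∑ a, w a • Measure.dirac (p a)) ∧
      NearAt o S ε (∑ a, w a • Measure.dirac (p a)) M := by
  refine ⟨⟨fun B hB hBS => ?_, fun x hx hxS => ?_⟩, ⟨fun B hB hBS => ?_, fun x hx hxS => ?_⟩⟩
  · refine le_add_right ?_
    rw [finset_sum_smul_dirac_apply _ _ Metric.isOpen_thickening.measurableSet]
    calc M B ≤ M ((Metric.closedBall o S \ ⋃ a, A a) ∪ ⋃ a, B ∩ A a) := by
          refine measure_mono fun x hx => ?_
          by_cases h : x ∈ ⋃ a, A a
          · rw [← inter_iUnion]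
            exact Or.inr ⟨hx, h⟩
          · exact Or.inl ⟨hBS hx, h⟩
      _ ≤ 0 + ∑ a, M (B ∩ A a) := (measure_union_le _ _).trans
          (add_le_add hcov.le (measure_iUnion_fintype_le _ _))
      _ ≤ ∑ a, w a * (Metric.thickening ε B).indicator 1 (p a) := by
          rw [zero_add]
          refine Finset.sum_le_sum fun a _ => ?_
          rcases (B ∩ A a).eq_empty_or_nonempty with h | ⟨y, hyB, hyA⟩
          · simp [h]
          · have : p a ∈ Metric.thickening ε B :=
              Metric.mem_thickening_iff.2 ⟨y, hyB, by rw [dist_comm]; exact hAp a y hyA⟩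
            rw [indicator_of_mem this, Pi.one_apply, mul_one]
            exact (measure_mono inter_subset_right).trans (hMw a)
  · obtain ⟨a, ha⟩ := hs x hx hxS
    exact ⟨_, (mem_support_sum_smul_dirac hw0).2 (mem_range_self a), ha⟩
  · rw [finset_sum_smul_dirac_apply _ _ hB]
    calc ∑ a, w a * B.indicator 1 (p a)
        ≤ ∑ a, (M (Metric.thickening ε B ∩ A a) + ENNReal.ofReal (ε / k)) := by
          refine Finset.sum_le_sum fun a _ => ?_
          by_cases h : p a ∈ B
          · rw [indicator_of_mem h, Pi.one_apply, mul_one, inter_eq_right.2]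
            · exact hwM a
            · exact fun y hy => Metric.mem_thickening_iff.2 ⟨_, h, hAp a y hy⟩
          · simp [h]
      _ = M (⋃ a, Metric.thickening ε B ∩ A a) + k * ENNReal.ofReal (ε / k) := by
          rw [Finset.sum_add_distrib, measure_iUnion, tsum_fintype]
          · simp
          · exact hd.mono fun a b hab => hab.mono inter_subset_right inter_subset_right
          · exact fun a => Metric.isOpen_thickening.measurableSet.inter (hA a)
      _ ≤ M (Metric.thickening ε B) + ENNReal.ofReal ε := by
          refine add_le_add (measure_mono (iUnion_subset fun a => inter_subset_left)) ?_
          rw [← ENNReal.ofReal_natCast, ← ENNReal.ofReal_mul k.cast_nonneg]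
          exact ENNReal.ofReal_le_ofReal (by
            rw [mul_div_assoc']
            exact div_le_of_le_mul₀ k.cast_nonneg hε.le (mul_comm _ _).le)
  · obtain ⟨a, rfl⟩ := (mem_support_sum_smul_dirac hw0).1 hx
    exact hp a

end Atoms

/-- A space with finitely many atoms in `ℝᵏ` with the maximum norm. -/
noncomputable def atomic {k : ℕ} (q : Fin k → Fin k → ℝ) (w : Fin k → ℝ) : MMSpace where
  carrier := Fin k → ℝ
  root := 0
  μ := ∑ a, ENNReal.ofReal (w a) • Measure.dirac (q a)
  boundedlyFinite s _ := by
    refine (measure_mono (subset_univ s)).trans_lt ?_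
    rw [finset_sum_smul_dirac_apply _ _ MeasurableSet.univ]
    simp

instance {k : ℕ} (q : Fin k → Fin k → ℝ) (w : Fin k → ℝ) : ProperSpace (atomic q w).carrier :=
  inferInstanceAs (ProperSpace (Fin k → ℝ))

/-- Finitely many points and a base point can be embedded isometrically into `ℝᵏ`. -/
theorem exists_kuratowski {P : Type} [MetricSpace P] (o : P) {k : ℕ} (x : Fin k → P) :
    ∃ f : P → (Fin k → ℝ), f o = 0 ∧
      Isometry fun a : (insert o (range x) : Set P) => f a := by
  let f : P → (Fin k → ℝ) := fun y a => dist y (x a) - dist o (x a)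
  have hle : ∀ y z, dist (f y) (f z) ≤ dist y z := fun y z => by
    refine (dist_pi_le_iff dist_nonneg).2 fun a => ?_
    rw [Real.dist_eq, sub_sub_sub_cancel_right]
    exact abs_dist_sub_le y z (x a)
  have hge : ∀ y a, dist y (x a) ≤ dist (f y) (f (x a)) := fun y a => by
    refine le_trans ?_ (dist_le_pi_dist _ _ a)
    simp only [f, Real.dist_eq, sub_sub_sub_cancel_right, dist_self, sub_zero]
    exact le_abs_self _
  refine ⟨f, funext fun a => sub_self _, Isometry.of_dist_eq ?_⟩
  rintro ⟨y, hy⟩ ⟨z, hz⟩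
  refine le_antisymm (hle y z) ?_
  change dist y z ≤ dist (f y) (f z)
  rcases hz with rfl | ⟨b, rfl⟩
  · rcases hy with rfl | ⟨a, rfl⟩
    · simp
    · rw [dist_comm, dist_comm (f _)]
      exact hge _ a
  · exact hge y b

/-- Atomic spaces with rational data approximate every space with a proper core. -/
theorem exists_close_atomic (X : MMSpace) [ProperSpace X.core] (S : ℝ) {ε : ℝ} (hε : 0 < ε) :
    ∃ (k : ℕ) (q : Fin k → Fin k → ℚ) (w : Fin k → ℚ),
      (atomic (fun a b => (q a b : ℝ)) (fun a => (w a : ℝ))).Close X S ε := by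
  set o := X.coreRoot
  have hK : IsCompact (X.coreSupport ∩ Metric.closedBall o S) :=
    (isCompact_closedBall o S).inter_left X.isClosed_coreSupport
  obtain ⟨t, htK, ht⟩ := hK.elim_nhds_subcover (fun x => Metric.ball x (ε / 2))
    fun x _ => Metric.ball_mem_nhds x (half_pos hε)
  let k := t.card
  let x : Fin k → X.core := fun a => t.equivFin.symm a
  have hx : ∀ a, x a ∈ X.coreSupport := fun a => (htK _ (t.equivFin.symm a).2).1
  have hcov : ∀ y ∈ X.coreSupport, dist y o ≤ S → ∃ a, dist y (x a) < ε / 2 := fun y hy hyS => by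
    obtain ⟨z, hz, hyz⟩ := mem_iUnion₂.1 (ht ⟨hy, hyS⟩)
    exact ⟨t.equivFin ⟨z, hz⟩, by simpa [x] using hyz⟩
  obtain ⟨f, hf0, hf⟩ := exists_kuratowski o x
  have : Nonempty (insert o (range x) : Set X.core) := ⟨⟨o, mem_insert _ _⟩⟩
  -- Gluing `ℝᵏ` to the core along the root and the net allows coordinates to be rounded freely;
  -- rounding a distance matrix instead could violate the triangle inequality.
  obtain ⟨E, _, i, j, hi, hj, hij⟩ := exists_amalgam
    (isometry_subtype_coe (s := insert o (range x))) hf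
  have hijx : ∀ a, i (x a) = j (f (x a)) := fun a => hij ⟨x a, Or.inr (mem_range_self a)⟩
  have hijo : i o = j 0 := by rw [← hf0]; exact hij ⟨o, mem_insert _ _⟩
  borelize E
  let M := X.coreMeasure.map i
  let A : Fin k → Set E := disjointed fun a => Metric.ball (i (x a)) (ε / 2)
  have hA : ∀ a, MeasurableSet (A a) := fun a =>
    disjointedRec (fun _ _ h => h.diff Metric.isOpen_ball.measurableSet)
      Metric.isOpen_ball.measurableSet
  have hAx : ∀ a, A a ⊆ Metric.ball (i (x a)) (ε / 2) := fun a => disjointed_subset _ a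
  have hfin : ∀ a, M (A a) < ∞ := fun a =>
    X.map_coreMeasure_lt_top hi (Metric.isBounded_ball.subset (hAx a))
  have hq : ∀ a b, ∃ q : ℚ, dist (q : ℝ) (f (x a) b) < ε / 2 := fun a b => by
    obtain ⟨q, hq⟩ := Rat.denseRange_cast.exists_dist_lt (f (x a) b) (half_pos hε)
    exact ⟨q, by rwa [dist_comm]⟩
  choose q hq using hq
  -- The weight strictly exceeds the mass, so an atom stays in the support even if its piece is
  -- null.
  have hw : ∀ a, ∃ w : ℚ, (M (A a)).toReal < w ∧ (w : ℝ) < (M (A a)).toReal + ε / k := fun a => by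
    have : 0 < (k : ℝ) := Nat.cast_pos.2 a.pos
    exact exists_rat_btwn (lt_add_of_pos_right _ (by positivity))
  choose w hw1 hw2 using hw
  have hqx : ∀ a, dist (j fun b => (q a b : ℝ)) (i (x a)) < ε / 2 := fun a => by
    rw [hijx, hj.dist_eq]
    exact (dist_pi_lt_iff (half_pos hε)).2 (hq a)
  let Y := atomic (fun a b => (q a b : ℝ)) (fun a => (w a : ℝ))
  let jY : Y.carrier → E := j
  have hjY : Isometry jY := hj
  have hY : Y.coreMeasure.map (fun y : Y.core => jY y) =
      ∑ a, ENNReal.ofReal (w a) • Measure.dirac (j fun b => (q a b : ℝ)) := by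
    have h1 := Measure.map_map (μ := Y.coreMeasure) hjY.continuous.measurable
      (measurable_subtype_coe (p := (· ∈ Y.core)))
    rw [Y.coreMeasure_map_val] at h1
    refine h1.symm.trans ?_
    ext B hB
    rw [Measure.map_apply hjY.continuous.measurable hB, finset_sum_smul_dirac_apply _ _ hB]
    exact finset_sum_smul_dirac_apply _ _ (hj.continuous.measurable hB)
  have hsupp : M.support = i '' X.coreSupport := support_map _ hi
  have key := nearAt_sum_smul_dirac (M := M) (o := i o) (S := S) hε
    (w := fun a => ENNReal.ofReal (w a)) (p := fun a => j fun b => (q a b : ℝ)) hA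
    (disjoint_disjointed _) ?_ (fun a y hy => ?_) (fun a => ?_) (fun a => ?_) (fun a => ?_)
    (fun a => ⟨i (x a), hsupp ▸ mem_image_of_mem i (hx a), by linarith [hqx a]⟩)
    (fun y hy hyS => ?_)
  · refine ⟨k, q, w, E, inferInstance, inferInstance, inferInstance, fun y => jY y, i,
      hjY.comp isometry_subtype_coe, hi, ?_, ?_, ?_⟩
    · rw [hY]
      change NearAt (j 0) S ε _ _
      rw [← hijo]
      exact key.2
    · rw [hY]
      exact key.1
    · change dist (j 0) (i o) ≤ ε
      rw [← hijo, dist_self]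
      exact hε.le
  · rw [iUnion_disjointed, Measure.map_apply hi.continuous.measurable
      (Metric.isClosed_closedBall.measurableSet.diff
        (isOpen_iUnion fun a => Metric.isOpen_ball).measurableSet)]
    refine measure_mono_null (t := X.coreSupportᶜ) (fun y hy hyX => ?_) X.coreMeasure_compl_coreSupport
    have hy1 : dist (i y) (i o) ≤ S := hy.1
    rw [hi.dist_eq] at hy1
    obtain ⟨a, ha⟩ := hcov y hyX hy1
    exact hy.2 (mem_iUnion.2 ⟨a, by rwa [Metric.mem_ball, hi.dist_eq]⟩)
  · have := hAx a hy
    rw [Metric.mem_ball] at this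
    linarith [dist_triangle_right y (j fun b => (q a b : ℝ)) (i (x a)), hqx a]
  · exact (ENNReal.ofReal_pos.2 (ENNReal.toReal_nonneg.trans_lt (hw1 a))).ne'
  · exact (ENNReal.le_ofReal_iff_toReal_le (hfin a).ne
      (ENNReal.toReal_nonneg.trans (hw1 a).le)).2 (hw1 a).le
  · calc ENNReal.ofReal (w a) ≤ ENNReal.ofReal ((M (A a)).toReal + ε / k) :=
          ENNReal.ofReal_le_ofReal (hw2 a).le
      _ ≤ M (A a) + ENNReal.ofReal (ε / k) := ENNReal.ofReal_add_le.trans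
          (add_le_add ENNReal.ofReal_toReal_le le_rfl)
  · rw [hsupp] at hy
    obtain ⟨z, hz, rfl⟩ := hy
    rw [hi.dist_eq] at hyS
    obtain ⟨a, ha⟩ := hcov z hz hyS
    rw [← hi.dist_eq] at ha
    exact ⟨a, by linarith [dist_triangle_right (i z) (j fun b => (q a b : ℝ)) (i (x a)), hqx a]⟩

end MMSpace

/-! ### The metric and the topology on equivalence classes -/

theorem isOpen_iff_forall_tendsto {α : Type*} [PseudoMetricSpace α] {U : Set α} :
    IsOpen U ↔ ∀ (x : ℕ → α) (y : α), Tendsto x atTop (𝓝 y) → y ∈ U → ∀ᶠ n in atTop, x n ∈ U := by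
  refine ⟨fun hU x y h hy => h.eventually_mem (hU.mem_nhds hy), fun h => ?_⟩
  rw [isOpen_iff_mem_nhds]
  intro y hy
  have h1 : Tendsto id (𝓝 y) (𝓟 U) :=
    tendsto_of_seq_tendsto fun x hx => tendsto_principal.2 (h x y hx hy)
  simpa using h1

namespace MMSpace

theorem Represents.equivalent {X Y : MMSpace} {x : HBClass} (hX : X.Represents x)
    (hY : Y.Represents x) : X.Equivalent Y :=
  Quotient.exact (Eq.trans hX hY.symm)

theorem Represents.eq {X Y : MMSpace} {x y : HBClass} (hX : X.Represents x)
    (hY : Y.Represents y) (h : X.Equivalent Y) : x = y :=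
  Subtype.ext (hX.symm.trans ((Quotient.sound h).trans hY))

/-- An arbitrary representative need not have a proper carrier, but its core is isometric to that of
a proper one. -/
theorem Represents.properSpace {X : MMSpace} {x : HBClass} (hX : X.Represents x) :
    ProperSpace X.core := by
  obtain ⟨Y, _, hY⟩ := x.2
  obtain ⟨φ, -⟩ := hX.equivalent hY
  exact LipschitzWith.properSpace φ.toHomeomorph.isProperMap φ.isometry.lipschitz

theorem Represents.localizedEDist_eq {X X' Y Y' : MMSpace} {x y : HBClass}
    (hX : X.Represents x) (hX' : X'.Represents x) (hY : Y.Represents y) (hY' : Y'.Represents y) :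
    localizedEDist X Y = localizedEDist X' Y' := by
  have key : ∀ {X X' Y Y' : MMSpace}, X.Represents x → X'.Represents x → Y.Represents y →
      Y'.Represents y → localizedEDist X Y ≤ localizedEDist X' Y' := by
    intro X X' Y Y' hX hX' hY hY'
    have := hX.properSpace
    have := hX'.properSpace
    have := hY.properSpace
    have := hY'.properSpace
    calc localizedEDist X Y ≤ localizedEDist X X' + localizedEDist X' Y :=
          localizedEDist_triangle _ _ _
      _ ≤ localizedEDist X X' + (localizedEDist X' Y' + localizedEDist Y' Y) := by
          gcongr
          exact localizedEDist_triangle _ _ _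
      _ = localizedEDist X' Y' := by
          rw [(hX.equivalent hX').localizedEDist_eq_zero,
            (hY'.equivalent hY).localizedEDist_eq_zero, zero_add, add_zero]
  exact le_antisymm (key hX hX' hY hY') (key hX' hX hY' hY)

theorem equivalent_of_localizedEDist_eq_zero {X Y : MMSpace} [ProperSpace X.core]
    [ProperSpace Y.core] (h : localizedEDist X Y = 0) : X.Equivalent Y :=
  equivalent_of_close fun S _ hε =>
    (eventually_close (X := fun _ => X) (by rw [h]; exact tendsto_const_nhds) S hε).exists.choose_spec

/-- The class of a space in which closed bounded sets are compact. -/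
def toHBClass (X : MMSpace) [h : ProperSpace X.carrier] : HBClass := ⟨Quotient.mk _ X, X, h, rfl⟩

theorem represents_toHBClass (X : MMSpace) [ProperSpace X.carrier] :
    X.Represents X.toHBClass := rfl

end MMSpace

namespace HBClass

open MMSpace

/-- A representative of a class. -/
noncomputable def rep (x : HBClass) : MMSpace := x.2.choose

theorem represents_rep (x : HBClass) : x.rep.Represents x := x.2.choose_spec.2

instance (x : HBClass) : ProperSpace x.rep.core := x.represents_rep.properSpace

/-- The localized metric on classes, with its metric topology. -/
noncomputable abbrev localizedMetric : MetricSpace HBClass where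
  dist x y := localizedSGHP x.rep y.rep
  dist_self x := by rw [localizedSGHP_eq, localizedEDist_self, ENNReal.toReal_zero]
  dist_comm x y := by rw [localizedSGHP_eq, localizedSGHP_eq, localizedEDist_comm]
  dist_triangle x y z := by
    rw [localizedSGHP_eq, localizedSGHP_eq, localizedSGHP_eq,
      ← ENNReal.toReal_add (localizedEDist_ne_top _ _) (localizedEDist_ne_top _ _)]
    exact ENNReal.toReal_mono
      (ENNReal.add_ne_top.2 ⟨localizedEDist_ne_top _ _, localizedEDist_ne_top _ _⟩)
      (localizedEDist_triangle _ _ _)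
  eq_of_dist_eq_zero {x y} h := by
    rw [localizedSGHP_eq, ENNReal.toReal_eq_zero_iff, or_iff_left (localizedEDist_ne_top _ _)] at h
    exact x.represents_rep.eq y.represents_rep (equivalent_of_localizedEDist_eq_zero h)

theorem localizedMetric_dist {X Y : MMSpace} {x y : HBClass} (hX : X.Represents x)
    (hY : Y.Represents y) : localizedMetric.dist x y = localizedSGHP X Y := by
  rw [localizedSGHP_eq, hX.localizedEDist_eq x.represents_rep hY y.represents_rep]
  rfl

theorem tendsto_localizedMetric_iff {X : ℕ → MMSpace} {Y : MMSpace} {x : ℕ → HBClass}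
    {y : HBClass} (hX : ∀ n, (X n).Represents (x n)) (hY : Y.Represents y) :
    Tendsto x atTop (@nhds _ localizedMetric.toUniformSpace.toTopologicalSpace y) ↔
      GHVagueTendsto X Y := by
  have := fun n => (hX n).properSpace
  have := hY.properSpace
  rw [ghVagueTendsto_iff,
    ← ENNReal.tendsto_toReal_iff (fun n => localizedEDist_ne_top _ _) ENNReal.zero_ne_top]
  refine (@tendsto_iff_dist_tendsto_zero _ _ localizedMetric.toPseudoMetricSpace _ _ _).trans ?_
  have h1 : ∀ n, localizedMetric.dist (x n) y = (localizedEDist (X n) Y).toReal :=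
    fun n => localizedMetric_dist (hX n) hY
  simp only [ENNReal.toReal_zero]
  exact tendsto_congr h1

/-- Open sets of a metric space are detected by sequences, exactly as in the definition of
`ghVagueTopology`, and the two notions of convergence coincide. -/
theorem ghVagueTopology_eq :
    ghVagueTopology = localizedMetric.toUniformSpace.toTopologicalSpace := by
  ext U
  rw [@isOpen_iff_forall_tendsto _ localizedMetric.toPseudoMetricSpace]
  refine ⟨fun hU x y h hy => ?_, fun hU X Y x y hX hY h hy => ?_⟩
  · exact hU _ _ x y (fun n => (x n).represents_rep) y.represents_rep
      ((tendsto_localizedMetric_iff (fun n => (x n).represents_rep) y.represents_rep).1 h) hy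
  · exact hU x y ((tendsto_localizedMetric_iff hX hY).2 h) hy

noncomputable instance : MetricSpace HBClass :=
  localizedMetric.replaceTopology ghVagueTopology_eq

theorem dist_eq {X Y : MMSpace} {x y : HBClass} (hX : X.Represents x) (hY : Y.Represents y) :
    dist x y = localizedSGHP X Y :=
  localizedMetric_dist hX hY

theorem tendsto_iff {X : ℕ → MMSpace} {Y : MMSpace} {x : ℕ → HBClass} {y : HBClass}
    (hX : ∀ n, (X n).Represents (x n)) (hY : Y.Represents y) :
    Tendsto x atTop (𝓝 y) ↔ GHVagueTendsto X Y := by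
  rw [← tendsto_localizedMetric_iff hX hY, ← ghVagueTopology_eq]

instance : CompleteSpace HBClass := by
  -- Only sequences with this rate need limits. The exponential factor is what turns the distance
  -- bound at step `n` into closeness at radius `n + 1` with error `(1 / 2) ^ n / 4`.
  refine Metric.complete_of_convergent_controlled_sequences
    (fun n => (1 / 2 : ℝ) ^ n / 4 * Real.exp (-((n + 1 : ℝ) + 2))) (fun n => by positivity)
    fun u hu => ?_
  obtain ⟨Y, hY, h⟩ := exists_tendsto_localizedEDist (X := fun n => (u n).rep) fun n => by
    have h1 := hu n n (n + 1) le_rfl n.le_succ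
    rw [dist_eq (u n).represents_rep (u (n + 1)).represents_rep, localizedSGHP_eq] at h1
    rw [← ENNReal.ofReal_toReal (localizedEDist_ne_top _ _)]
    exact (ENNReal.ofReal_lt_ofReal_iff_of_nonneg ENNReal.toReal_nonneg).2 h1
  exact ⟨Y.toHBClass, (tendsto_iff (fun n => (u n).represents_rep) Y.represents_toHBClass).2
    (ghVagueTendsto_iff.2 h)⟩

instance : TopologicalSpace.SeparableSpace HBClass := by
  let g : (Σ k : ℕ, (Fin k → Fin k → ℚ) × (Fin k → ℚ)) → HBClass := fun p =>
    (atomic (fun a b => (p.2.1 a b : ℝ)) (fun a => (p.2.2 a : ℝ))).toHBClass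
  refine ⟨range g, countable_range g, fun y => ?_⟩
  choose k q w h using fun n : ℕ => exists_close_atomic y.rep n (Nat.one_div_pos_of_nat (n := n))
  refine mem_closure_of_tendsto (f := fun n => g ⟨k n, q n, w n⟩) (b := atTop) ?_
    (Eventually.of_forall fun n => mem_range_self _)
  refine (tendsto_iff (fun n => represents_toHBClass _) y.represents_rep).2
    (ghVagueTendsto_iff.2 (tendsto_localizedEDist_of_close fun S ε hε => ?_))
  filter_upwards [tendsto_natCast_atTop_atTop.eventually_ge_atTop S,
    (tendsto_one_div_add_atTop_nhds_zero_nat (𝕜 := ℝ)).eventually (gt_mem_nhds hε)] with n h1 h2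
  exact (h n).mono h1 h2.le

end HBClass

theorem mainTheorem8 :
    PolishSpace HBClass ∧
    (∀ (X : ℕ → MMSpace) (Y : MMSpace) (x : ℕ → HBClass) (y : HBClass),
      (∀ n, (X n).Represents (x n)) → Y.Represents y →
      (Tendsto x atTop (𝓝 y) ↔ MMSpace.GHVagueTendsto X Y)) ∧
    (∀ (X Y : MMSpace) (x y : HBClass), X.Represents x → Y.Represents y →
      AEMeasurable (fun R : ℝ => MMSpace.dsGHP (X.restrict R) (Y.restrict R))
        (volume.restrict (Ici (0 : ℝ)))) ∧
    ∃ m : MetricSpace HBClass,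
      (∀ (X Y : MMSpace) (x y : HBClass), X.Represents x → Y.Represents y →
        m.dist x y = MMSpace.localizedSGHP X Y) ∧
      m.toUniformSpace.toTopologicalSpace = HBClass.ghVagueTopology ∧
      @CompleteSpace HBClass m.toUniformSpace := by
  refine ⟨?_, fun X Y x y hX hY => HBClass.tendsto_iff hX hY, fun X Y x y hX hY => ?_,
    inferInstance, fun X Y x y hX hY => HBClass.dist_eq hX hY, rfl, inferInstance⟩
  · have := UniformSpace.secondCountable_of_separable HBClass
    infer_instance
  · have := hX.properSpace
    have := hY.properSpace
    exact MMSpace.aemeasurable_dsGHP_restrict X Y _
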